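/- **Theorem 2.1.** Let $G$ be a compact connected Lie group with Lie algebra $\mathfrak g$, let $(\xi_a)$ be a basis of $\mathfrak g$ and $\Theta^a\in S^1(\mathfrak g^*)$ the dual basis. Let $W$ be a compact smooth $G$-manifold, possibly with boundary, which is a degenerate principal $G$-bundle, i.e. $G$ acts locally freely (with discrete stabilizers) on some open subset of $W$ containing $\partial W$. For $\xi\in\mathfrak g$ let $X_\xi(x)=\frac{d}{dt}\big|_{t=0}\exp(-t\xi)\cdot x$ be the fundamental vector field and $\iota_a$ the contraction with $X_{\xi_a}$. Let $W^s$ be the set of points of $W$ whose stabilizer has positive dimension and $W^0=W\setminus W^s$. Let $f:W\to[0,1]$ be a smooth $G$-invariant function that vanishes on an open neighbourhood $U$ of $W^s$ and equals $1$ outside an open neighbourhood $V\supseteq\overline U$. Let $\omega$ be a connection on $W^0$: a smooth $\mathfrak g$-valued $1$-form on $W^0$ with $\omega(X_\xi)=\xi$ for $\xi\in\mathfrak g$ and $\omega_{gx}(g_*v)=\mathrm{Ad}(g)\,\omega_x(v)$ for $g\in G$, $x\in W^0$, $v\in T_xW$. Let $\omega_f=f\omega\in\Omega^1(W)\otimes\mathfrak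 g$ (extended by $0$) be the degenerate connection and $$\Omega_f^G=d\omega_f+\tfrac12[\omega_f,\omega_f]-(-1+f)\,\xi_a\Theta^a=\sum_a \Omega^a\,\xi_a ,\qquad \Omega^a\in S(\mathfrak g^*)\otimes\Omega(W),$$ its equivariant degenerate curvature. Let $CW_f: S(\mathfrak g^*)\to S(\mathfrak g^*)\otimes\Omega(W)$, $F\mapsto F(\Omega_f^G)$, be the algebra homomorphism given by $CW_f(l)=\sum_a l(\xi_a)\,\Omega^a$ for $l\in\mathfrak g^*$. Let $\Omega_G(W)=(S(\mathfrak g^*)\otimes\Omega(W))^G$, let $D=1\otimes d-\sum_a\Theta^a\otimes\iota_a$, and let $H_G^*(W)=H(\Omega_G(W),D)$ be the equivariant cohomology of $W$ in the Cartan model, where elements of $\mathfrak g^*$ have degree $2$. Then for every $F\in S(\mathfrak g^*)^G$ one has $F(\Omega_f^G)\in\Omega_G(W)$ and $D\,F(\Omega_f^G)=0$; if $F$ is homogeneous of polynomial degree $q$, then $F(\Omega_f^G)$ has total degree $2q$; and $F\mapsto[F(\Omega_f^G)]$ is a homomorphism of algebras $$cw_f: S(\mathfrak g^*)^G\to H_G^*(W),$$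 the degenerate Chern–Weil homomorphism. -/

import Mathlib

open Set Filter Topology Module
open scoped Manifold ContDiff TensorProduct

set_option linter.unusedSectionVars false

namespace DegCW

noncomputable section

/-! ### Exterior forms on a real vector space -/

section Linear

variable {V V' V'' : Type*} [AddCommGroup V] [Module ℝ V] [AddCommGroup V'] [Module ℝ V']
  [AddCommGroup V''] [Module ℝ V'']

/-- Exterior forms on `V`: the exterior algebra `Λ(V*)`. -/
abbrev Form (V : Type*) [AddCommGroup V] [Module ℝ V] : Type _ :=
  ExteriorAlgebra ℝ (Dual ℝ V)

/-- A covector as a form of degree one. -/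
def oneForm : Dual ℝ V →ₗ[ℝ] Form V := ExteriorAlgebra.ι ℝ

/-- Pullback of exterior forms along a linear map. -/
def pull (A : V →ₗ[ℝ] V') : Form V' →ₐ[ℝ] Form V := ExteriorAlgebra.map A.dualMap

/-- Contraction (interior product) of an exterior form with a vector. -/
def contr (v : V) : Form V →ₗ[ℝ] Form V :=
  CliffordAlgebra.contractLeft (Dual.eval ℝ V v)

/-- The sign automorphism of `Λ(V*)`, equal to `(-1) ^ q` on forms of degree `q`. -/
def parity : Form V →ₐ[ℝ] Form V := CliffordAlgebra.involute

theorem form_induction {C : Form V → Prop}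
    (h0 : ∀ r : ℝ, C (algebraMap ℝ (Form V) r)) (h1 : ∀ x : Dual ℝ V, C (oneForm x))
    (hm : ∀ a b, C a → C b → C (a * b)) (ha : ∀ a b, C a → C b → C (a + b)) (a : Form V) : C a :=
  ExteriorAlgebra.induction h0 h1 hm ha a

@[simp] theorem pull_oneForm (A : V →ₗ[ℝ] V') (l : Dual ℝ V') :
    pull A (oneForm l) = oneForm (l ∘ₗ A) := ExteriorAlgebra.map_apply_ι _ _

@[simp] theorem parity_oneForm (l : Dual ℝ V) : parity (oneForm l) = - oneForm l :=
  CliffordAlgebra.involute_ι _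

theorem parity_parity (u : Form V) : parity (parity u) = u :=
  CliffordAlgebra.involute_involute u

theorem contr_algebraMap (v : V) (r : ℝ) : contr v (algebraMap ℝ (Form V) r) = 0 :=
  CliffordAlgebra.contractLeft_algebraMap _ _ _

theorem contr_oneForm_mul (v : V) (l : Dual ℝ V) (u : Form V) :
    contr v (oneForm l * u) = l v • u - oneForm l * contr v u :=
  CliffordAlgebra.contractLeft_ι_mul _ _ _

theorem contr_oneForm (v : V) (l : Dual ℝ V) :
    contr v (oneForm l) = algebraMap ℝ (Form V) (l v) :=
  CliffordAlgebra.contractLeft_ι _ _ _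

theorem contr_mul (v : V) (u w : Form V) :
    contr v (u * w) = contr v u * w + parity u * contr v w := by
  induction u using form_induction generalizing w with
  | h0 r =>
    rw [contr_algebraMap, zero_mul, zero_add, AlgHom.commutes, ← Algebra.smul_def,
      ← Algebra.smul_def, map_smul]
  | h1 l => rw [contr_oneForm_mul, contr_oneForm, parity_oneForm, Algebra.smul_def]; noncomm_ring
  | hm a b ha hb => rw [mul_assoc, ha, hb, ha, map_mul]; noncomm_ring
  | ha a b ha hb => rw [add_mul, map_add, ha, hb, map_add, map_add]; noncomm_ring

theorem contr_one (v : V) : contr v (1 : Form V) = 0 := CliffordAlgebra.contractLeft_one _ _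

theorem contr_parity (v : V) (u : Form V) : contr v (parity u) = - parity (contr v u) := by
  induction u using form_induction with
  | h0 r => rw [AlgHom.commutes, contr_algebraMap, map_zero, neg_zero]
  | h1 l => rw [parity_oneForm, map_neg, contr_oneForm, AlgHom.commutes]
  | hm a b ha hb => rw [map_mul, contr_mul, contr_mul, ha, hb, map_add, map_mul, map_mul]; noncomm_ring
  | ha a b ha hb => rw [map_add, map_add, ha, hb, map_add, map_add]; abel

theorem pull_smul (A : V →ₗ[ℝ] V') (c : ℝ) (u : Form V') : pull A (c • u) = c • pull A u :=
  map_smul (pull A) c u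

theorem pull_parity (A : V →ₗ[ℝ] V') (u : Form V') : pull A (parity u) = parity (pull A u) := by
  induction u using form_induction with
  | h0 r => simp
  | h1 l => simp
  | hm a b ha hb => simp [ha, hb]
  | ha a b ha hb => simp [ha, hb]

theorem pull_contr (A : V →ₗ[ℝ] V') (v : V) (u : Form V') :
    pull A (contr (A v) u) = contr v (pull A u) := by
  induction u using form_induction with
  | h0 r => rw [contr_algebraMap, AlgHom.commutes, contr_algebraMap, map_zero]
  | h1 l => rw [contr_oneForm, pull_oneForm, contr_oneForm, AlgHom.commutes]; rfl
  | hm a b ha hb => rw [contr_mul, map_add, map_mul, map_mul, map_mul, contr_mul, ha, hb,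
      pull_parity]
  | ha a b ha hb => simp [ha, hb]

theorem pull_pull (A : V →ₗ[ℝ] V') (B : V' →ₗ[ℝ] V'') (u : Form V'') :
    pull A (pull B u) = pull (B ∘ₗ A) u := by
  induction u using form_induction with
  | h0 r => simp
  | h1 l => simp [LinearMap.comp_assoc]
  | hm a b ha hb => simp [ha, hb]
  | ha a b ha hb => simp [ha, hb]

@[simp] theorem pull_id (u : Form V) : pull LinearMap.id u = u := by
  induction u using form_induction with
  | h0 r => simp
  | h1 l => simp
  | hm a b ha hb => simp [ha, hb]
  | ha a b ha hb => simp [ha, hb]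

theorem oneForm_mul_swap (l m : Dual ℝ V) : oneForm l * oneForm m = - (oneForm m * oneForm l) :=
  eq_neg_of_add_eq_zero_left (ExteriorAlgebra.ι_add_mul_swap l m)

/-- A product of two covectors commutes with every form. -/
theorem oneForm_mul_oneForm_comm (l m : Dual ℝ V) (u : Form V) :
    Commute (oneForm l * oneForm m) u := by
  induction u using form_induction with
  | h0 r => exact (Algebra.commutes r _).symm
  | h1 k =>
    show oneForm l * oneForm m * oneForm k = oneForm k * (oneForm l * oneForm m)
    rw [mul_assoc, oneForm_mul_swap m k, mul_neg, ← mul_assoc, oneForm_mul_swap l k]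
    noncomm_ring
  | hm a b ha hb => exact ha.mul_right hb
  | ha a b ha hb => exact ha.add_right hb

instance [FiniteDimensional ℝ V] : FiniteDimensional ℝ (Form V) :=
  Module.Finite.of_basis (finBasis ℝ (Dual ℝ V)).ExteriorAlgebra

/-- An auxiliary norm on the finite-dimensional space `Λ(V*)`; it only serves to speak of smooth
maps with values in `Λ(V*)`, and all norms are equivalent. -/
instance [FiniteDimensional ℝ V] : NormedAddCommGroup (Form V) :=
  NormedAddCommGroup.induced (Form V) (Fin (finrank ℝ (Form V)) → ℝ)
    (finBasis ℝ (Form V)).equivFun.toLinearMap (finBasis ℝ (Form V)).equivFun.injective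

instance [FiniteDimensional ℝ V] : NormedSpace ℝ (Form V) :=
  NormedSpace.induced ℝ (Form V) (Fin (finrank ℝ (Form V)) → ℝ)
    (finBasis ℝ (Form V)).equivFun.toLinearMap

/-- Antisymmetrization of a linear map `V → Λ(V*)`, that is `L ↦ ∑ᵢ eⁱ ∧ L(eᵢ)` for a basis
`(eᵢ)` of `V` with dual basis `(eⁱ)`. -/
def alternate [FiniteDimensional ℝ V] (L : V →ₗ[ℝ] Form V) : Form V :=
  ∑ i, oneForm ((finBasis ℝ V).coord i) * L (finBasis ℝ V i)

theorem alternate_add [FiniteDimensional ℝ V] (L M : V →ₗ[ℝ] Form V) :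
    alternate (L + M) = alternate L + alternate M := by
  simp [alternate, mul_add, Finset.sum_add_distrib]

theorem alternate_smul [FiniteDimensional ℝ V] (c : ℝ) (L : V →ₗ[ℝ] Form V) :
    alternate (c • L) = c • alternate L := by
  simp [alternate, Finset.smul_sum]

theorem pull_alternate [FiniteDimensional ℝ V] [FiniteDimensional ℝ V'] (A : V →ₗ[ℝ] V')
    (L : V' →ₗ[ℝ] Form V') :
    pull A (alternate L) = alternate ((pull A).toLinearMap ∘ₗ L ∘ₗ A) := by
  have key : ∀ j, (finBasis ℝ V').coord j ∘ₗ A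
      = ∑ i, (finBasis ℝ V').coord j (A (finBasis ℝ V i)) • (finBasis ℝ V).coord i := by
    intro j
    apply (finBasis ℝ V).ext
    intro k
    simp [Finsupp.single_apply, Finset.sum_ite_eq]
  have key2 : ∀ i, A (finBasis ℝ V i) = ∑ j, (finBasis ℝ V').coord j (A (finBasis ℝ V i)) •
      finBasis ℝ V' j := fun i => by simp
  simp only [alternate, map_sum, map_mul, pull_oneForm]
  simp_rw [key]
  simp only [map_sum, map_smul, Finset.sum_mul, smul_mul_assoc]
  rw [Finset.sum_comm]
  refine Finset.sum_congr rfl fun i _ => ?_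
  have h := congrArg (fun z => oneForm ((finBasis ℝ V).coord i) * pull A (L z)) (key2 i)
  simp only [map_sum, map_smul, Finset.mul_sum, mul_smul_comm] at h
  exact h.symm

end Linear

/-! ### Differential forms on subsets of a finite-dimensional vector space -/

section Calculus

variable {E E' : Type*} [NormedAddCommGroup E] [NormedSpace ℝ E] [FiniteDimensional ℝ E]
  [NormedAddCommGroup E'] [NormedSpace ℝ E'] [FiniteDimensional ℝ E']

/-- Exterior derivative `∑ᵢ eⁱ ∧ ∂ᵢ w`, within the set `s`, of a form `w` on `E`. -/
def extd (s : Set E) (w : E → Form E) (y : E) : Form E :=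
  alternate (fderivWithin ℝ w s y).toLinearMap

/-- The product of forms, as a continuous bilinear map. -/
def mulCLM : Form E →L[ℝ] Form E →L[ℝ] Form E :=
  LinearMap.toContinuousLinearMap
    ((LinearMap.toContinuousLinearMap (𝕜 := ℝ) (E := Form E) (F' := Form E)).toLinearMap ∘ₗ
      LinearMap.mul ℝ (Form E))

@[simp] theorem mulCLM_apply (u w : Form E) : mulCLM u w = u * w := rfl

theorem contDiffWithinAt_mul {F : Type*} [NormedAddCommGroup F] [NormedSpace ℝ F] {s : Set F}
    {y : F} {u w : F → Form E} (hu : ContDiffWithinAt ℝ ∞ u s y)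
    (hw : ContDiffWithinAt ℝ ∞ w s y) : ContDiffWithinAt ℝ ∞ (fun z => u z * w z) s y :=
  (mulCLM (E := E)).isBoundedBilinearMap.contDiff.comp_contDiffWithinAt (hu.prodMk hw)

theorem contDiffWithinAt_linear {F F' F'' : Type*} [NormedAddCommGroup F] [NormedSpace ℝ F]
    [NormedAddCommGroup F'] [NormedSpace ℝ F'] [FiniteDimensional ℝ F']
    [NormedAddCommGroup F''] [NormedSpace ℝ F''] {s : Set F}
    {y : F} (L : F' →ₗ[ℝ] F'') {u : F → F'} (hu : ContDiffWithinAt ℝ ∞ u s y) :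
    ContDiffWithinAt ℝ ∞ (fun z => L (u z)) s y :=
  (LinearMap.toContinuousLinearMap L).contDiff.comp_contDiffWithinAt hu

theorem fderivWithin_linear {F F' F'' : Type*} [NormedAddCommGroup F] [NormedSpace ℝ F]
    [NormedAddCommGroup F'] [NormedSpace ℝ F'] [FiniteDimensional ℝ F']
    [NormedAddCommGroup F''] [NormedSpace ℝ F''] {s : Set F}
    {y : F} (L : F' →ₗ[ℝ] F'') {u : F → F'} (hu : DifferentiableWithinAt ℝ u s y)
    (hs : UniqueDiffWithinAt ℝ s y) :
    (fderivWithin ℝ (fun z => L (u z)) s y).toLinearMap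
      = L ∘ₗ (fderivWithin ℝ u s y).toLinearMap := by
  have := ((LinearMap.toContinuousLinearMap L).hasFDerivAt.comp_hasFDerivWithinAt y
    hu.hasFDerivWithinAt).fderivWithin hs
  ext v
  exact congrArg (fun T => T v) this

theorem extd_congr {s : Set E} {u w : E → Form E} {y : E} (h : u =ᶠ[𝓝[s] y] w) (hy : y ∈ s) :
    extd s u y = extd s w y := by
  rw [extd, extd, h.fderivWithin_eq_of_mem hy]

theorem extd_add {s : Set E} {u w : E → Form E} {y : E}
    (hu : DifferentiableWithinAt ℝ u s y) (hw : DifferentiableWithinAt ℝ w s y)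
    (hs : UniqueDiffWithinAt ℝ s y) :
    extd s (fun z => u z + w z) y = extd s u y + extd s w y := by
  rw [extd, extd, extd, ← alternate_add, fderivWithin_fun_add hs hu hw]
  rfl

theorem extd_smul {s : Set E} {u : E → Form E} {y : E} (c : ℝ)
    (hu : DifferentiableWithinAt ℝ u s y) (hs : UniqueDiffWithinAt ℝ s y) :
    extd s (fun z => c • u z) y = c • extd s u y := by
  rw [extd, extd, ← alternate_smul, fderivWithin_fun_const_smul hs hu]
  rfl

theorem extd_const {s : Set E} (c : Form E) (y : E) : extd s (fun _ => c) y = 0 := by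
  simp [extd, alternate]

theorem mul_oneForm_eq (u : Form E) (l : Dual ℝ E) : u * oneForm l = oneForm l * parity u := by
  induction u using form_induction with
  | h0 r => rw [AlgHom.commutes, Algebra.commutes]
  | h1 k => rw [parity_oneForm, oneForm_mul_swap]; noncomm_ring
  | hm a b ha hb => rw [mul_assoc, hb, ← mul_assoc, ha, map_mul, mul_assoc]
  | ha a b ha hb => rw [add_mul, ha, hb, map_add, mul_add]

theorem extd_mul {s : Set E} {u w : E → Form E} {y : E}
    (hu : DifferentiableWithinAt ℝ u s y) (hw : DifferentiableWithinAt ℝ w s y)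
    (hs : UniqueDiffWithinAt ℝ s y) :
    extd s (fun z => u z * w z) y = extd s u y * w y + parity (u y) * extd s w y := by
  have h := ((mulCLM (E := E)).hasFDerivWithinAt_of_bilinear hu.hasFDerivWithinAt
    hw.hasFDerivWithinAt).fderivWithin hs
  have h2 : ∀ v, fderivWithin ℝ (fun z => u z * w z) s y v
      = u y * fderivWithin ℝ w s y v + fderivWithin ℝ u s y v * w y := fun v =>
    congrArg (fun T => T v) h
  simp only [extd, alternate, ContinuousLinearMap.coe_coe, h2, Finset.sum_mul, Finset.mul_sum,
    ← Finset.sum_add_distrib]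
  refine Finset.sum_congr rfl fun i _ => ?_
  have h3 := mul_oneForm_eq (parity (u y)) ((finBasis ℝ E).coord i)
  rw [parity_parity] at h3
  rw [← mul_assoc (parity _), h3]
  noncomm_ring

theorem extd_smooth {s : Set E} {w : E → Form E} {y : E} (hw : ContDiffWithinAt ℝ ∞ w s y)
    (hs : UniqueDiffOn ℝ s) (hy : y ∈ s) : ContDiffWithinAt ℝ ∞ (extd s w) s y := by
  have h := hw.fderivWithin_right hs (m := ∞) (by simp) hy
  have h2 : ∀ i, ContDiffWithinAt ℝ ∞ (fun z => oneForm ((finBasis ℝ E).coord i) *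
      fderivWithin ℝ w s z (finBasis ℝ E i)) s y := fun i =>
    contDiffWithinAt_mul contDiffWithinAt_const (h.clm_apply contDiffWithinAt_const)
  have h3 := ContDiffWithinAt.sum (s := Finset.univ) fun i _ => h2 i
  exact h3

/-- Pullbacks of constant-coefficient forms are smooth and closed. -/
theorem pull_const {s : Set E} {t : E → E'} {y : E} (ht : ContDiffWithinAt ℝ ∞ t s y)
    (hs : UniqueDiffOn ℝ s) (hy : y ∈ s) (hc : y ∈ closure (interior s)) (e : Form E') :
    ContDiffWithinAt ℝ ∞ (fun z => pull (fderivWithin ℝ t s z).toLinearMap e) s y ∧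
      extd s (fun z => pull (fderivWithin ℝ t s z).toLinearMap e) y = 0 := by
  have hA := ht.fderivWithin_right hs (m := ∞) (by simp) hy
  have hdiff : ∀ {u : E → Form E}, ContDiffWithinAt ℝ ∞ u s y → DifferentiableWithinAt ℝ u s y :=
    fun h => h.differentiableWithinAt (by simp)
  induction e using form_induction with
  | h0 r =>
    simp only [AlgHom.commutes]
    exact ⟨contDiffWithinAt_const, extd_const _ _⟩
  | h1 l =>
    simp only [pull_oneForm]
    let T : (E →L[ℝ] E') →ₗ[ℝ] Form E :=
      { toFun := fun A => oneForm (l ∘ₗ A.toLinearMap)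
        map_add' := fun A B => by
          rw [← map_add, ← LinearMap.comp_add]; rfl
        map_smul' := fun c A => by
          rw [RingHom.id_apply, ← map_smul, ← LinearMap.comp_smul]; rfl }
    refine ⟨contDiffWithinAt_linear T hA, ?_⟩
    show extd s (fun z => T (fderivWithin ℝ t s z)) y = 0
    rw [extd, fderivWithin_linear T (hA.differentiableWithinAt (by simp)) (hs y hy)]
    have hsym : IsSymmSndFDerivWithinAt ℝ t s y :=
      (ht.of_le (m := 2) (by norm_cast)).isSymmSndFDerivWithinAt (by simp) hs hc hy
    set b := finBasis ℝ E
    set B := fderivWithin ℝ (fderivWithin ℝ t s) s y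
    have h1 : ∀ i, T (B (b i)) = ∑ j, l (B (b i) (b j)) • oneForm (b.coord j) := by
      intro i
      simp only [← map_smul, ← map_sum]
      show oneForm _ = _
      congr 1
      apply b.ext
      intro k
      simp [Finsupp.single_apply]
    have h2 : alternate (T ∘ₗ B.toLinearMap)
        = ∑ i, ∑ j, l (B (b i) (b j)) • (oneForm (b.coord i) * oneForm (b.coord j)) := by
      simp only [alternate, LinearMap.comp_apply, ContinuousLinearMap.coe_coe]
      refine Finset.sum_congr rfl fun i _ => ?_
      rw [h1, Finset.mul_sum]
      exact Finset.sum_congr rfl fun j _ => mul_smul_comm _ _ _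
    have h3 : alternate (T ∘ₗ B.toLinearMap) = - alternate (T ∘ₗ B.toLinearMap) := by
      conv_lhs => rw [h2, Finset.sum_comm]
      rw [h2, ← Finset.sum_neg_distrib]
      refine Finset.sum_congr rfl fun i _ => ?_
      rw [← Finset.sum_neg_distrib]
      refine Finset.sum_congr rfl fun j _ => ?_
      rw [hsym.eq, oneForm_mul_swap, smul_neg]
    have h4 := eq_neg_iff_add_eq_zero.mp h3
    rw [← two_smul ℝ, smul_eq_zero] at h4
    exact h4.resolve_left two_ne_zero
  | hm a b ha hb =>
    simp only [map_mul]
    refine ⟨contDiffWithinAt_mul ha.1 hb.1, ?_⟩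
    rw [extd_mul (hdiff ha.1) (hdiff hb.1) (hs y hy), ha.2, hb.2, zero_mul, mul_zero, add_zero]
  | ha a b ha hb =>
    simp only [map_add]
    refine ⟨ha.1.add hb.1, ?_⟩
    rw [extd_add (hdiff ha.1) (hdiff hb.1) (hs y hy), ha.2, hb.2, add_zero]

/-- Pullback along a smooth map preserves smoothness and commutes with the exterior derivative. -/
theorem pull_smooth {s : Set E} {s' : Set E'} {t : E → E'} {w : E' → Form E'} {y : E}
    (ht : ContDiffWithinAt ℝ ∞ t s y) (hw : ContDiffWithinAt ℝ ∞ w s' (t y))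
    (hm : MapsTo t s s')
    (hs : UniqueDiffOn ℝ s) (hy : y ∈ s) (hc : y ∈ closure (interior s)) :
    ContDiffWithinAt ℝ ∞ (fun z => pull (fderivWithin ℝ t s z).toLinearMap (w (t z))) s y ∧
      extd s (fun z => pull (fderivWithin ℝ t s z).toLinearMap (w (t z))) y
        = pull (fderivWithin ℝ t s y).toLinearMap (extd s' w (t y)) := by
  set b := finBasis ℝ (Form E')
  have hcoef : ∀ i, ContDiffWithinAt ℝ ∞ (fun z => b.coord i (w z)) s' (t y) := fun i =>
    contDiffWithinAt_linear _ hw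
  have hcoef' : ∀ i, ContDiffWithinAt ℝ ∞ (fun z => b.coord i (w (t z))) s y := fun i =>
    (hcoef i).comp y ht hm
  have hk := fun i => pull_const ht hs hy hc (b i)
  have hdiff : ∀ {u : E → Form E}, ContDiffWithinAt ℝ ∞ u s y → DifferentiableWithinAt ℝ u s y :=
    fun h => h.differentiableWithinAt (by simp)
  have hexp : (fun z => pull (fderivWithin ℝ t s z).toLinearMap (w (t z)))
      = fun z => ∑ i, b.coord i (w (t z)) • pull (fderivWithin ℝ t s z).toLinearMap (b i) := by
    funext z
    have h := congrArg (pull (fderivWithin ℝ t s z).toLinearMap) (b.sum_repr (w (t z)))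
    rw [← h, map_sum]
    simp only [map_smul]
    rfl
  have hterm : ∀ i, ContDiffWithinAt ℝ ∞ (fun z => b.coord i (w (t z)) •
      pull (fderivWithin ℝ t s z).toLinearMap (b i)) s y := fun i => (hcoef' i).smul (hk i).1
  refine ⟨hexp ▸ ContDiffWithinAt.sum fun i _ => hterm i, ?_⟩
  rw [hexp]
  have hd : ∀ v, fderivWithin ℝ (fun z => ∑ i, b.coord i (w (t z)) •
        pull (fderivWithin ℝ t s z).toLinearMap (b i)) s y v
      = ∑ i, (b.coord i (w (t y)) • fderivWithin ℝ
          (fun z => pull (fderivWithin ℝ t s z).toLinearMap (b i)) s y v)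
        + pull (fderivWithin ℝ t s y).toLinearMap
            (fderivWithin ℝ w s' (t y) (fderivWithin ℝ t s y v)) := by
    intro v
    rw [fderivWithin_fun_sum (hs y hy) fun i _ => hdiff (hterm i)]
    have hw' : ∀ i, fderivWithin ℝ (fun z => b.coord i (w (t z))) s y v
        = b.coord i (fderivWithin ℝ w s' (t y) (fderivWithin ℝ t s y v)) := by
      intro i
      have h1 := ((LinearMap.toContinuousLinearMap (b.coord i)).hasFDerivAt.comp_hasFDerivWithinAt y
        (((hw.differentiableWithinAt (by simp)).hasFDerivWithinAt).comp y
        ((ht.differentiableWithinAt (by simp)).hasFDerivWithinAt) hm)).fderivWithin (hs y hy)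
      exact congrArg (fun T => T v) h1
    rw [← b.sum_repr (fderivWithin ℝ w s' (t y) (fderivWithin ℝ t s y v)), map_sum,
      ← Finset.sum_add_distrib]
    simp only [_root_.sum_apply, map_smul]
    refine Finset.sum_congr rfl fun i _ => ?_
    rw [fderivWithin_fun_smul (hs y hy) ((hcoef' i).differentiableWithinAt (by simp))
      (hdiff (hk i).1)]
    rw [_root_.add_apply, _root_.smul_apply, ContinuousLinearMap.smulRight_apply, hw']
    rfl
  have hL : (fderivWithin ℝ (fun z => ∑ i, b.coord i (w (t z)) •
        pull (fderivWithin ℝ t s z).toLinearMap (b i)) s y).toLinearMap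
      = ∑ i, (b.coord i (w (t y)) • (fderivWithin ℝ
          (fun z => pull (fderivWithin ℝ t s z).toLinearMap (b i)) s y).toLinearMap)
        + (pull (fderivWithin ℝ t s y).toLinearMap).toLinearMap ∘ₗ
            (fderivWithin ℝ w s' (t y)).toLinearMap ∘ₗ (fderivWithin ℝ t s y).toLinearMap := by
    ext v
    simpa using hd v
  have hsum : ∀ (r : Finset (Fin (finrank ℝ (Form E')))) (L : _ → E →ₗ[ℝ] Form E),
      alternate (∑ i ∈ r, L i) = ∑ i ∈ r, alternate (L i) := by
    intro r L
    simp only [alternate, LinearMap.sum_apply, Finset.mul_sum]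
    exact Finset.sum_comm
  rw [extd, hL, alternate_add, hsum, ← pull_alternate]
  simp only [alternate_smul]
  rw [Finset.sum_eq_zero, zero_add]
  · rfl
  · intro i _
    have := (hk i).2
    rw [extd] at this
    rw [this, smul_zero]

/-- Contraction, as a bilinear map. -/
def contrL : E →ₗ[ℝ] Form E →ₗ[ℝ] Form E :=
  CliffordAlgebra.contractLeft ∘ₗ Dual.eval ℝ E

/-- Contraction, as a continuous bilinear map. -/
def contrCLM : E →L[ℝ] Form E →L[ℝ] Form E :=
  LinearMap.toContinuousLinearMap
    ((LinearMap.toContinuousLinearMap (𝕜 := ℝ) (E := Form E) (F' := Form E)).toLinearMap ∘ₗ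
      contrL)

theorem contrCLM_apply (v : E) (w : Form E) : contrCLM v w = contr v w := rfl

theorem contDiff_contr : ContDiff ℝ ∞ fun p : E × Form E => contr p.1 p.2 := by
  have h : ContDiff ℝ ∞ fun p : E × Form E => contrCLM p.1 p.2 :=
    contrCLM.isBoundedBilinearMap.contDiff
  simp only [contrCLM_apply] at h
  exact h

theorem contDiffWithinAt_contr {F : Type*} [NormedAddCommGroup F] [NormedSpace ℝ F] {s : Set F}
    {y : F} {v : F → E} {w : F → Form E} (hv : ContDiffWithinAt ℝ ∞ v s y)
    (hw : ContDiffWithinAt ℝ ∞ w s y) :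
    ContDiffWithinAt ℝ ∞ (fun z => contr (v z) (w z)) s y :=
  contDiff_contr.contDiffAt.comp_contDiffWithinAt y (f := fun z => (v z, w z)) (hv.prodMk hw)

end Calculus

/-! ### Differential forms on manifolds (possibly with boundary) -/

section Manifold

variable {E : Type*} [NormedAddCommGroup E] [NormedSpace ℝ E] {H : Type*} [TopologicalSpace H]
  (I : ModelWithCorners ℝ E H) {M : Type*} [TopologicalSpace M] [ChartedSpace H M]

/-- Sections `x ↦ u x ∈ Λ(T*ₓM)` of the exterior algebra bundle of the cotangent bundle, without
any regularity. They form a ring under the pointwise wedge product. -/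
abbrev RoughForm (M : Type*) [TopologicalSpace M] [ChartedSpace H M] : Type _ :=
  (x : M) → Form (TangentSpace I x)

/-- Differential of the inverse of the chart at `c`, at the point `y` of the model space. -/
def chartInvD (c : M) (y : E) : E →ₗ[ℝ] TangentSpace I ((extChartAt I c).symm y) :=
  (mfderivWithin 𝓘(ℝ, E) I (extChartAt I c).symm (range I) y).toLinearMap

/-- Differential of the chart at `x`, at the point `x`. -/
def chartD (x : M) : TangentSpace I x →ₗ[ℝ] E :=
  (mfderiv I 𝓘(ℝ, E) (extChartAt I x) x).toLinearMap

/-- Coordinate representation of a form in the chart at `c`: its pullback along the inverse of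
the chart. -/
def chartRep (u : RoughForm I M) (c : M) (y : E) : Form E :=
  pull (chartInvD I c y) (u ((extChartAt I c).symm y))

/-- Pullback of a form along a map. -/
def roughPullback (f : M → M) (u : RoughForm I M) : RoughForm I M := fun x =>
  pull (mfderiv I I f x).toLinearMap (u (f x))

/-- Contraction of a form with a vector field. -/
def roughContr (X : (x : M) → TangentSpace I x) (u : RoughForm I M) : RoughForm I M := fun x =>
  contr (X x) (u x)

variable [FiniteDimensional ℝ E]

/-- Smoothness of a form at a point, in the coordinates of the chart at that point. -/
def SmoothFormAt (u : RoughForm I M) (x : M) : Prop :=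
  ContDiffWithinAt ℝ ∞ (chartRep I u x) (range I) (extChartAt I x x)

/-- Exterior derivative of a form, computed at `x` in the chart at `x`. -/
def roughD (u : RoughForm I M) : RoughForm I M := fun x =>
  pull (chartD I x) (extd (range I) (chartRep I u x) (extChartAt I x x))

theorem chartD_eq [IsManifold I ∞ M] (x : M) (v : TangentSpace I x) : chartD I x v = v :=
  congrArg (fun T => T v) (mfderiv_extChartAt_self (I := I) (x := x))

theorem pull_eq_of_eq {V : Type*} [AddCommGroup V] [Module ℝ V] {u : RoughForm I M} {p q : M}
    (h : p = q) (A : V →ₗ[ℝ] TangentSpace I p) (B : V →ₗ[ℝ] TangentSpace I q) (hAB : ∀ v, (A v : E) = (B v : E)) :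
    pull A (u p) = pull B (u q) := by
  subst h
  congr 2
  exact LinearMap.ext hAB

/-- The coordinate expression of a map `f`. -/
def coordMap (f : M → M) (c c' : M) : E → E := extChartAt I c' ∘ f ∘ (extChartAt I c).symm

theorem chartRep_pullback_apply [IsManifold I ∞ M] {f : M → M} (hf : ContMDiff I I ∞ f)
    (u : RoughForm I M) (c c' : M) {y : E} (hy : y ∈ (extChartAt I c).target)
    (hy' : f ((extChartAt I c).symm y) ∈ (extChartAt I c').source) :
    chartRep I (roughPullback I f u) c y
      = pull (fderivWithin ℝ (coordMap I f c c') (range I) y).toLinearMap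
          (chartRep I u c' (coordMap I f c c' y)) := by
  have hyr : y ∈ range I := extChartAt_target_subset_range c hy
  have hU : UniqueMDiffWithinAt 𝓘(ℝ, E) (range I) y :=
    (I.uniqueDiffOn y hyr).uniqueMDiffWithinAt
  set z := (extChartAt I c).symm y with hz
  have hp : (extChartAt I c').symm (coordMap I f c c' y) = f z :=
    (extChartAt I c').left_inv hy'
  have hs : MDifferentiableWithinAt 𝓘(ℝ, E) I (extChartAt I c).symm (range I) y :=
    mdifferentiableWithinAt_extChartAt_symm hy
  have hfz : MDifferentiableAt I I f z := hf.mdifferentiableAt (by simp)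
  have hc1 : mfderivWithin 𝓘(ℝ, E) I (f ∘ (extChartAt I c).symm) (range I) y
      = (mfderiv I I f z).comp (mfderivWithin 𝓘(ℝ, E) I (extChartAt I c).symm (range I) y) :=
    mfderiv_comp_mfderivWithin y hfz hs hU
  have hcont : ContinuousWithinAt (f ∘ (extChartAt I c).symm) (range I) y :=
    ContinuousAt.comp_continuousWithinAt (g := f) (f := (extChartAt I c).symm) (s := range I)
      (x := y) hfz.continuousAt hs.continuousWithinAt
  have hev : ∀ᶠ y' in 𝓝[range I] y,
      f ((extChartAt I c).symm y') ∈ (extChartAt I c').source :=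
    hcont ((isOpen_extChartAt_source c').mem_nhds hy')
  have heq : ((extChartAt I c').symm ∘ coordMap I f c c') =ᶠ[𝓝[range I] y]
      (f ∘ (extChartAt I c).symm) := by
    filter_upwards [hev] with y' h
    exact (extChartAt I c').left_inv h
  have ht : MDifferentiableWithinAt 𝓘(ℝ, E) 𝓘(ℝ, E) (coordMap I f c c') (range I) y :=
    (mdifferentiableAt_extChartAt ((extChartAt_source I c') ▸ hy')).comp_mdifferentiableWithinAt
      y (hfz.comp_mdifferentiableWithinAt y hs)
  have hty : coordMap I f c c' y ∈ (extChartAt I c').target := (extChartAt I c').map_source hy'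
  have hc2 : mfderivWithin 𝓘(ℝ, E) I ((extChartAt I c').symm ∘ coordMap I f c c') (range I) y
      = (mfderivWithin 𝓘(ℝ, E) I (extChartAt I c').symm (range I) (coordMap I f c c' y)).comp
        (mfderivWithin 𝓘(ℝ, E) 𝓘(ℝ, E) (coordMap I f c c') (range I) y) :=
    mfderivWithin_comp y (mdifferentiableWithinAt_extChartAt_symm hty) ht
      (fun _ _ => mem_range_self _) hU
  have hc3 := heq.mfderivWithin_eq_of_mem (I := 𝓘(ℝ, E)) (I' := I) hyr
  have hfinal : ∀ v : E, (mfderiv I I f z (chartInvD I c y v) : E)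
      = chartInvD I c' (coordMap I f c c' y)
          (fderivWithin ℝ (coordMap I f c c') (range I) y v) := by
    intro v
    rw [← mfderivWithin_eq_fderivWithin]
    have e1 := congrArg (fun T : E →L[ℝ] E => T v) hc1
    have e2 := congrArg (fun T : E →L[ℝ] E => T v) hc2
    have e3 := congrArg (fun T : E →L[ℝ] E => T v) hc3
    exact (e1.symm.trans e3.symm).trans e2
  show pull _ (pull _ (u (f z))) = pull _ (pull _ (u _))
  rw [pull_pull, pull_pull]
  exact pull_eq_of_eq I hp.symm _ _ hfinal

theorem coordMap_contDiffWithinAt [IsManifold I ∞ M] {f : M → M} (hf : ContMDiff I I ∞ f)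
    {c c' x : M} (hx : x ∈ (extChartAt I c).source) (hx' : f x ∈ (extChartAt I c').source) :
    ContDiffWithinAt ℝ ∞ (coordMap I f c c') (range I) (extChartAt I c x) :=
  ((contMDiffAt_iff_of_mem_source (extChartAt_source I c ▸ hx)
    (extChartAt_source I c' ▸ hx')).mp (hf x)).2

theorem coordMap_apply {f : M → M} {c c' x : M} (hx : x ∈ (extChartAt I c).source) :
    coordMap I f c c' (extChartAt I c x) = extChartAt I c' (f x) := by
  show extChartAt I c' (f ((extChartAt I c).symm (extChartAt I c x))) = _
  rw [(extChartAt I c).left_inv hx]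

theorem eventually_chart [IsManifold I ∞ M] {f : M → M} (hf : Continuous f)
    {c c' x : M} (hx : x ∈ (extChartAt I c).source) (hx' : f x ∈ (extChartAt I c').source) :
    ∀ᶠ y in 𝓝[range I] (extChartAt I c x), y ∈ (extChartAt I c).target ∧
      f ((extChartAt I c).symm y) ∈ (extChartAt I c').source := by
  have h1 : ∀ᶠ y in 𝓝[range I] (extChartAt I c x), y ∈ (extChartAt I c).target :=
    extChartAt_target_mem_nhdsWithin' hx
  have h2 : ContinuousAt (fun y => f ((extChartAt I c).symm y)) (extChartAt I c x) :=
    hf.continuousAt.comp (continuousAt_extChartAt_symm' hx)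
  have h3 : ∀ᶠ y in 𝓝[range I] (extChartAt I c x),
      f ((extChartAt I c).symm y) ∈ (extChartAt I c').source := by
    refine (h2.mono_left nhdsWithin_le_nhds).eventually ((isOpen_extChartAt_source c').mem_nhds ?_)
    show f ((extChartAt I c).symm (extChartAt I c x)) ∈ _
    rw [(extChartAt I c).left_inv hx]
    exact hx'
  exact h1.and h3

theorem chartRep_pullback_eventuallyEq [IsManifold I ∞ M] {f : M → M} (hf : ContMDiff I I ∞ f)
    (u : RoughForm I M) {c c' x : M} (hx : x ∈ (extChartAt I c).source)
    (hx' : f x ∈ (extChartAt I c').source) :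
    chartRep I (roughPullback I f u) c =ᶠ[𝓝[range I] (extChartAt I c x)] fun y =>
      pull (fderivWithin ℝ (coordMap I f c c') (range I) y).toLinearMap
          (chartRep I u c' (coordMap I f c c' y)) := by
  filter_upwards [eventually_chart I hf.continuous hx hx'] with y hy
  exact chartRep_pullback_apply I hf u c c' hy.1 hy.2

theorem roughPullback_id (u : RoughForm I M) : roughPullback I id u = u := by
  funext x
  show pull (mfderiv I I id x).toLinearMap (u x) = u x
  rw [mfderiv_id]
  exact pull_id _

theorem chartRep_pullback_smooth [IsManifold I ∞ M] {f : M → M} (hf : ContMDiff I I ∞ f)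
    {u : RoughForm I M} {c x : M} (hx : x ∈ (extChartAt I c).source)
    (hu : SmoothFormAt I u (f x)) :
    ContDiffWithinAt ℝ ∞ (chartRep I (roughPullback I f u) c) (range I) (extChartAt I c x) ∧
    extd (range I) (chartRep I (roughPullback I f u) c) (extChartAt I c x)
      = pull (fderivWithin ℝ (coordMap I f c (f x)) (range I) (extChartAt I c x)).toLinearMap
          (extd (range I) (chartRep I u (f x)) (extChartAt I (f x) (f x))) := by
  have hx' := mem_extChartAt_source (I := I) (f x)
  have h0 := coordMap_apply I (f := f) (c' := f x) hx
  have hr : extChartAt I c x ∈ range I := mem_range_self _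
  have hu' : ContDiffWithinAt ℝ ∞ (chartRep I u (f x)) (range I)
    (coordMap I f c (f x) (extChartAt I c x)) := h0 ▸ hu
  have h := pull_smooth (coordMap_contDiffWithinAt I hf hx hx') hu' (fun _ _ => mem_range_self _)
    I.uniqueDiffOn hr (I.range_subset_closure_interior hr)
  have he := chartRep_pullback_eventuallyEq I hf u hx hx'
  rw [h0] at h
  exact ⟨h.1.congr_of_eventuallyEq_of_mem he hr, (extd_congr he hr).trans h.2⟩

/-- Smoothness may be tested in any chart. -/
theorem contDiffWithinAt_chartRep [IsManifold I ∞ M] {u : RoughForm I M} {c x : M}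
    (hu : SmoothFormAt I u x) (hx : x ∈ (extChartAt I c).source) :
    ContDiffWithinAt ℝ ∞ (chartRep I u c) (range I) (extChartAt I c x) := by
  have := (chartRep_pullback_smooth I contMDiff_id hx (f := id) hu).1
  rwa [roughPullback_id] at this

/-- Invariance of the exterior derivative under changes of charts. -/
theorem chartRep_roughD [IsManifold I ∞ M] {u : RoughForm I M} {c : M} {y : E}
    (hy : y ∈ (extChartAt I c).target) (hu : SmoothFormAt I u ((extChartAt I c).symm y)) :
    chartRep I (roughD I u) c y = extd (range I) (chartRep I u c) y := by
  set z := (extChartAt I c).symm y with hz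
  have hzs : z ∈ (extChartAt I c).source := (extChartAt I c).map_target hy
  have hzy : extChartAt I c z = y := (extChartAt I c).right_inv hy
  have h := (chartRep_pullback_smooth I contMDiff_id hzs (f := id) hu).2
  rw [roughPullback_id, hzy] at h
  rw [h]
  show pull _ (pull _ _) = _
  rw [pull_pull]
  congr 2
  ext v
  have hyr : y ∈ range I := extChartAt_target_subset_range c hy
  have hU : UniqueMDiffWithinAt 𝓘(ℝ, E) (range I) y :=
    (I.uniqueDiffOn y hyr).uniqueMDiffWithinAt
  have hc : mfderivWithin 𝓘(ℝ, E) 𝓘(ℝ, E) (extChartAt I z ∘ (extChartAt I c).symm) (range I) y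
      = (mfderiv I 𝓘(ℝ, E) (extChartAt I z) z).comp
        (mfderivWithin 𝓘(ℝ, E) I (extChartAt I c).symm (range I) y) :=
    mfderiv_comp_mfderivWithin y (mdifferentiableAt_extChartAt (mem_chart_source H z))
      (mdifferentiableWithinAt_extChartAt_symm hy) hU
  rw [mfderivWithin_eq_fderivWithin] at hc
  exact (congrArg (fun T : E →L[ℝ] E => T v) hc).symm

theorem roughD_smooth [IsManifold I ∞ M] {u : RoughForm I M} (hu : ∀ x, SmoothFormAt I u x)
    (x : M) : SmoothFormAt I (roughD I u) x := by
  have hr : extChartAt I x x ∈ range I := mem_range_self _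
  refine (extd_smooth (hu x) I.uniqueDiffOn hr).congr_of_eventuallyEq_of_mem ?_ hr
  filter_upwards [extChartAt_target_mem_nhdsWithin (I := I) x] with y hy
  exact chartRep_roughD I hy (hu _)

theorem roughPullback_smooth [IsManifold I ∞ M] {f : M → M} (hf : ContMDiff I I ∞ f)
    {u : RoughForm I M} (hu : ∀ x, SmoothFormAt I u x) (x : M) :
    SmoothFormAt I (roughPullback I f u) x :=
  (chartRep_pullback_smooth I hf (mem_extChartAt_source x) (hu (f x))).1

end Manifold

/-! ### The algebra of smooth differential forms -/

section Forms

variable {E : Type*} [NormedAddCommGroup E] [NormedSpace ℝ E] [FiniteDimensional ℝ E]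
  {H : Type*} [TopologicalSpace H]
  (I : ModelWithCorners ℝ E H) {M : Type*} [TopologicalSpace M] [ChartedSpace H M]

theorem smoothFormAt_add {u w : RoughForm I M} {x : M} (hu : SmoothFormAt I u x)
    (hw : SmoothFormAt I w x) : SmoothFormAt I (u + w) x := by
  have h : chartRep I (u + w) x = fun y => chartRep I u x y + chartRep I w x y :=
    funext fun y => map_add _ _ _
  rw [SmoothFormAt, h]
  exact hu.add hw

theorem smoothFormAt_mul {u w : RoughForm I M} {x : M} (hu : SmoothFormAt I u x)
    (hw : SmoothFormAt I w x) : SmoothFormAt I (u * w) x := by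
  have h : chartRep I (u * w) x = fun y => chartRep I u x y * chartRep I w x y :=
    funext fun y => map_mul _ _ _
  rw [SmoothFormAt, h]
  exact contDiffWithinAt_mul hu hw

/-- A smooth function is a smooth form of degree zero. -/
theorem smoothFormAt_fun [IsManifold I ∞ M] {f : M → ℝ} (hf : ContMDiff I 𝓘(ℝ, ℝ) ∞ f) (x : M) :
    SmoothFormAt I (fun x => algebraMap ℝ (Form (TangentSpace I x)) (f x) : RoughForm I M) x := by
  have h : chartRep I (fun x => algebraMap ℝ (Form (TangentSpace I x)) (f x) : RoughForm I M) x
      = fun y => Algebra.linearMap ℝ (Form E) (f ((extChartAt I x).symm y)) :=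
    funext fun y => AlgHom.commutes _ _
  rw [SmoothFormAt, h]
  refine contDiffWithinAt_linear _ ?_
  have := ((contMDiffAt_iff_of_mem_source (mem_chart_source H x)
    (mem_chart_source ℝ (f x))).mp (hf x)).2
  rw [extChartAt_model_space_eq_id] at this
  exact this

theorem alternate_parity (L : E →ₗ[ℝ] Form E) :
    alternate (parity.toLinearMap ∘ₗ L) = - parity (alternate L) := by
  simp [alternate]

theorem smoothFormAt_algebraMap (r : ℝ) (x : M) :
    SmoothFormAt I (algebraMap ℝ (RoughForm I M) r) x := by
  have h : chartRep I (algebraMap ℝ (RoughForm I M) r) x = fun _ => algebraMap ℝ (Form E) r :=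
    funext fun y => AlgHom.commutes _ _
  rw [SmoothFormAt, h]
  exact contDiffWithinAt_const

/-- Smooth forms are closed under sums and wedge products. -/
def smoothForms (M : Type*) [TopologicalSpace M] [ChartedSpace H M] :
    Subalgebra ℝ (RoughForm I M) where
  carrier := {u | ∀ x, SmoothFormAt I u x}
  mul_mem' hu hw x := smoothFormAt_mul I (hu x) (hw x)
  add_mem' hu hw x := smoothFormAt_add I (hu x) (hw x)
  algebraMap_mem' r x := smoothFormAt_algebraMap I r x

/-- The algebra `Ω(M)` of smooth differential forms on `M` (of all degrees), with the wedge
product. -/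
def DiffForm (M : Type*) [TopologicalSpace M] [ChartedSpace H M] : Type _ := smoothForms I M

instance : Ring (DiffForm I M) := inferInstanceAs (Ring (smoothForms I M))

instance : Algebra ℝ (DiffForm I M) := inferInstanceAs (Algebra ℝ (smoothForms I M))

theorem smoothFormAt_differentiable {u : RoughForm I M} {x : M} (hu : SmoothFormAt I u x) :
    DifferentiableWithinAt ℝ (chartRep I u x) (range I) (extChartAt I x x) :=
  hu.differentiableWithinAt (by simp)

theorem uniqueDiff_chart (x : M) : UniqueDiffWithinAt ℝ (range I) (extChartAt I x x) :=
  I.uniqueDiffOn _ (mem_range_self _)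

variable [IsManifold I ∞ M]

theorem pull_chartRep_self (u : RoughForm I M) (x : M) :
    pull (chartD I x) (chartRep I u x (extChartAt I x x)) = u x := by
  show pull _ (pull _ _) = _
  rw [pull_pull]
  have hp : (extChartAt I x).symm (extChartAt I x x) = x := extChartAt_to_inv x
  refine (pull_eq_of_eq I hp _ LinearMap.id fun v => ?_).trans (pull_id (u x))
  have h1 := congrArg (fun T => T (chartD I x v)) (mfderivWithin_range_extChartAt_symm (I := I)
    (x := x))
  exact h1.trans (chartD_eq I x v)

theorem roughD_add {u w : RoughForm I M} (hu : ∀ x, SmoothFormAt I u x)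
    (hw : ∀ x, SmoothFormAt I w x) : roughD I (u + w) = roughD I u + roughD I w := by
  funext x
  have h : chartRep I (u + w) x = fun y => chartRep I u x y + chartRep I w x y :=
    funext fun y => map_add _ _ _
  show pull _ _ = pull _ _ + pull _ _
  rw [h, extd_add (smoothFormAt_differentiable I (hu x)) (smoothFormAt_differentiable I (hw x))
    (uniqueDiff_chart I x), map_add]

theorem roughD_smul (c : ℝ) {u : RoughForm I M} (hu : ∀ x, SmoothFormAt I u x) :
    roughD I (c • u) = c • roughD I u := by
  funext x
  have h : chartRep I (c • u) x = fun y => c • chartRep I u x y :=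
    funext fun y => pull_smul _ _ _
  show pull (chartD I x) _ = c • pull (chartD I x) _
  rw [h, extd_smul c (smoothFormAt_differentiable I (hu x)) (uniqueDiff_chart I x), pull_smul]

theorem roughD_mul {u w : RoughForm I M} (hu : ∀ x, SmoothFormAt I u x)
    (hw : ∀ x, SmoothFormAt I w x) (x : M) :
    roughD I (u * w) x = roughD I u x * w x + parity (u x) * roughD I w x := by
  have h : chartRep I (u * w) x = fun y => chartRep I u x y * chartRep I w x y :=
    funext fun y => map_mul _ _ _
  show pull _ _ = pull _ _ * _ + _ * pull _ _
  rw [h, extd_mul (smoothFormAt_differentiable I (hu x)) (smoothFormAt_differentiable I (hw x))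
    (uniqueDiff_chart I x), map_add, map_mul, map_mul, pull_parity, pull_chartRep_self,
    pull_chartRep_self]

theorem smoothFormAt_parity {u : RoughForm I M} {x : M} (hu : SmoothFormAt I u x) :
    SmoothFormAt I (fun x => parity (u x) : RoughForm I M) x := by
  have h : chartRep I (fun x => parity (u x) : RoughForm I M) x
      = fun y => (parity (V := E)).toLinearMap (chartRep I u x y) :=
    funext fun y => pull_parity _ _
  rw [SmoothFormAt, h]
  exact contDiffWithinAt_linear _ hu

/-- The exterior derivative `d : Ω(M) → Ω(M)`. -/
def dForm : DiffForm I M →ₗ[ℝ] DiffForm I M where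
  toFun u := ⟨roughD I u.1, roughD_smooth I u.2⟩
  map_add' u w := Subtype.ext (roughD_add I u.2 w.2)
  map_smul' c u := Subtype.ext (roughD_smul I c u.2)

/-- The sign automorphism `(-1) ^ deg` of `Ω(M)`. -/
def parityForm : DiffForm I M →ₐ[ℝ] DiffForm I M where
  toFun u := ⟨fun x => parity (u.1 x), fun x => smoothFormAt_parity I (u.2 x)⟩
  map_one' := Subtype.ext <| funext fun _ => map_one _
  map_zero' := Subtype.ext <| funext fun _ => map_zero _
  map_mul' _ _ := Subtype.ext <| funext fun _ => map_mul _ _ _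
  map_add' _ _ := Subtype.ext <| funext fun _ => map_add _ _ _
  commutes' r := Subtype.ext <| funext fun _ => AlgHom.commutes _ r

/-- Pullback of smooth forms along a smooth map. -/
def pullbackForm (f : M → M) (hf : ContMDiff I I ∞ f) : DiffForm I M →ₐ[ℝ] DiffForm I M where
  toFun u := ⟨roughPullback I f u.1, roughPullback_smooth I hf u.2⟩
  map_one' := Subtype.ext <| funext fun _ => map_one _
  map_zero' := Subtype.ext <| funext fun _ => map_zero _
  map_mul' _ _ := Subtype.ext <| funext fun _ => map_mul _ _ _
  map_add' _ _ := Subtype.ext <| funext fun _ => map_add _ _ _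
  commutes' r := Subtype.ext <| funext fun _ => AlgHom.commutes _ r

/-- A smooth function, as a form of degree zero. -/
def funForm (f : M → ℝ) (hf : ContMDiff I 𝓘(ℝ, ℝ) ∞ f) : DiffForm I M :=
  ⟨fun x => algebraMap ℝ (Form (TangentSpace I x)) (f x), smoothFormAt_fun I hf⟩

theorem parityForm_parityForm (u : DiffForm I M) : parityForm I (parityForm I u) = u :=
  Subtype.ext <| funext fun _ => parity_parity _

theorem dForm_mul (u w : DiffForm I M) :
    dForm I (u * w) = dForm I u * w + parityForm I u * dForm I w :=
  Subtype.ext <| funext fun x => roughD_mul I u.2 w.2 x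

theorem dForm_one : dForm I (1 : DiffForm I M) = 0 := by
  have h := dForm_mul I (1 : DiffForm I M) 1
  rw [map_one (parityForm I), mul_one, mul_one, one_mul] at h
  simpa using h

theorem dForm_parityForm (u : DiffForm I M) :
    dForm I (parityForm I u) = - parityForm I (dForm I u) := by
  refine Subtype.ext <| funext fun x => ?_
  have h : chartRep I (fun x => parity (u.1 x) : RoughForm I M) x
      = fun y => (parity (V := E)).toLinearMap (chartRep I u.1 x y) :=
    funext fun y => pull_parity _ _
  show pull (chartD I x) (extd _ (chartRep I (fun x => parity (u.1 x) : RoughForm I M) x) _)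
    = - parity (pull (chartD I x) _)
  rw [h, extd, fderivWithin_linear _ (smoothFormAt_differentiable I (u.2 x))
    (uniqueDiff_chart I x), alternate_parity, map_neg, pull_parity]
  rfl

theorem parityForm_pullbackForm (f : M → M) (hf : ContMDiff I I ∞ f) (u : DiffForm I M) :
    parityForm I (pullbackForm I f hf u) = pullbackForm I f hf (parityForm I u) :=
  Subtype.ext <| funext fun _ => (pull_parity _ _).symm

/-- Coordinates of a vector field in the chart at `c`. -/
theorem contDiffWithinAt_vectorField {X : (x : M) → TangentSpace I x}
    (hX : ContMDiff I I.tangent ∞ (fun x => (⟨x, X x⟩ : TangentBundle I M))) (x : M) :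
    ContDiffWithinAt ℝ ∞ (fun y =>
      (trivializationAt E (TangentSpace I) x
        ⟨(extChartAt I x).symm y, X ((extChartAt I x).symm y)⟩).2) (range I)
      (extChartAt I x x) := by
  have h1 := (Bundle.contMDiffAt_section x).mp (hX x)
  have h2 := ((contMDiffAt_iff_of_mem_source (mem_chart_source H x)
      (mem_chart_source E _)).mp h1).2
  rw [extChartAt_model_space_eq_id] at h2
  exact h2

theorem chartInvD_vectorField (X : (x : M) → TangentSpace I x) (x : M) {y : E}
    (hy : y ∈ (extChartAt I x).target) :
    chartInvD I x y (trivializationAt E (TangentSpace I) x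
        ⟨(extChartAt I x).symm y, X ((extChartAt I x).symm y)⟩).2 = X ((extChartAt I x).symm y) := by
  have hzs : (extChartAt I x).symm y ∈ (chartAt H x).source :=
    extChartAt_source I x ▸ (extChartAt I x).map_target hy
  have h1 := congrArg (fun T => T (X ((extChartAt I x).symm y)))
    (mfderivWithin_extChartAt_symm_comp_mfderiv_extChartAt (I := I) hy)
  have h2 := congrArg (fun T => T (X ((extChartAt I x).symm y)))
    (TangentBundle.continuousLinearMapAt_trivializationAt (I := I) hzs)
  have h3 := congrArg (fun T => T (X ((extChartAt I x).symm y)))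
    (Bundle.Trivialization.coe_linearMapAt_of_mem (R := ℝ)
      (trivializationAt E (TangentSpace I) x) (b := (extChartAt I x).symm y)
      (by simpa using hzs))
  refine Eq.trans ?_ h1
  exact congrArg (chartInvD I x y) (h3.symm.trans h2)

theorem roughContr_smooth {X : (x : M) → TangentSpace I x}
    (hX : ContMDiff I I.tangent ∞ (fun x => (⟨x, X x⟩ : TangentBundle I M)))
    {u : RoughForm I M} (hu : ∀ x, SmoothFormAt I u x) (x : M) :
    SmoothFormAt I (roughContr I X u) x := by
  have hr : extChartAt I x x ∈ range I := mem_range_self _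
  have hs := contDiffWithinAt_contr (contDiffWithinAt_vectorField I hX x) (hu x)
  refine hs.congr_of_eventuallyEq_of_mem ?_ hr
  filter_upwards [extChartAt_target_mem_nhdsWithin (I := I) x] with y hy
  have hXz := chartInvD_vectorField I X x hy
  show pull _ (contr (X _) (u _)) = contr _ (pull _ (u _))
  rw [← pull_contr, hXz]

end Forms

/-! ### Tensor products of differential graded algebras -/

section Tensor

variable {S Ω κ : Type*} [CommRing S] [Algebra ℝ S] [Ring Ω] [Algebra ℝ Ω] [Fintype κ]

/-- The operator `1 ⊗ d - ∑ₐ Θ^a ⊗ ι_a` on `S ⊗ Ω`. -/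
def tensorD (d : Ω →ₗ[ℝ] Ω) (c : κ → Ω →ₗ[ℝ] Ω) (Θ : κ → S) : S ⊗[ℝ] Ω →ₗ[ℝ] S ⊗[ℝ] Ω :=
  TensorProduct.map LinearMap.id d
    - ∑ a, TensorProduct.map (LinearMap.mulLeft ℝ (Θ a)) (c a)

theorem tensorD_tmul (d : Ω →ₗ[ℝ] Ω) (c : κ → Ω →ₗ[ℝ] Ω) (Θ : κ → S) (s : S) (u : Ω) :
    tensorD d c Θ (s ⊗ₜ u) = s ⊗ₜ d u - ∑ a, (Θ a * s) ⊗ₜ c a u := by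
  simp [tensorD]

theorem tensorD_mul (d : Ω →ₗ[ℝ] Ω) (c : κ → Ω →ₗ[ℝ] Ω) (Θ : κ → S) (p : Ω →ₐ[ℝ] Ω)
    (hd : ∀ u w, d (u * w) = d u * w + p u * d w)
    (hc : ∀ a u w, c a (u * w) = c a u * w + p u * c a w) (α β : S ⊗[ℝ] Ω) :
    tensorD d c Θ (α * β) = tensorD d c Θ α * β
      + Algebra.TensorProduct.map (AlgHom.id ℝ S) p α * tensorD d c Θ β := by
  induction α using TensorProduct.induction_on with
  | zero => simp
  | add x y hx hy => rw [add_mul, map_add, hx, hy, map_add, map_add]; noncomm_ring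
  | tmul s u =>
    induction β using TensorProduct.induction_on with
    | zero => simp
    | add x y hx hy => rw [mul_add, map_add, hx, hy, map_add]; noncomm_ring
    | tmul t w =>
      rw [Algebra.TensorProduct.map_tmul, Algebra.TensorProduct.tmul_mul_tmul, tensorD_tmul,
        tensorD_tmul, tensorD_tmul, hd, AlgHom.id_apply]
      simp only [hc, TensorProduct.tmul_add, sub_mul, mul_sub, Finset.sum_mul,
        Finset.mul_sum, Algebra.TensorProduct.tmul_mul_tmul, Finset.sum_add_distrib]
      have e1 : ∀ a, Θ a * (s * t) = Θ a * s * t := fun a => (mul_assoc _ _ _).symm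
      have e2 : ∀ a, s * (Θ a * t) = Θ a * s * t := fun a => by ring
      simp only [e1, e2]
      abel

theorem tensorD_parity (d : Ω →ₗ[ℝ] Ω) (c : κ → Ω →ₗ[ℝ] Ω) (Θ : κ → S) (p : Ω →ₐ[ℝ] Ω)
    (hd : ∀ u, d (p u) = - p (d u)) (hc : ∀ a u, c a (p u) = - p (c a u)) (α : S ⊗[ℝ] Ω) :
    tensorD d c Θ (Algebra.TensorProduct.map (AlgHom.id ℝ S) p α)
      = - Algebra.TensorProduct.map (AlgHom.id ℝ S) p (tensorD d c Θ α) := by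
  induction α using TensorProduct.induction_on with
  | zero => simp
  | add x y hx hy => rw [map_add, map_add, hx, hy, map_add, map_add, neg_add]
  | tmul s u =>
    rw [Algebra.TensorProduct.map_tmul, tensorD_tmul, tensorD_tmul, map_sub, map_sum]
    simp only [Algebra.TensorProduct.map_tmul, hd, hc, TensorProduct.tmul_neg,
      Finset.sum_neg_distrib, AlgHom.id_apply]
    abel

end Tensor

/-! ### Smooth group actions and the Cartan model -/

section Action

variable {E : Type*} [NormedAddCommGroup E] [NormedSpace ℝ E] [FiniteDimensional ℝ E]
  {H : Type*} [TopologicalSpace H]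
  {EG : Type*} [NormedAddCommGroup EG] [NormedSpace ℝ EG] {HG : Type*} [TopologicalSpace HG]
  (J : ModelWithCorners ℝ EG HG) (I : ModelWithCorners ℝ E H)
  {G : Type*} [TopologicalSpace G] [ChartedSpace HG G] [Group G]
  {M : Type*} [TopologicalSpace M] [ChartedSpace H M] [MulAction G M]

/-- The fundamental vector field on `M` of an element `ξ` of the Lie algebra of `G`, that is
`x ↦ d/dt exp(-tξ) • x` at `t = 0`; with this sign, `ξ ↦ X_ξ` is a homomorphism of Lie algebras. -/
def fundVF (ξ : GroupLieAlgebra J G) (x : M) : TangentSpace I x :=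
  - (mfderiv J I (fun g : G => g • x) 1 ξ : E)

/-- The adjoint representation of `G` on its Lie algebra: `Ad g` is the differential at `1` of the
conjugation `h ↦ g h g⁻¹`. -/
def Ad (g : G) : GroupLieAlgebra J G →ₗ[ℝ] GroupLieAlgebra J G :=
  ContinuousLinearMap.toLinearMap (M := GroupLieAlgebra J G) (M₂ := GroupLieAlgebra J G)
    (mfderiv J J (fun h : G => g * h * g⁻¹) 1)

theorem smul_contMDiff [ContMDiffSMul J I ∞ G M] (g : G) :
    ContMDiff I I ∞ (fun x : M => g • x) :=
  (ContMDiffSMul.contMDiff_smul (I := J) (I' := I) (n := ∞) (G := G) (M := M)).comp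
    (contMDiff_const.prodMk contMDiff_id)

theorem fundVF_smooth [IsManifold I ∞ M] [LieGroup J ∞ G] [ContMDiffSMul J I ∞ G M]
    (ξ : GroupLieAlgebra J G) :
    ContMDiff I I.tangent ∞ (fun x : M => (⟨x, fundVF J I ξ x⟩ : TangentBundle I M)) := by
  have hG : IsManifold J ∞ G := LieGroup.toContMDiffMul.toIsManifold
  let fg : M → TangentBundle I M := fun x => ⟨x, 0⟩
  have sfg : ContMDiff I I.tangent ∞ fg := Bundle.contMDiff_zeroSection _ _
  let fv : M → TangentBundle J G := fun _ => ⟨1, -ξ⟩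
  have sfv : ContMDiff I J.tangent ∞ fv := contMDiff_const
  let F₂ : (TangentBundle J G × TangentBundle I M) → TangentBundle (J.prod I) (G × M) :=
    (equivTangentBundleProd J G I M).symm
  have S₂ : ContMDiff (J.tangent.prod I.tangent) (J.prod I).tangent ∞ F₂ :=
    contMDiff_equivTangentBundleProd_symm
  have hact := ContMDiffSMul.contMDiff_smul (I := J) (I' := I) (n := ∞) (G := G) (M := M)
  have S₃ : ContMDiff (J.prod I).tangent I.tangent ∞
      (tangentMap (J.prod I) I (fun p : G × M => p.1 • p.2)) :=
    hact.contMDiff_tangentMap (by simp)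
  have S := (S₃.comp S₂).comp (sfv.prodMk sfg)
  have h1 : ∀ x : M, (mfderiv (J.prod I) I (fun p : G × M => p.1 • p.2) ((1 : G), x)
      ((-ξ, 0) : TangentSpace J (1 : G) × TangentSpace I x) : E)
      = fundVF J I ξ x := by
    intro x
    have := mfderiv_prod_eq_add_apply (I := J) (I' := I) (I'' := I)
      (f := fun p : G × M => p.1 • p.2) (p := ((1 : G), x))
      (v := ((-ξ, 0) : TangentSpace J (1 : G) × TangentSpace I x))
      (hact.mdifferentiableAt (by simp))
    refine this.trans ?_
    have e1 := map_neg (mfderiv J I (fun g : G => g • x) 1) ξ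
    have e2 := map_zero (mfderiv I I (fun y : M => (1 : G) • y) x)
    exact (congrArg₂ (fun a b : E => a + b) e1 e2).trans (add_zero _)
  have h2 : (fun x : M => (⟨x, fundVF J I ξ x⟩ : TangentBundle I M))
      = (tangentMap (J.prod I) I (fun p : G × M => p.1 • p.2) ∘ F₂) ∘
        fun x => (fv x, fg x) := by
    funext x
    refine Bundle.TotalSpace.ext (one_smul G x).symm ?_
    exact heq_of_eq (h1 x).symm
  rw [h2]
  exact S

/-- Contraction `ι_ξ : Ω(M) → Ω(M)` with the fundamental vector field of `ξ`. -/
def contrForm [IsManifold I ∞ M] [LieGroup J ∞ G] [ContMDiffSMul J I ∞ G M]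
    (ξ : GroupLieAlgebra J G) : DiffForm I M →ₗ[ℝ] DiffForm I M where
  toFun u := ⟨roughContr I (fundVF J I ξ) u.1, roughContr_smooth I (fundVF_smooth J I ξ) u.2⟩
  map_add' _ _ := Subtype.ext <| funext fun _ => map_add _ _ _
  map_smul' c u := Subtype.ext <| funext fun x => (contr (fundVF J I ξ x)).map_smul c (u.1 x)

theorem contrForm_mul [IsManifold I ∞ M] [LieGroup J ∞ G] [ContMDiffSMul J I ∞ G M]
    (ξ : GroupLieAlgebra J G) (u w : DiffForm I M) :
    contrForm J I ξ (u * w) = contrForm J I ξ u * w + parityForm I u * contrForm J I ξ w :=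
  Subtype.ext <| funext fun _ => contr_mul _ _ _

theorem contrForm_parityForm [IsManifold I ∞ M] [LieGroup J ∞ G] [ContMDiffSMul J I ∞ G M]
    (ξ : GroupLieAlgebra J G) (u : DiffForm I M) :
    contrForm J I ξ (parityForm I u) = - parityForm I (contrForm J I ξ u) :=
  Subtype.ext <| funext fun _ => contr_parity _ _

/-- The action of `G` on `Ω(M)`: `g` acts as the pullback along `x ↦ g⁻¹ • x`. -/
def actForm [IsManifold I ∞ M] [ContMDiffSMul J I ∞ G M] (g : G) :
    DiffForm I M →ₐ[ℝ] DiffForm I M :=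
  pullbackForm I (fun x => g⁻¹ • x) (smul_contMDiff J I g⁻¹)

/-- The symmetric algebra `S(𝔤*)` of polynomials on the Lie algebra `𝔤` of `G`. -/
abbrev Poly (G : Type*) [TopologicalSpace G] [ChartedSpace HG G] [Group G] : Type _ :=
  SymmetricAlgebra ℝ (Dual ℝ (GroupLieAlgebra J G))

/-- The action of `G` on `S(𝔤*)` extending the coadjoint representation. -/
def actPoly (g : G) : Poly J G →ₐ[ℝ] Poly J G :=
  SymmetricAlgebra.lift (SymmetricAlgebra.ι ℝ (Dual ℝ (GroupLieAlgebra J G)) ∘ₗ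
    (Ad J g⁻¹).dualMap)

/-- The algebra `S(𝔤*)^G` of invariant polynomials. -/
def invPoly (G : Type*) [TopologicalSpace G] [ChartedSpace HG G] [Group G] :
    Subalgebra ℝ (Poly J G) where
  carrier := {F | ∀ g : G, actPoly J g F = F}
  mul_mem' ha hb g := by rw [map_mul, ha g, hb g]
  add_mem' ha hb g := by rw [map_add, ha g, hb g]
  algebraMap_mem' r g := AlgHom.commutes _ r

variable [IsManifold I ∞ M]

variable (G M) in
/-- The algebra `S(𝔤*) ⊗ Ω(M)`. As `S(𝔤*)` is concentrated in even degrees, the graded tensor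
product is the usual one. -/
abbrev CartanAlg : Type _ := Poly J G ⊗[ℝ] DiffForm I M

/-- The sign automorphism `(-1) ^ deg` of `S(𝔤*) ⊗ Ω(M)`. -/
def cartanParity : CartanAlg J I G M →ₐ[ℝ] CartanAlg J I G M :=
  Algebra.TensorProduct.map (AlgHom.id ℝ _) (parityForm I)

variable [ContMDiffSMul J I ∞ G M]

/-- The diagonal action of `G` on `S(𝔤*) ⊗ Ω(M)`. -/
def actCartan (g : G) : CartanAlg J I G M →ₐ[ℝ] CartanAlg J I G M :=
  Algebra.TensorProduct.map (actPoly J g) (actForm J I g)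

variable (G M) in
/-- The algebra `Ω_G(M) = (S(𝔤*) ⊗ Ω(M))^G` of equivariant differential forms. -/
def EquivForm : Subalgebra ℝ (CartanAlg J I G M) where
  carrier := {α | ∀ g : G, actCartan J I g α = α}
  mul_mem' ha hb g := by rw [map_mul, ha g, hb g]
  add_mem' ha hb g := by rw [map_add, ha g, hb g]
  algebraMap_mem' r g := AlgHom.commutes _ r

variable [LieGroup J ∞ G] {κ : Type*} [Fintype κ] (b : Basis κ ℝ (GroupLieAlgebra J G))

/-- The element `Θ^a ∈ S¹(𝔤*)` of the dual basis. -/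
def Theta (a : κ) : Poly J G := SymmetricAlgebra.ι ℝ _ (b.coord a)

/-- The Cartan differential `D = 1 ⊗ d - ∑ₐ Θ^a ⊗ ι_a` on `S(𝔤*) ⊗ Ω(M)`, for a basis `(ξ_a)` of the
Lie algebra. -/
def cartanD : CartanAlg J I G M →ₗ[ℝ] CartanAlg J I G M :=
  tensorD (dForm I) (fun a => contrForm J I (b a)) (Theta J b)

theorem cartanD_mul (α β : CartanAlg J I G M) :
    cartanD J I b (α * β) = cartanD J I b α * β + cartanParity J I α * cartanD J I b β :=
  tensorD_mul _ _ _ _ (dForm_mul I) (fun a => contrForm_mul J I (b a)) α β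

theorem cartanD_parity (α : CartanAlg J I G M) :
    cartanD J I b (cartanParity J I α) = - cartanParity J I (cartanD J I b α) :=
  tensorD_parity _ _ _ _ (dForm_parityForm I) (fun a => contrForm_parityForm J I (b a)) α

theorem cartanD_one : cartanD J I b (1 : CartanAlg J I G M) = 0 := by
  rw [cartanD, Algebra.TensorProduct.one_def, tensorD_tmul, dForm_one]
  have h : ∀ ξ : GroupLieAlgebra J G, contrForm J I ξ (1 : DiffForm I M) = 0 := fun ξ =>
    Subtype.ext <| funext fun x => contr_one _
  simp [h]

theorem cartanParity_act (g : G) (α : CartanAlg J I G M) :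
    actCartan J I g (cartanParity J I α) = cartanParity J I (actCartan J I g α) := by
  induction α using TensorProduct.induction_on with
  | zero => simp
  | add x y hx hy => simp only [map_add, hx, hy]
  | tmul s u =>
    show actPoly J g s ⊗ₜ[ℝ] actForm J I g (parityForm I u)
      = actPoly J g s ⊗ₜ[ℝ] parityForm I (actForm J I g u)
    rw [actForm, parityForm_pullbackForm]

theorem cartanParity_cartanParity (α : CartanAlg J I G M) :
    cartanParity J I (cartanParity J I α) = α := by
  induction α using TensorProduct.induction_on with
  | zero => simp
  | add x y hx hy => simp only [map_add, hx, hy]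
  | tmul s u =>
    show s ⊗ₜ[ℝ] parityForm I (parityForm I u) = s ⊗ₜ[ℝ] u
    rw [parityForm_parityForm]

theorem cartanD_parity_mul {z β : CartanAlg J I G M} (hz : cartanD J I b z = 0) :
    cartanD J I b (cartanParity J I z * β) = z * cartanD J I b β := by
  rw [cartanD_mul, cartanD_parity, hz, map_zero, neg_zero, zero_mul, zero_add,
    cartanParity_cartanParity]

/-- The `D`-closed equivariant forms are closed under sums and products. -/
def closedForms : Subalgebra ℝ (CartanAlg J I G M) where
  carrier := {α | α ∈ EquivForm J I G M ∧ cartanD J I b α = 0}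
  mul_mem' ha hb := ⟨mul_mem ha.1 hb.1, by rw [cartanD_mul, ha.2, hb.2, zero_mul, mul_zero,
    add_zero]⟩
  add_mem' ha hb := ⟨add_mem ha.1 hb.1, by rw [map_add, ha.2, hb.2, add_zero]⟩
  algebraMap_mem' r := ⟨algebraMap_mem _ r, by
    rw [Algebra.algebraMap_eq_smul_one, map_smul, cartanD_one, smul_zero]⟩

variable (M) in
/-- The algebra of `D`-closed equivariant forms. -/
def Cocycle : Type _ := closedForms J I b (M := M)

instance : Ring (Cocycle J I M b) := inferInstanceAs (Ring (closedForms J I b (M := M)))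

instance : Algebra ℝ (Cocycle J I M b) :=
  inferInstanceAs (Algebra ℝ (closedForms J I b (M := M)))

variable (M) in
/-- The ideal of `D`-exact equivariant forms in the algebra of `D`-closed equivariant forms. -/
def Coboundary : Ideal (Cocycle J I M b) where
  carrier := {z | ∃ β ∈ EquivForm J I G M, cartanD J I b β = z.1}
  zero_mem' := ⟨0, zero_mem _, map_zero _⟩
  add_mem' := by
    rintro _ _ ⟨β, hβ, h⟩ ⟨γ, hγ, h'⟩
    exact ⟨β + γ, add_mem hβ hγ, by rw [map_add, h, h']; rfl⟩
  smul_mem' := by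
    rintro z w ⟨β, hβ, h⟩
    have hz : cartanParity J I z.1 ∈ EquivForm J I G M := fun g => by
      rw [cartanParity_act, z.2.1 g]
    exact ⟨cartanParity J I z.1 * β, mul_mem hz hβ,
      (cartanD_parity_mul J I b z.2.2).trans (congrArg (fun t => z.1 * t) h)⟩

instance : (Coboundary J I M b).IsTwoSided where
  mul_mem_of_left := by
    rintro z w ⟨β, hβ, h⟩
    refine ⟨β * w.1, mul_mem hβ w.2.1, ?_⟩
    rw [cartanD_mul, w.2.2, mul_zero, add_zero]
    exact congrArg (fun t => t * w.1) h

variable (M) in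
/-- The equivariant cohomology algebra `H_G^*(M)` in the Cartan model: `D`-closed equivariant forms
modulo `D`-exact ones. -/
abbrev EquivCohomology : Type _ := Cocycle J I M b ⧸ Coboundary J I M b

variable (M) in
/-- The cohomology class of a `D`-closed equivariant form. -/
def cohomClass : Cocycle J I M b →ₐ[ℝ] EquivCohomology J I M b :=
  Ideal.Quotient.mkₐ ℝ (Coboundary J I M b)

end Action

/-! ### Degenerate principal bundles, degenerate connections and the Chern–Weil map -/

section ChernWeil

variable {E : Type*} [NormedAddCommGroup E] [NormedSpace ℝ E] [FiniteDimensional ℝ E]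
  {H : Type*} [TopologicalSpace H]
  {EG : Type*} [NormedAddCommGroup EG] [NormedSpace ℝ EG] {HG : Type*} [TopologicalSpace HG]
  (J : ModelWithCorners ℝ EG HG) (I : ModelWithCorners ℝ E H)
  {G : Type*} [TopologicalSpace G] [ChartedSpace HG G] [Group G]
  {M : Type*} [TopologicalSpace M] [ChartedSpace H M] [MulAction G M]

/-- The singular set `W^s`: the points whose stabilizer has positive dimension. For a smooth action
of a Lie group, stabilizers are closed subgroups, hence Lie groups, and a Lie group is discrete if
and only if its dimension is zero. -/
def singularSet (G M : Type*) [TopologicalSpace G] [Group G] [MulAction G M] : Set M :=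
  {x | ¬ DiscreteTopology (MulAction.stabilizer G x)}

/-- A smooth `G`-manifold is a degenerate principal `G`-bundle if the action is locally free on an
open set which contains the boundary. -/
def IsDegeneratePrincipalBundle (G : Type*) [TopologicalSpace G] [Group G] [MulAction G M] : Prop :=
  ∃ O : Set M, IsOpen O ∧ I.boundary M ⊆ O ∧
    ∀ x ∈ O, DiscreteTopology (MulAction.stabilizer G x)

/-- An invariant smooth function with values in `[0, 1]`, which vanishes on a neighbourhood `U` of
the singular set and is equal to one outside a larger neighbourhood `V`. -/
structure IsCutoff (G : Type*) [TopologicalSpace G] [Group G] [MulAction G M] (f : M → ℝ) :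
    Prop where
  smooth : ContMDiff I 𝓘(ℝ, ℝ) ∞ f
  mem_Icc : ∀ x, f x ∈ Set.Icc (0 : ℝ) 1
  invariant : ∀ (g : G) (x : M), f (g • x) = f x
  nhds : ∃ U V : Set M, IsOpen U ∧ IsOpen V ∧ singularSet G M ⊆ U ∧ closure U ⊆ V ∧
    (∀ x ∈ U, f x = 0) ∧ ∀ x ∉ V, f x = 1

/-- A `𝔤`-valued form `θ` of degree one is a connection form on the regular part `W^0`, the
complement of the singular set: it is smooth there, equivariant, and reproduces the generators of
fundamental vector fields. The values of `θ` on the singular set are irrelevant. -/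
structure IsConnection (θ : (x : M) → TangentSpace I x →ₗ[ℝ] GroupLieAlgebra J G) : Prop where
  smooth : ∀ (l : Dual ℝ (GroupLieAlgebra J G)) (x : M), x ∉ singularSet G M →
    SmoothFormAt I (fun y => oneForm (l ∘ₗ θ y) : RoughForm I M) x
  equivariant : ∀ (g : G) (x : M), x ∉ singularSet G M → ∀ v : TangentSpace I x,
    θ (g • x) (mfderiv I I (fun y : M => g • y) x v) = Ad J g (θ x v)
  reproduces : ∀ (ξ : GroupLieAlgebra J G) (x : M), x ∉ singularSet G M →
    θ x (fundVF J I ξ x) = ξ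

variable [IsManifold I ∞ M] {f : M → ℝ}
  {θ : (x : M) → TangentSpace I x →ₗ[ℝ] GroupLieAlgebra J G}

theorem smoothFormAt_degConn (hf : IsCutoff I G f) (hθ : IsConnection J I θ)
    (l : Dual ℝ (GroupLieAlgebra J G)) (x : M) :
    SmoothFormAt I (fun y => oneForm (f y • (l ∘ₗ θ y)) : RoughForm I M) x := by
  by_cases hx : x ∈ singularSet G M
  · obtain ⟨U, V, hU, -, hsU, -, h0, -⟩ := hf.nhds
    have hr : extChartAt I x x ∈ range I := mem_range_self _
    have hc : ContDiffWithinAt ℝ ∞ (fun _ : E => (0 : Form E)) (range I) (extChartAt I x x) :=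
      contDiffWithinAt_const
    refine hc.congr_of_eventuallyEq_of_mem ?_ hr
    have h1 : ContinuousAt (extChartAt I x).symm (extChartAt I x x) :=
      continuousAt_extChartAt_symm x
    have h2 : ∀ᶠ y in 𝓝[range I] (extChartAt I x x), (extChartAt I x).symm y ∈ U := by
      refine (h1.mono_left nhdsWithin_le_nhds).eventually (hU.mem_nhds ?_)
      rw [extChartAt_to_inv]
      exact hsU hx
    filter_upwards [h2] with y hy
    show pull _ (oneForm (f _ • _)) = 0
    rw [h0 _ hy, zero_smul, map_zero, map_zero]
  · have h : (fun y => oneForm (f y • (l ∘ₗ θ y)) : RoughForm I M)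
        = (fun y => algebraMap ℝ (Form (TangentSpace I y)) (f y) : RoughForm I M)
          * (fun y => oneForm (l ∘ₗ θ y) : RoughForm I M) := by
      funext y
      show oneForm (f y • (l ∘ₗ θ y)) = algebraMap ℝ (Form (TangentSpace I y)) (f y) * _
      rw [map_smul, Algebra.smul_def]
    rw [h]
    exact smoothFormAt_mul I (smoothFormAt_fun I hf.smooth x) (hθ.smooth l x hx)

/-- The component `⟨l, θ_f⟩` of the degenerate connection `θ_f = f θ`, a smooth form of degree one
on the whole of `M`. -/
def degConn (hf : IsCutoff I G f) (hθ : IsConnection J I θ)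
    (l : Dual ℝ (GroupLieAlgebra J G)) : DiffForm I M :=
  ⟨fun y => oneForm (f y • (l ∘ₗ θ y)), smoothFormAt_degConn J I hf hθ l⟩

theorem alternate_oneForm_comm (L : E →ₗ[ℝ] Form E) (hL : ∀ v, ∃ l, L v = oneForm l)
    (w : Form E) : Commute (alternate L) w := by
  refine Finset.sum_induction _ (fun z => Commute z w) (fun _ _ => Commute.add_left)
    (Commute.zero_left w) fun i _ => ?_
  obtain ⟨l, hl⟩ := hL (finBasis ℝ E i)
  rw [hl]
  exact oneForm_mul_oneForm_comm _ _ _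

theorem pull_surjective_chartD (x : M) (w : Form (TangentSpace I x)) :
    ∃ w' : Form E, pull (chartD I x) w' = w := by
  refine ⟨pull (LinearMap.id : E →ₗ[ℝ] E) w, ?_⟩
  have h : (LinearMap.id : E →ₗ[ℝ] E) ∘ₗ chartD I x = LinearMap.id :=
    LinearMap.ext fun v => chartD_eq I x v
  exact (pull_pull (chartD I x) (V'' := TangentSpace I x) (LinearMap.id : E →ₗ[ℝ] E) w).trans
    ((congrArg (fun A => pull A w) h).trans (pull_id w))

/-- The exterior derivative of a form of degree one commutes with every form. -/
theorem dForm_oneForm_mem_center (l : (x : M) → Dual ℝ (TangentSpace I x))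
    (hl : ∀ x, SmoothFormAt I (fun y => oneForm (l y) : RoughForm I M) x) (w : DiffForm I M) :
    Commute (dForm I ⟨fun y => oneForm (l y), hl⟩ : DiffForm I M) w := by
  refine Subtype.ext <| funext fun x => ?_
  show pull (chartD I x) _ * w.1 x = w.1 x * pull (chartD I x) _
  obtain ⟨w', hw'⟩ := pull_surjective_chartD I x (w.1 x)
  rw [← hw', ← map_mul, ← map_mul]
  congr 1
  set u : E → Form E := chartRep I (fun y => oneForm (l y) : RoughForm I M) x with hu
  have hd : DifferentiableWithinAt ℝ u (range I) (extChartAt I x x) :=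
    smoothFormAt_differentiable I (hl x)
  let P : Form E →ₗ[ℝ] Form E := oneForm ∘ₗ ExteriorAlgebra.ιInv
  have hP : ∀ m : Dual ℝ E, P (oneForm m) = oneForm m := fun m =>
    congrArg oneForm (ExteriorAlgebra.ι_leftInverse m)
  have hPu : (fun z => P (u z)) = u := by
    funext z
    have h : u z = oneForm (l _ ∘ₗ chartInvD I x z) := pull_oneForm _ _
    rw [h, hP]
  have hD := fderivWithin_linear P hd (uniqueDiff_chart I x)
  rw [hPu] at hD
  refine alternate_oneForm_comm _ (fun v => ?_) w'
  exact ⟨_, congrArg (fun T => T v) hD⟩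

variable [LieGroup J ∞ G] {κ : Type*} [Fintype κ] (b : Basis κ ℝ (GroupLieAlgebra J G))

/-- The component along `ξ_a` of `dθ_f + ½ [θ_f, θ_f]`. -/
def formCurvature (hf : IsCutoff I G f) (hθ : IsConnection J I θ) (a : κ) : DiffForm I M :=
  dForm I (degConn J I hf hθ (b.coord a))
    + (1 / 2 : ℝ) • ∑ c, ∑ e, b.coord a ⁅b c, b e⁆ •
      (degConn J I hf hθ (b.coord c) * degConn J I hf hθ (b.coord e))

/-- The component along `ξ_a` of the equivariant degenerate curvature
`Ω_f^G = dθ_f + ½ [θ_f, θ_f] - (-1 + f) ξ_a Θ^a ∈ S(𝔤*) ⊗ Ω(M) ⊗ 𝔤`. -/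
def degCurvature (hf : IsCutoff I G f) (hθ : IsConnection J I θ) (a : κ) : CartanAlg J I G M :=
  1 ⊗ₜ[ℝ] formCurvature J I b hf hθ a
    - Theta J b a ⊗ₜ[ℝ] (-1 + funForm I f hf.smooth)

theorem formCurvature_commute (hf : IsCutoff I G f) (hθ : IsConnection J I θ) (a : κ)
    (w : DiffForm I M) : Commute (formCurvature J I b hf hθ a) w := by
  refine Commute.add_left (dForm_oneForm_mem_center I _ _ w) ?_
  refine Commute.smul_left (Commute.sum_left _ _ _ fun c _ => Commute.sum_left _ _ _ fun e _ =>
    Commute.smul_left ?_ _) _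
  exact Subtype.ext <| funext fun x => oneForm_mul_oneForm_comm _ _ _

/-- The components of the curvature have even degree; hence they are central. -/
theorem degCurvature_mem_center (hf : IsCutoff I G f) (hθ : IsConnection J I θ) (a : κ) :
    degCurvature J I b hf hθ a ∈ Subalgebra.center ℝ (CartanAlg J I G M) := by
  rw [Subalgebra.mem_center_iff]
  intro α
  induction α using TensorProduct.induction_on with
  | zero => simp
  | add x y hx hy => rw [add_mul, mul_add, hx, hy]
  | tmul s u =>
    have h1 : (funForm I f hf.smooth : DiffForm I M) * u = u * funForm I f hf.smooth :=
      Subtype.ext <| funext fun x => Algebra.commutes (A := Form (TangentSpace I x)) (f x) (u.1 x)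
    have h2 : (-1 + funForm I f hf.smooth) * u = u * (-1 + funForm I f hf.smooth) := by
      rw [add_mul, mul_add, h1, neg_one_mul, mul_neg_one]
    rw [degCurvature, mul_sub, sub_mul, Algebra.TensorProduct.tmul_mul_tmul,
      Algebra.TensorProduct.tmul_mul_tmul, Algebra.TensorProduct.tmul_mul_tmul,
      Algebra.TensorProduct.tmul_mul_tmul, mul_one, one_mul, h2, mul_comm s,
      (formCurvature_commute J I b hf hθ a u).eq]

/-- The map `F ↦ F(Ω_f^G)`, `S(𝔤*) → S(𝔤*) ⊗ Ω(M)`: the homomorphism of algebras which sends a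
linear form `l` on `𝔤` to `l(Ω_f^G) = ∑ₐ l(ξ_a) Ω^a`. -/
def chernWeil (hf : IsCutoff I G f) (hθ : IsConnection J I θ) :
    Poly J G →ₐ[ℝ] CartanAlg J I G M :=
  (Subalgebra.center ℝ (CartanAlg J I G M)).val.comp <|
    SymmetricAlgebra.lift <|
      ∑ a, (Dual.eval ℝ (GroupLieAlgebra J G) (b a)).smulRight
        (⟨degCurvature J I b hf hθ a, degCurvature_mem_center J I b hf hθ a⟩ :
          Subalgebra.center ℝ (CartanAlg J I G M))

theorem chernWeil_ι (hf : IsCutoff I G f) (hθ : IsConnection J I θ)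
    (l : Dual ℝ (GroupLieAlgebra J G)) :
    chernWeil J I b hf hθ (SymmetricAlgebra.ι ℝ _ l) = ∑ a, l (b a) • degCurvature J I b hf hθ a := by
  simp [chernWeil]

/-- Polynomials on `𝔤` which are homogeneous of degree `p`. -/
def polyDeg (G : Type*) [TopologicalSpace G] [ChartedSpace HG G] [Group G] (p : ℕ) :
    Submodule ℝ (Poly J G) :=
  LinearMap.range (SymmetricAlgebra.ι ℝ (Dual ℝ (GroupLieAlgebra J G))) ^ p

/-- Smooth differential forms of degree `k`. -/
def formDeg (M : Type*) [TopologicalSpace M] [ChartedSpace H M] (k : ℕ) :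
    Submodule ℝ (DiffForm I M) where
  carrier := {u | ∀ x, u.1 x ∈ ⋀[ℝ]^k (Dual ℝ (TangentSpace I x))}
  zero_mem' _ := zero_mem _
  add_mem' hu hw x := add_mem (hu x) (hw x)
  smul_mem' c _ hu x := Submodule.smul_mem _ c (hu x)

/-- Elements of `S(𝔤*) ⊗ Ω(M)` of total degree `n`, where the generators of `S(𝔤*)` have
degree two. -/
def cartanDeg (G M : Type*) [TopologicalSpace G] [ChartedSpace HG G] [Group G]
    [TopologicalSpace M] [ChartedSpace H M] (n : ℕ) : Submodule ℝ (CartanAlg J I G M) :=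
  ⨆ (p : ℕ) (k : ℕ) (_ : 2 * p + k = n),
    Submodule.map₂ (TensorProduct.mk ℝ (Poly J G) (DiffForm I M)) (polyDeg J G p) (formDeg I M k)

end ChernWeil

end

end DegCW

namespace DegCW

noncomputable section

/-! ### Derivations of symmetric algebras -/

section SymmetricAlgebraDerivation

variable {V : Type*} [AddCommGroup V] [Module ℝ V]

/-- An endomorphism of a free module extends to a derivation of its symmetric algebra. -/
theorem exists_derivation_symmetricAlgebra {ι : Type*} (b : Basis ι ℝ V) (N : V →ₗ[ℝ] V) :
    ∃ δ : SymmetricAlgebra ℝ V →ₗ[ℝ] SymmetricAlgebra ℝ V,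
      (∀ F K, δ (F * K) = δ F * K + F * δ K) ∧
        ∀ v, δ (SymmetricAlgebra.ι ℝ V v) = SymmetricAlgebra.ι ℝ V (N v) := by
  let e := SymmetricAlgebra.equivMvPolynomial b
  let D := MvPolynomial.mkDerivation ℝ fun i => e (SymmetricAlgebra.ι ℝ V (N (b i)))
  let δ : SymmetricAlgebra ℝ V →ₗ[ℝ] SymmetricAlgebra ℝ V :=
    e.symm.toLinearMap ∘ₗ D.toLinearMap ∘ₗ e.toLinearMap
  have hδ : ∀ F, δ F = e.symm (D (e F)) := fun _ => rfl
  refine ⟨δ, fun F K => ?_, fun v => ?_⟩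
  · rw [hδ, hδ, hδ, map_mul, Derivation.leibniz, map_add, smul_eq_mul, smul_eq_mul, map_mul,
      map_mul, e.symm_apply_apply, e.symm_apply_apply]
    ring
  · have h : δ ∘ₗ SymmetricAlgebra.ι ℝ V = SymmetricAlgebra.ι ℝ V ∘ₗ N := by
      refine b.ext fun i => ?_
      show e.symm (D (e (SymmetricAlgebra.ι ℝ V (b i)))) = SymmetricAlgebra.ι ℝ V (N (b i))
      rw [show e (SymmetricAlgebra.ι ℝ V (b i)) = MvPolynomial.X i from
        SymmetricAlgebra.equivMvPolynomial_ι_apply b i, MvPolynomial.mkDerivation_X,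
        e.symm_apply_apply]
    exact congrArg (fun T => T v) h

variable {W : Type*} [AddCommGroup W] [Module ℝ W]

/-- Evaluation of a polynomial on `W`, that is an element of `S(W*)`, at a point of `W`. -/
def evalSym (w : W) : SymmetricAlgebra ℝ (Dual ℝ W) →ₐ[ℝ] ℝ :=
  SymmetricAlgebra.lift (Dual.eval ℝ W w)

@[simp] theorem evalSym_ι (w : W) (l : Dual ℝ W) :
    evalSym w (SymmetricAlgebra.ι ℝ _ l) = l w := by
  simp [evalSym]

theorem eq_zero_of_evalSym {κ : Type*} [Fintype κ] (b : Basis κ ℝ W)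
    {F : SymmetricAlgebra ℝ (Dual ℝ W)} (h : ∀ w, evalSym w F = 0) : F = 0 := by
  classical
  let e := SymmetricAlgebra.equivMvPolynomial b.dualBasis
  have key : ∀ x : κ → ℝ, ((MvPolynomial.aeval x).comp e.toAlgHom :
      SymmetricAlgebra ℝ (Dual ℝ W) →ₐ[ℝ] ℝ) = evalSym (∑ i, x i • b i) := by
    intro x
    refine SymmetricAlgebra.algHom_ext (b.dualBasis.ext fun i => ?_)
    show MvPolynomial.aeval x (e (SymmetricAlgebra.ι ℝ _ (b.dualBasis i)))
      = evalSym _ (SymmetricAlgebra.ι ℝ _ (b.dualBasis i))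
    rw [show e (SymmetricAlgebra.ι ℝ _ (b.dualBasis i)) = MvPolynomial.X i from
        SymmetricAlgebra.equivMvPolynomial_ι_apply b.dualBasis i, MvPolynomial.aeval_X, evalSym_ι]
    simp [Finsupp.single_apply]
  refine (map_eq_zero_iff e e.injective).mp (MvPolynomial.funext fun x => ?_)
  have h1 := congrArg (fun T => T F) (key x)
  rw [map_zero]
  exact h1.trans (h _)

/-- The derivative of a polynomial along a curve. -/
theorem hasDerivAt_evalSym {c : ℝ → W} {w' : W} {t : ℝ}
    (hc : ∀ l : Dual ℝ W, HasDerivAt (fun s => l (c s)) (l w') t)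
    {N : Dual ℝ W →ₗ[ℝ] Dual ℝ W} (hN : ∀ l, N l (c t) = l w')
    {δ : SymmetricAlgebra ℝ (Dual ℝ W) →ₗ[ℝ] SymmetricAlgebra ℝ (Dual ℝ W)}
    (hδ : ∀ F K, δ (F * K) = δ F * K + F * δ K)
    (hδι : ∀ l, δ (SymmetricAlgebra.ι ℝ _ l) = SymmetricAlgebra.ι ℝ _ (N l))
    (F : SymmetricAlgebra ℝ (Dual ℝ W)) :
    HasDerivAt (fun s => evalSym (c s) F) (evalSym (c t) (δ F)) t := by
  have h1 : δ 1 = 0 := by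
    have := hδ 1 1
    simpa using this
  induction F using SymmetricAlgebra.induction with
  | algebraMap r =>
    rw [Algebra.algebraMap_eq_smul_one, map_smul, h1, smul_zero, map_zero]
    simp only [map_smul, map_one]
    exact hasDerivAt_const _ _
  | ι l =>
    rw [hδι]
    simp only [evalSym_ι, hN]
    exact hc l
  | mul a b ha hb =>
    rw [hδ, map_add, map_mul, map_mul]
    simp only [map_mul]
    exact ha.mul hb
  | add a b ha hb =>
    rw [map_add, map_add]
    simp only [map_add]
    exact ha.add hb

/-- A homomorphism `φ` from a symmetric algebra to the even centre of a differential algebra which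
satisfies `D φ = - ∑ₐ Tₐ φ δₐ` on generators, for derivations `δₐ`, satisfies it everywhere. -/
theorem differential_algHom_symmetricAlgebra {A κ : Type*} [Ring A] [Algebra ℝ A] [Fintype κ]
    {D : A →ₗ[ℝ] A} {p : A →ₐ[ℝ] A} (hD : ∀ x y, D (x * y) = D x * y + p x * D y)
    {φ : SymmetricAlgebra ℝ V →ₐ[ℝ] A} (hφ : ∀ F x, Commute (φ F) x)
    (hp : ∀ v, p (φ (SymmetricAlgebra.ι ℝ V v)) = φ (SymmetricAlgebra.ι ℝ V v))
    {T : κ → A} {δ : κ → SymmetricAlgebra ℝ V →ₗ[ℝ] SymmetricAlgebra ℝ V}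
    (hδ : ∀ a F K, δ a (F * K) = δ a F * K + F * δ a K)
    (h : ∀ v, D (φ (SymmetricAlgebra.ι ℝ V v))
      = - ∑ a, T a * φ (δ a (SymmetricAlgebra.ι ℝ V v))) (F : SymmetricAlgebra ℝ V) :
    D (φ F) = - ∑ a, T a * φ (δ a F) := by
  have hp' : ∀ F, p (φ F) = φ F := fun F => by
    induction F using SymmetricAlgebra.induction with
    | algebraMap r => rw [AlgHom.commutes, AlgHom.commutes]
    | ι l => exact hp l
    | mul a b ha hb => rw [map_mul, map_mul, ha, hb]
    | add a b ha hb => rw [map_add, map_add, ha, hb]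
  have h1 : ∀ a, δ a 1 = 0 := fun a => by simpa using hδ a 1 1
  have hD1 : D 1 = 0 := by simpa using hD 1 1
  induction F using SymmetricAlgebra.induction with
  | algebraMap r =>
    simp [Algebra.algebraMap_eq_smul_one, h1, hD1]
  | ι l => exact h l
  | mul a b ha hb =>
    rw [map_mul, hD, hp', ha, hb, neg_mul, mul_neg, ← neg_add, Finset.sum_mul, Finset.mul_sum,
      ← Finset.sum_add_distrib]
    congr 1
    refine Finset.sum_congr rfl fun i _ => ?_
    rw [hδ, map_add, map_mul, map_mul, mul_add, ← mul_assoc (φ a), (hφ a (T i)).eq]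
    simp only [mul_assoc]
  | add a b ha hb =>
    simp only [map_add, ha, hb, mul_add, Finset.sum_add_distrib, neg_add]

end SymmetricAlgebraDerivation

/-! ### The Bianchi identity -/

section Bianchi

variable {Ω κ : Type*} [Ring Ω] [Algebra ℝ Ω] [Fintype κ]

/-- The `a`-th component of `dθ + ½ [θ, θ]`, for structure constants `C`. -/
def curvatureComponent (d : Ω →ₗ[ℝ] Ω) (θ : κ → Ω) (C : κ → κ → κ → ℝ) (a : κ) : Ω :=
  d (θ a) + (1 / 2 : ℝ) • ∑ c, ∑ e, C a c e • (θ c * θ e)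

theorem sum_cyclic_smul_mul_eq_zero {θ : κ → Ω} (hθ : ∀ a c, θ a * θ c = - (θ c * θ a))
    {K : κ → κ → κ → ℝ} (hK : ∀ c p q, K c p q + K p q c + K q c p = 0) :
    ∑ c, ∑ p, ∑ q, K c p q • (θ c * (θ p * θ q)) = 0 := by
  have hcyc : ∀ c p q, θ p * (θ q * θ c) = θ c * (θ p * θ q) := fun c p q => by
    rw [hθ q c, mul_neg, ← mul_assoc, hθ p c, neg_mul, neg_neg, mul_assoc]
  have hsum : ∀ h : κ → κ → κ → Ω, ∑ c, ∑ p, ∑ q, h p q c = ∑ c, ∑ p, ∑ q, h c p q := by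
    intro h
    rw [Finset.sum_comm]
    exact Finset.sum_congr rfl fun p _ => Finset.sum_comm
  set S := ∑ c, ∑ p, ∑ q, K c p q • (θ c * (θ p * θ q)) with hS
  have h1 : ∑ c, ∑ p, ∑ q, K p q c • (θ c * (θ p * θ q)) = S := by
    rw [hS, ← hsum fun c p q => K c p q • (θ c * (θ p * θ q))]
    simp only [hcyc]
  have h2 : ∑ c, ∑ p, ∑ q, K q c p • (θ c * (θ p * θ q)) = S := by
    rw [← h1, ← hsum fun c p q => K p q c • (θ c * (θ p * θ q))]
    simp only [hcyc]
  have h3 : S + S + S = 0 := by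
    nth_rewrite 3 [← h2]
    nth_rewrite 2 [← h1]
    rw [hS]
    simp only [← Finset.sum_add_distrib, ← add_smul, hK, zero_smul, Finset.sum_const_zero]
  have h4 : (3 : ℝ) • S = 0 := by
    rw [← h3, ← two_add_one_eq_three, add_smul, two_smul, one_smul]
  exact (smul_eq_zero.mp h4).resolve_left (by norm_num)

theorem d_curvatureComponent {d : Ω →ₗ[ℝ] Ω} {p : Ω →ₐ[ℝ] Ω} {θ : κ → Ω}
    {C : κ → κ → κ → ℝ} (hd : ∀ u w, d (u * w) = d u * w + p u * d w)
    (hdd : ∀ a, d (d (θ a)) = 0) (hp : ∀ a, p (θ a) = - θ a)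
    (hθ : ∀ a c, θ a * θ c = - (θ c * θ a)) (hdc : ∀ a u, Commute (d (θ a)) u)
    (hC : ∀ a c e, C a c e = - C a e c)
    (hJ : ∀ a c r q, ∑ e, (C a c e * C e r q + C a r e * C e q c + C a q e * C e c r) = 0) (a : κ) :
    d (curvatureComponent d θ C a)
      = - ∑ c, ∑ e, C a c e • (θ c * curvatureComponent d θ C e) := by
  have h1 : ∑ c, ∑ e, C a c e • (d (θ c) * θ e) = - ∑ c, ∑ e, C a c e • (θ c * d (θ e)) := by
    rw [Finset.sum_comm, ← Finset.sum_neg_distrib]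
    refine Finset.sum_congr rfl fun c _ => ?_
    rw [← Finset.sum_neg_distrib]
    refine Finset.sum_congr rfl fun e _ => ?_
    rw [(hdc e (θ c)).eq, hC, neg_smul]
  have h2 : ∑ c, ∑ e, C a c e • (θ c * ∑ r, ∑ q, C e r q • (θ r * θ q)) = 0 := by
    have h3 : ∀ c r q, ∑ e, C a c e * C e r q + ∑ e, C a r e * C e q c
        + ∑ e, C a q e * C e c r = 0 := fun c r q => by
      rw [← Finset.sum_add_distrib, ← Finset.sum_add_distrib, hJ]
    rw [← sum_cyclic_smul_mul_eq_zero hθ (K := fun c r q => ∑ e, C a c e * C e r q) h3]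
    refine Finset.sum_congr rfl fun c _ => ?_
    simp only [Finset.mul_sum, Finset.smul_sum, Finset.sum_smul, mul_smul_comm, smul_smul]
    rw [Finset.sum_comm]
    exact Finset.sum_congr rfl fun r _ => Finset.sum_comm
  have h4 : ∑ c, ∑ e, C a c e • (θ c * curvatureComponent d θ C e)
      = ∑ c, ∑ e, C a c e • (θ c * d (θ e)) := by
    simp only [curvatureComponent, mul_add, smul_add, Finset.sum_add_distrib, mul_smul_comm,
      smul_comm _ (1 / 2 : ℝ), ← Finset.smul_sum, h2, smul_zero, add_zero]
  rw [h4, curvatureComponent, map_add, hdd, zero_add, map_smul, map_sum]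
  simp only [map_sum, map_smul, hd, hp, neg_mul, smul_add, smul_neg, Finset.sum_add_distrib,
    Finset.sum_neg_distrib, h1]
  rw [← neg_add, ← add_smul]
  norm_num

variable {S : Type*} [CommRing S] [Algebra ℝ S]

/-- The equivariant Bianchi identity: `D` applied to the equivariant degenerate curvature is
`-[θ_f, Ω_f^G]`. -/
theorem tensorD_equivariantCurvature [DecidableEq κ] {d : Ω →ₗ[ℝ] Ω} {c : κ → Ω →ₗ[ℝ] Ω}
    {Θ : κ → S} {p : Ω →ₐ[ℝ] Ω} {θ : κ → Ω} {f : Ω}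
    {C : κ → κ → κ → ℝ} (hd : ∀ u w, d (u * w) = d u * w + p u * d w)
    (hc : ∀ a u w, c a (u * w) = c a u * w + p u * c a w)
    (hdd : ∀ a, d (d (θ a)) = 0) (hp : ∀ a, p (θ a) = - θ a)
    (hθ : ∀ a e, θ a * θ e = - (θ e * θ a)) (hdc : ∀ a u, Commute (d (θ a)) u)
    (hf : ∀ u, Commute f u)
    (hC : ∀ a r e, C a r e = - C a e r)
    (hJ : ∀ a r s q, ∑ e, (C a r e * C e s q + C a s e * C e q r + C a q e * C e r s) = 0)
    (hcθ : ∀ a e, c a (θ e) = if a = e then f else 0) (hcf : ∀ a, c a f = 0)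
    (hcd : ∀ e a, c e (d (θ a)) = - (∑ q, C a e q • θ q) - if e = a then d f else 0) (a : κ) :
    tensorD d c Θ (1 ⊗ₜ[ℝ] curvatureComponent d θ C a - Θ a ⊗ₜ[ℝ] (-1 + f))
      = - ∑ r, ∑ e, C a r e • (((1 : S) ⊗ₜ[ℝ] θ r)
          * (1 ⊗ₜ[ℝ] curvatureComponent d θ C e - Θ e ⊗ₜ[ℝ] (-1 + f))) := by
  have hd1 : d 1 = 0 := by simpa using hd 1 1
  have hc1 : ∀ a, c a 1 = 0 := fun a => by simpa using hc a 1 1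
  have h1 : ∀ e, c e (∑ r, ∑ s, C a r s • (θ r * θ s)) = (2 : ℝ) • ∑ q, C a e q • (f * θ q) := by
    intro e
    have h2 : ∑ r, ∑ s, C a r s • (c e (θ r) * θ s) = ∑ q, C a e q • (f * θ q) := by
      simp [hcθ, ite_mul, Finset.sum_ite_irrel]
    have h3 : ∑ r, ∑ s, C a r s • (θ r * c e (θ s)) = - ∑ q, C a e q • (f * θ q) := by
      rw [← Finset.sum_neg_distrib]
      refine Finset.sum_congr rfl fun r _ => ?_
      rw [hC a e r, neg_smul, neg_neg, (hf _).eq]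
      simp [hcθ]
    simp only [map_sum, map_smul, hc, hp, neg_mul, smul_add, smul_neg, Finset.sum_add_distrib,
      Finset.sum_neg_distrib, h2, h3, neg_neg, two_smul]
  have h4 : ∀ e, c e (curvatureComponent d θ C a)
      = ∑ q, C a e q • ((-1 + f) * θ q) - if e = a then d f else 0 := by
    intro e
    rw [curvatureComponent, map_add, map_smul, h1, smul_smul, hcd]
    simp only [add_mul, neg_mul, one_mul, smul_add, smul_neg, Finset.sum_add_distrib,
      Finset.sum_neg_distrib]
    norm_num
    abel
  rw [map_sub, tensorD_tmul, tensorD_tmul, d_curvatureComponent hd hdd hp hθ hdc hC hJ, map_add,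
    map_neg, hd1, neg_zero, zero_add]
  have h5 : ∑ e, (Θ e * Θ a) ⊗ₜ[ℝ] c e (-1 + f) = (0 : S ⊗[ℝ] Ω) := by
    simp [hc1, hcf]
  have h6 : ∑ e, (Θ e * 1) ⊗ₜ[ℝ] c e (curvatureComponent d θ C a)
      = (∑ e, ∑ q, C a e q • (Θ e ⊗ₜ[ℝ] ((-1 + f) * θ q))) - Θ a ⊗ₜ[ℝ] d f := by
    simp only [h4, TensorProduct.tmul_sub, TensorProduct.tmul_sum, TensorProduct.tmul_smul,
      mul_one, Finset.sum_sub_distrib]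
    congr 1
    rw [Finset.sum_eq_single a] <;> simp +contextual
  have h7 : ∑ r, ∑ e, C a r e • (((1 : S) ⊗ₜ[ℝ] θ r)
          * (1 ⊗ₜ[ℝ] curvatureComponent d θ C e - Θ e ⊗ₜ[ℝ] (-1 + f)))
      = (1 : S) ⊗ₜ[ℝ] (∑ r, ∑ e, C a r e • (θ r * curvatureComponent d θ C e))
        + ∑ e, ∑ q, C a e q • (Θ e ⊗ₜ[ℝ] ((-1 + f) * θ q)) := by
    have hcom : ∀ q, (-1 + f) * θ q = θ q * (-1 + f) := fun q => by
      rw [add_mul, mul_add, (hf _).eq, neg_one_mul, mul_neg_one]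
    simp only [mul_sub, Algebra.TensorProduct.tmul_mul_tmul, mul_one, one_mul, smul_sub,
      Finset.sum_sub_distrib, TensorProduct.tmul_sum, TensorProduct.tmul_smul]
    rw [sub_eq_add_neg]
    congr 1
    rw [Finset.sum_comm, ← Finset.sum_neg_distrib]
    refine Finset.sum_congr rfl fun e _ => ?_
    rw [← Finset.sum_neg_distrib]
    refine Finset.sum_congr rfl fun q _ => ?_
    rw [hC, neg_smul, neg_neg, hcom]
  rw [h5, h6, h7, TensorProduct.tmul_neg]
  abel

end Bianchi

/-! ### Further properties of the exterior derivative -/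

section ExteriorDerivative

variable {E : Type*} [NormedAddCommGroup E] [NormedSpace ℝ E] [FiniteDimensional ℝ E]

/-- Antisymmetrization, as a linear map on continuous linear maps. -/
def alternateL : (E →L[ℝ] Form E) →ₗ[ℝ] Form E where
  toFun L := alternate L.toLinearMap
  map_add' L M := alternate_add L.toLinearMap M.toLinearMap
  map_smul' c L := alternate_smul c L.toLinearMap

theorem extd_extd {s : Set E} {w : E → Form E} {y : E} (hw : ContDiffWithinAt ℝ ∞ w s y)
    (hs : UniqueDiffOn ℝ s) (hy : y ∈ s) (hc : y ∈ closure (interior s)) :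
    extd s (extd s w) y = 0 := by
  have hA := hw.fderivWithin_right hs (m := ∞) (by simp) hy
  have hsym : IsSymmSndFDerivWithinAt ℝ w s y :=
    (hw.of_le (m := 2) (by norm_cast)).isSymmSndFDerivWithinAt (by simp) hs hc hy
  set B := fderivWithin ℝ (fderivWithin ℝ w s) s y
  set b := finBasis ℝ E
  have h1 : extd s (extd s w) y = alternate (alternateL ∘ₗ B.toLinearMap) := by
    show alternate (fderivWithin ℝ (fun z => alternateL (fderivWithin ℝ w s z)) s y).toLinearMap = _
    rw [fderivWithin_linear alternateL (hA.differentiableWithinAt (by simp)) (hs y hy)]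
  have h2 : alternate (alternateL ∘ₗ B.toLinearMap)
      = ∑ i, ∑ j, oneForm (b.coord i) * (oneForm (b.coord j) * B (b i) (b j)) := by
    refine Finset.sum_congr rfl fun i _ => ?_
    show oneForm (b.coord i) * ∑ j, oneForm (b.coord j) * B (b i) (b j) = _
    rw [Finset.mul_sum]
  have h3 : alternate (alternateL ∘ₗ B.toLinearMap)
      = - alternate (alternateL ∘ₗ B.toLinearMap) := by
    nth_rewrite 1 [h2]
    rw [Finset.sum_comm, h2, ← Finset.sum_neg_distrib]
    refine Finset.sum_congr rfl fun i _ => ?_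
    rw [← Finset.sum_neg_distrib]
    refine Finset.sum_congr rfl fun j _ => ?_
    rw [hsym.eq, ← mul_assoc, oneForm_mul_swap, neg_mul, mul_assoc]
  have h4 := eq_neg_iff_add_eq_zero.mp h3
  rw [← two_smul ℝ, smul_eq_zero] at h4
  exact h1.trans (h4.resolve_left two_ne_zero)

variable {H : Type*} [TopologicalSpace H]
  (I : ModelWithCorners ℝ E H) {M : Type*} [TopologicalSpace M] [ChartedSpace H M]
  [IsManifold I ∞ M]

theorem dForm_dForm (u : DiffForm I M) : dForm I (dForm I u) = 0 := by
  refine Subtype.ext <| funext fun x => ?_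
  have hr : extChartAt I x x ∈ range I := mem_range_self _
  have h1 : chartRep I (roughD I u.1) x =ᶠ[𝓝[range I] (extChartAt I x x)]
      extd (range I) (chartRep I u.1 x) := by
    filter_upwards [extChartAt_target_mem_nhdsWithin (I := I) x] with y hy
    exact chartRep_roughD I hy (u.2 _)
  show pull (chartD I x) (extd (range I) (chartRep I (roughD I u.1) x) (extChartAt I x x)) = 0
  rw [extd_congr h1 hr, extd_extd (u.2 x) I.uniqueDiffOn hr (I.range_subset_closure_interior hr),
    map_zero]

theorem dForm_pullbackForm (f : M → M) (hf : ContMDiff I I ∞ f) (u : DiffForm I M) :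
    dForm I (pullbackForm I f hf u) = pullbackForm I f hf (dForm I u) := by
  refine Subtype.ext <| funext fun x => ?_
  have h := (chartRep_pullback_smooth I hf (mem_extChartAt_source (I := I) x) (u.2 (f x))).2
  show pull (chartD I x) (extd (range I) (chartRep I (roughPullback I f u.1) x) (extChartAt I x x))
    = pull (mfderiv I I f x).toLinearMap (pull (chartD I (f x)) _)
  rw [h, pull_pull, pull_pull]
  congr 2
  refine LinearMap.ext fun v => ?_
  show fderivWithin ℝ (coordMap I f x (f x)) (range I) (extChartAt I x x) (chartD I x v)
    = chartD I (f x) (mfderiv I I f x v)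
  rw [chartD_eq, chartD_eq, (hf.mdifferentiableAt (by simp)).mfderiv]
  rfl

end ExteriorDerivative

/-! ### Degrees -/

section Degree

variable {V V' : Type*} [AddCommGroup V] [Module ℝ V] [AddCommGroup V'] [Module ℝ V']

theorem oneForm_mem_exteriorPower (l : Dual ℝ V) : oneForm l ∈ ⋀[ℝ]^1 (Dual ℝ V) := by
  rw [ExteriorAlgebra.exteriorPower, pow_one]
  exact LinearMap.mem_range_self _ l

theorem mul_mem_exteriorPower {k m : ℕ} {u w : Form V} (hu : u ∈ ⋀[ℝ]^k (Dual ℝ V))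
    (hw : w ∈ ⋀[ℝ]^m (Dual ℝ V)) : u * w ∈ ⋀[ℝ]^(k + m) (Dual ℝ V) := by
  rw [ExteriorAlgebra.exteriorPower, pow_add]
  exact Submodule.mul_mem_mul hu hw

theorem pull_mem_exteriorPower (A : V →ₗ[ℝ] V') {k : ℕ} {u : Form V'}
    (hu : u ∈ ⋀[ℝ]^k (Dual ℝ V')) : pull A u ∈ ⋀[ℝ]^k (Dual ℝ V) := by
  have h : (⋀[ℝ]^k (Dual ℝ V')).map (pull A).toLinearMap ≤ ⋀[ℝ]^k (Dual ℝ V) := by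
    rw [ExteriorAlgebra.exteriorPower, ExteriorAlgebra.exteriorPower, Submodule.map_pow]
    refine pow_le_pow_left' ?_ k
    rintro _ ⟨_, ⟨l, rfl⟩, rfl⟩
    exact ⟨l ∘ₗ A, (pull_oneForm A l).symm⟩
  exact h (Submodule.mem_map_of_mem hu)

theorem alternate_mem_exteriorPower [FiniteDimensional ℝ V] {k : ℕ} {L : V →ₗ[ℝ] Form V}
    (hL : ∀ v, L v ∈ ⋀[ℝ]^k (Dual ℝ V)) : alternate L ∈ ⋀[ℝ]^(1 + k) (Dual ℝ V) :=
  Submodule.sum_mem _ fun _ _ => mul_mem_exteriorPower (oneForm_mem_exteriorPower _) (hL _)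

variable {E : Type*} [NormedAddCommGroup E] [NormedSpace ℝ E] [FiniteDimensional ℝ E]
  {H : Type*} [TopologicalSpace H]
  {EG : Type*} [NormedAddCommGroup EG] [NormedSpace ℝ EG] {HG : Type*} [TopologicalSpace HG]
  (J : ModelWithCorners ℝ EG HG) (I : ModelWithCorners ℝ E H)
  {G : Type*} [TopologicalSpace G] [ChartedSpace HG G] [Group G]
  {M : Type*} [TopologicalSpace M] [ChartedSpace H M]

theorem mul_mem_formDeg {k m : ℕ} {u w : DiffForm I M} (hu : u ∈ formDeg I M k)
    (hw : w ∈ formDeg I M m) : u * w ∈ formDeg I M (k + m) :=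
  fun x => mul_mem_exteriorPower (hu x) (hw x)

theorem one_mem_formDeg : (1 : DiffForm I M) ∈ formDeg I M 0 := fun x => by
  show (1 : Form (TangentSpace I x)) ∈ _
  rw [ExteriorAlgebra.exteriorPower, pow_zero]
  exact Submodule.one_le.mp le_rfl

theorem funForm_mem_formDeg [IsManifold I ∞ M] (f : M → ℝ) (hf : ContMDiff I 𝓘(ℝ, ℝ) ∞ f) :
    funForm I f hf ∈ formDeg I M 0 := fun x => by
  show algebraMap ℝ (Form (TangentSpace I x)) (f x) ∈ _
  rw [ExteriorAlgebra.exteriorPower, pow_zero]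
  exact Submodule.algebraMap_mem _

/-- Exterior derivatives of forms of degree one have degree two. -/
theorem dForm_oneForm_mem_formDeg [IsManifold I ∞ M] (l : (x : M) → Dual ℝ (TangentSpace I x))
    (hl : ∀ x, SmoothFormAt I (fun y => oneForm (l y) : RoughForm I M) x) :
    dForm I ⟨fun y => oneForm (l y), hl⟩ ∈ formDeg I M 2 := by
  intro x
  show pull (chartD I x) _ ∈ _
  refine pull_mem_exteriorPower _ (alternate_mem_exteriorPower (k := 1) fun v => ?_)
  set u : E → Form E := chartRep I (fun y => oneForm (l y) : RoughForm I M) x with hu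
  let P : Form E →ₗ[ℝ] Form E := oneForm ∘ₗ ExteriorAlgebra.ιInv
  have hP : ∀ m : Dual ℝ E, P (oneForm m) = oneForm m := fun m =>
    congrArg oneForm (ExteriorAlgebra.ι_leftInverse m)
  have hPu : (fun z => P (u z)) = u := by
    funext z
    have h : u z = oneForm (l _ ∘ₗ chartInvD I x z) := pull_oneForm _ _
    rw [h, hP]
  have hD := fderivWithin_linear P (smoothFormAt_differentiable I (hl x)) (uniqueDiff_chart I x)
  rw [hPu] at hD
  have h1 : fderivWithin ℝ u (range I) (extChartAt I x x) v
      = P (fderivWithin ℝ u (range I) (extChartAt I x x) v) := congrArg (fun T => T v) hD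
  show fderivWithin ℝ u (range I) (extChartAt I x x) v ∈ _
  rw [h1]
  exact oneForm_mem_exteriorPower _

theorem tmul_mem_cartanDeg {p k n : ℕ} (h : 2 * p + k = n) {F : Poly J G} {u : DiffForm I M}
    (hF : F ∈ polyDeg J G p) (hu : u ∈ formDeg I M k) : F ⊗ₜ[ℝ] u ∈ cartanDeg J I G M n :=
  Submodule.mem_iSup_of_mem p <| Submodule.mem_iSup_of_mem k <| Submodule.mem_iSup_of_mem h <|
    Submodule.apply_mem_map₂ (TensorProduct.mk ℝ (Poly J G) (DiffForm I M)) hF hu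

theorem cartanDeg_mul_le (m n : ℕ) :
    cartanDeg J I G M m * cartanDeg J I G M n ≤ cartanDeg J I G M (m + n) := by
  rw [cartanDeg, cartanDeg]
  simp only [Submodule.iSup_mul, Submodule.mul_iSup, iSup_le_iff]
  intro p k h q l h'
  rw [Submodule.mul_le]
  intro α hα β hβ
  have h1 : Submodule.map₂ (TensorProduct.mk ℝ (Poly J G) (DiffForm I M)) (polyDeg J G q)
      (formDeg I M l) ≤ (cartanDeg J I G M (m + n)).comap (LinearMap.mulRight ℝ β) := by
    refine Submodule.map₂_le.2 fun F hF u hu => ?_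
    have h2 : Submodule.map₂ (TensorProduct.mk ℝ (Poly J G) (DiffForm I M)) (polyDeg J G p)
        (formDeg I M k) ≤ (cartanDeg J I G M (m + n)).comap (LinearMap.mulLeft ℝ (F ⊗ₜ[ℝ] u)) := by
      refine Submodule.map₂_le.2 fun K hK w hw => ?_
      show (F ⊗ₜ[ℝ] u) * (K ⊗ₜ[ℝ] w) ∈ cartanDeg J I G M (m + n)
      rw [Algebra.TensorProduct.tmul_mul_tmul]
      refine tmul_mem_cartanDeg J I (p := q + p) (by omega) ?_ (mul_mem_formDeg I hu hw)
      rw [polyDeg, pow_add]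
      exact Submodule.mul_mem_mul hF hK
    exact h2 hβ
  exact h1 hα

variable [MulAction G M] [IsManifold I ∞ M] [LieGroup J ∞ G] {f : M → ℝ}
  {θ : (x : M) → TangentSpace I x →ₗ[ℝ] GroupLieAlgebra J G}
  {κ : Type*} [Fintype κ] (b : Basis κ ℝ (GroupLieAlgebra J G))

theorem degConn_mem_formDeg (hf : IsCutoff I G f) (hθ : IsConnection J I θ)
    (l : Dual ℝ (GroupLieAlgebra J G)) : degConn J I hf hθ l ∈ formDeg I M 1 :=
  fun _ => oneForm_mem_exteriorPower _

theorem degCurvature_mem_cartanDeg (hf : IsCutoff I G f) (hθ : IsConnection J I θ) (a : κ) :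
    degCurvature J I b hf hθ a ∈ cartanDeg J I G M 2 := by
  refine sub_mem (tmul_mem_cartanDeg J I (p := 0) (k := 2) rfl ?_ ?_)
    (tmul_mem_cartanDeg J I (p := 1) (k := 0) rfl ?_ ?_)
  · rw [polyDeg, pow_zero]
    exact Submodule.one_le.mp le_rfl
  · refine add_mem (dForm_oneForm_mem_formDeg I _ _) (Submodule.smul_mem _ _ ?_)
    exact sum_mem fun c _ => sum_mem fun e _ => Submodule.smul_mem _ _ <|
      mul_mem_formDeg I (k := 1) (m := 1) (degConn_mem_formDeg J I hf hθ _)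
        (degConn_mem_formDeg J I hf hθ _)
  · rw [polyDeg, pow_one]
    exact LinearMap.mem_range_self _ _
  · exact add_mem (neg_mem (one_mem_formDeg I)) (funForm_mem_formDeg I f hf.smooth)

/-- The Chern–Weil map doubles degrees. -/
theorem chernWeil_mem_cartanDeg (hf : IsCutoff I G f) (hθ : IsConnection J I θ) (q : ℕ)
    {F : Poly J G} (hF : F ∈ polyDeg J G q) :
    chernWeil J I b hf hθ F ∈ cartanDeg J I G M (2 * q) := by
  suffices h : (polyDeg J G q).map (chernWeil J I b hf hθ).toLinearMap
      ≤ cartanDeg J I G M (2 * q) from h (Submodule.mem_map_of_mem hF)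
  clear hF F
  induction q with
  | zero =>
    rintro _ ⟨F, hF, rfl⟩
    rw [polyDeg, pow_zero] at hF
    obtain ⟨r, rfl⟩ := Submodule.mem_one.mp hF
    show chernWeil J I b hf hθ (algebraMap ℝ _ r) ∈ _
    rw [AlgHom.commutes, Algebra.algebraMap_eq_smul_one]
    refine Submodule.smul_mem _ _ (tmul_mem_cartanDeg J I (p := 0) (k := 0) rfl ?_
      (one_mem_formDeg I))
    rw [polyDeg, pow_zero]
    exact Submodule.one_le.mp le_rfl
  | succ q ih =>
    rw [polyDeg, pow_succ, Submodule.map_mul, mul_add, mul_one]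
    refine (mul_le_mul' ih ?_).trans (cartanDeg_mul_le J I _ _)
    rintro _ ⟨_, ⟨l, rfl⟩, rfl⟩
    show chernWeil J I b hf hθ _ ∈ _
    rw [chernWeil_ι]
    exact sum_mem fun a _ => Submodule.smul_mem _ _ (degCurvature_mem_cartanDeg J I b hf hθ a)

end Degree

/-! ### Mixed partial derivatives -/

section MixedPartials

variable {F E E' : Type*} [NormedAddCommGroup F] [NormedSpace ℝ F]
  [NormedAddCommGroup E] [NormedSpace ℝ E] [NormedAddCommGroup E'] [NormedSpace ℝ E']

/-- The mixed partial derivatives of a smooth map on `F × s` coincide. -/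
theorem exists_mixed_partial {Ψ : F × E → E'} {s : Set E} {a₀ : F} {y₀ : E}
    (hΨ : ContDiffWithinAt ℝ ∞ Ψ (univ ×ˢ s) (a₀, y₀)) (hs : UniqueDiffOn ℝ s) (hy : y₀ ∈ s)
    (hc : y₀ ∈ closure (interior s)) :
    ∃ B : F →L[ℝ] E →L[ℝ] E',
      HasFDerivAt (fun a => fderivWithin ℝ (fun y => Ψ (a, y)) s y₀) B a₀ ∧
      HasFDerivWithinAt (fun y => fderiv ℝ (fun a => Ψ (a, y)) a₀) B.flip s y₀ := by
  set S : Set (F × E) := univ ×ˢ s with hS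
  have hSu : UniqueDiffOn ℝ S := uniqueDiffOn_univ.prod hs
  have hp : (a₀, y₀) ∈ S := ⟨mem_univ _, hy⟩
  have hSc : (a₀, y₀) ∈ closure (interior S) := by
    rw [hS, interior_prod_eq, closure_prod_eq, interior_univ, closure_univ]
    exact ⟨mem_univ _, hc⟩
  have hG := ((hΨ.fderivWithin_right hSu (m := ∞) (by simp) hp).differentiableWithinAt
    (by simp)).hasFDerivWithinAt
  have hsym : IsSymmSndFDerivWithinAt ℝ Ψ S (a₀, y₀) :=
    (hΨ.of_le (m := 2) (by norm_cast)).isSymmSndFDerivWithinAt (by simp) hSu hSc hp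
  set D₂ := fderivWithin ℝ (fderivWithin ℝ Ψ S) S (a₀, y₀)
  have hdiff : ∀ᶠ p in 𝓝[S] (a₀, y₀), DifferentiableWithinAt ℝ Ψ S p := by
    have h1 := ((hΨ.of_le (m := 1) (by norm_cast)).eventually (by simp))
    rw [insert_eq_of_mem hp] at h1
    exact h1.mono fun p h => h.differentiableWithinAt (by simp)
  have hl : HasFDerivAt (fun a : F => (a, y₀)) (ContinuousLinearMap.inl ℝ F E) a₀ :=
    hasFDerivAt_prodMk_left a₀ y₀
  have hr : ∀ a : F, HasFDerivAt (fun y : E => (a, y)) (ContinuousLinearMap.inr ℝ F E) y₀ :=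
    fun a => hasFDerivAt_prodMk_right a y₀
  have hml : Tendsto (fun a : F => (a, y₀)) (𝓝 a₀) (𝓝[S] (a₀, y₀)) :=
    tendsto_nhdsWithin_iff.mpr ⟨hl.continuousAt, Eventually.of_forall fun a => ⟨mem_univ _, hy⟩⟩
  have hmr : Tendsto (fun y : E => (a₀, y)) (𝓝[s] y₀) (𝓝[S] (a₀, y₀)) :=
    tendsto_nhdsWithin_iff.mpr ⟨(hr a₀).continuousAt.mono_left nhdsWithin_le_nhds,
      eventually_mem_nhdsWithin.mono fun y h => ⟨mem_univ _, h⟩⟩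
  let cr : (F × E →L[ℝ] E') →L[ℝ] (E →L[ℝ] E') :=
    (ContinuousLinearMap.compL ℝ E (F × E) E').flip (ContinuousLinearMap.inr ℝ F E)
  let cl : (F × E →L[ℝ] E') →L[ℝ] (F →L[ℝ] E') :=
    (ContinuousLinearMap.compL ℝ F (F × E) E').flip (ContinuousLinearMap.inl ℝ F E)
  refine ⟨cr ∘L D₂ ∘L ContinuousLinearMap.inl ℝ F E, ?_, ?_⟩
  · have h1 : HasFDerivAt (fun a => fderivWithin ℝ Ψ S (a, y₀))
        (D₂ ∘L ContinuousLinearMap.inl ℝ F E) a₀ := by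
      rw [← hasFDerivWithinAt_univ] at hl ⊢
      exact hG.comp a₀ hl fun a _ => mk_mem_prod (mem_univ _) hy
    refine (cr.hasFDerivAt.comp a₀ h1).congr_of_eventuallyEq ?_
    filter_upwards [hml.eventually hdiff] with a ha
    exact (ha.hasFDerivWithinAt.comp y₀ (hr a).hasFDerivWithinAt
      (fun y hy => ⟨mem_univ _, hy⟩)).fderivWithin (hs y₀ hy)
  · have hB : (cr ∘L D₂ ∘L ContinuousLinearMap.inl ℝ F E).flip
        = cl ∘L D₂ ∘L ContinuousLinearMap.inr ℝ F E := by
      ext v ξ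
      exact hsym.eq _ _
    have key : ∀ y, DifferentiableWithinAt ℝ Ψ S (a₀, y) → y ∈ s →
        fderiv ℝ (fun a => Ψ (a, y)) a₀ = cl (fderivWithin ℝ Ψ S (a₀, y)) := by
      intro y hd hys
      have hl' : HasFDerivAt (fun a : F => (a, y)) (ContinuousLinearMap.inl ℝ F E) a₀ :=
        hasFDerivAt_prodMk_left a₀ y
      rw [← hasFDerivWithinAt_univ] at hl'
      have h2 := hd.hasFDerivWithinAt.comp a₀ hl' (fun a _ => mk_mem_prod (mem_univ _) hys)
      rw [hasFDerivWithinAt_univ] at h2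
      exact h2.fderiv
    rw [hB]
    have h1 : HasFDerivWithinAt (fun y => fderivWithin ℝ Ψ S (a₀, y))
        (D₂ ∘L ContinuousLinearMap.inr ℝ F E) s y₀ :=
      hG.comp y₀ (hr a₀).hasFDerivWithinAt fun y hy => ⟨mem_univ _, hy⟩
    refine (cl.hasFDerivAt.comp_hasFDerivWithinAt y₀ h1).congr_of_eventuallyEq ?_ ?_
    rotate_left
    · exact key y₀ (hΨ.differentiableWithinAt (by simp)) hy
    filter_upwards [hmr.eventually hdiff, eventually_mem_nhdsWithin] with y hd hys
    exact key y hd hys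

/-- Let `α` be a form of degree one whose pullbacks along the maps `Ψ(a, ·)` are the forms `ρ(a)`,
and let `Z = ∂Ψ / ∂a (ξ)`. Then `dα(Z, v) = ∂ρ / ∂a (ξ) (v) - d(α(Z)) (v)`. -/
theorem fderivWithin_oneForm_of_pullback {Ψ : F × E → E} {s : Set E} {a₀ : F} {y₀ : E}
    (hΨ : ContDiffWithinAt ℝ ∞ Ψ (univ ×ˢ s) (a₀, y₀)) (hs : UniqueDiffOn ℝ s) (hy : y₀ ∈ s)
    (hc : y₀ ∈ closure (interior s)) (hΨ₀ : ∀ᶠ y in 𝓝[s] y₀, Ψ (a₀, y) = y)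
    (hm : ∀ᶠ a in 𝓝 a₀, Ψ (a, y₀) ∈ s)
    {α : E → E →L[ℝ] ℝ} (hα : DifferentiableWithinAt ℝ α s y₀) (ξ : F) (v : E)
    {ρ : F → ℝ} {ρ' : F →L[ℝ] ℝ} (hρ : HasFDerivAt ρ ρ' a₀)
    (h1 : ∀ᶠ a in 𝓝 a₀, α (Ψ (a, y₀)) (fderivWithin ℝ (fun y => Ψ (a, y)) s y₀ v) = ρ a)
    {k : E → ℝ} {k' : E →L[ℝ] ℝ} (hk : HasFDerivWithinAt k k' s y₀)
    (h2 : ∀ᶠ y in 𝓝[s] y₀, α y (fderiv ℝ (fun a => Ψ (a, y)) a₀ ξ) = k y) :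
    fderivWithin ℝ α s y₀ (fderiv ℝ (fun a => Ψ (a, y₀)) a₀ ξ) v
      - fderivWithin ℝ α s y₀ v (fderiv ℝ (fun a => Ψ (a, y₀)) a₀ ξ) = ρ' ξ - k' v := by
  obtain ⟨B, hB1, hB2⟩ := exists_mixed_partial hΨ hs hy hc
  have e0 : Ψ (a₀, y₀) = y₀ := hΨ₀.self_of_nhdsWithin hy
  have hid : fderivWithin ℝ (fun y => Ψ (a₀, y)) s y₀ = ContinuousLinearMap.id ℝ E := by
    rw [EventuallyEq.fderivWithin_eq_of_mem hΨ₀ hy]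
    exact fderivWithin_id (hs y₀ hy)
  have hΨa : DifferentiableAt ℝ (fun a => Ψ (a, y₀)) a₀ := by
    rw [← differentiableWithinAt_univ]
    have hl : HasFDerivAt (fun a : F => (a, y₀)) (ContinuousLinearMap.inl ℝ F E) a₀ :=
      hasFDerivAt_prodMk_left a₀ y₀
    exact (hΨ.differentiableWithinAt (by simp)).comp a₀ hl.differentiableAt.differentiableWithinAt
      fun a _ => mk_mem_prod (mem_univ _) hy
  have hα' : HasFDerivAt (fun a => α (Ψ (a, y₀)))
      ((fderivWithin ℝ α s y₀) ∘L fderiv ℝ (fun a => Ψ (a, y₀)) a₀) a₀ := by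
    have h3 : HasFDerivWithinAt α (fderivWithin ℝ α s y₀) s (Ψ (a₀, y₀)) := by
      rw [e0]; exact hα.hasFDerivWithinAt
    exact h3.comp_hasFDerivAt a₀ hΨa.hasFDerivAt hm
  have h3 := (hα'.clm_apply (hB1.clm_apply (hasFDerivAt_const v a₀))).unique
    (hρ.congr_of_eventuallyEq h1)
  have h4 := (hs y₀ hy).eq (hα.hasFDerivWithinAt.clm_apply
    (hB2.clm_apply (hasFDerivWithinAt_const ξ y₀ s))) (hk.congr_of_eventuallyEq h2 (h2.self_of_nhdsWithin hy))
  have h5 := congrArg (fun T => T ξ) h3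
  have h6 := congrArg (fun T => T v) h4
  simp [e0, hid] at h5 h6
  rw [← h5, ← h6]
  ring

end MixedPartials

/-! ### Maps in charts -/

section Charts

variable {E : Type*} [NormedAddCommGroup E] [NormedSpace ℝ E]
  {H : Type*} [TopologicalSpace H] {I : ModelWithCorners ℝ E H}
  {M : Type*} [TopologicalSpace M] [ChartedSpace H M] [IsManifold I ∞ M]
  {E' : Type*} [NormedAddCommGroup E'] [NormedSpace ℝ E']
  {H' : Type*} [TopologicalSpace H'] {I' : ModelWithCorners ℝ E' H'}
  {M' : Type*} [TopologicalSpace M'] [ChartedSpace H' M'] [IsManifold I' ∞ M']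
  {EG : Type*} [NormedAddCommGroup EG] [NormedSpace ℝ EG]
  {HG : Type*} [TopologicalSpace HG] {J : ModelWithCorners ℝ EG HG}
  {G : Type*} [TopologicalSpace G] [ChartedSpace HG G] [IsManifold J ∞ G]

theorem contDiffWithinAt_chart {f : M → M'} (hf : ContMDiff I I' ∞ f) {c x : M} {c' : M'}
    (hx : x ∈ (extChartAt I c).source) (hx' : f x ∈ (extChartAt I' c').source) :
    ContDiffWithinAt ℝ ∞ (extChartAt I' c' ∘ f ∘ (extChartAt I c).symm) (range I)
      (extChartAt I c x) :=
  ((contMDiffAt_iff_of_mem_source (extChartAt_source I c ▸ hx)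
    (extChartAt_source I' c' ▸ hx')).mp (hf x)).2

/-- The differential of a map, in terms of its coordinate expression. -/
theorem mfderiv_mfderivWithin_extChartAt_symm {f : M → M'} (hf : ContMDiff I I' ∞ f) {c : M}
    {c' : M'} {y : E} (hy : y ∈ (extChartAt I c).target)
    (hy' : f ((extChartAt I c).symm y) ∈ (extChartAt I' c').source) (v : E) :
    (mfderiv I I' f ((extChartAt I c).symm y)
        (mfderivWithin 𝓘(ℝ, E) I (extChartAt I c).symm (range I) y v) : E')
      = mfderivWithin 𝓘(ℝ, E') I' (extChartAt I' c').symm (range I')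
          (extChartAt I' c' (f ((extChartAt I c).symm y)))
          (fderivWithin ℝ (extChartAt I' c' ∘ f ∘ (extChartAt I c).symm) (range I) y v) := by
  have hyr : y ∈ range I := extChartAt_target_subset_range c hy
  have hU : UniqueMDiffWithinAt 𝓘(ℝ, E) (range I) y :=
    (I.uniqueDiffOn y hyr).uniqueMDiffWithinAt
  set z := (extChartAt I c).symm y with hz
  have hs : MDifferentiableWithinAt 𝓘(ℝ, E) I (extChartAt I c).symm (range I) y :=
    mdifferentiableWithinAt_extChartAt_symm hy
  have hfz : MDifferentiableAt I I' f z := hf.mdifferentiableAt (by simp)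
  have hc1 : mfderivWithin 𝓘(ℝ, E) I' (f ∘ (extChartAt I c).symm) (range I) y
      = (mfderiv I I' f z).comp (mfderivWithin 𝓘(ℝ, E) I (extChartAt I c).symm (range I) y) :=
    mfderiv_comp_mfderivWithin y hfz hs hU
  have hcont : ContinuousWithinAt (f ∘ (extChartAt I c).symm) (range I) y :=
    ContinuousAt.comp_continuousWithinAt (g := f) (f := (extChartAt I c).symm) (s := range I)
      (x := y) hfz.continuousAt hs.continuousWithinAt
  have hev : ∀ᶠ y' in 𝓝[range I] y,
      f ((extChartAt I c).symm y') ∈ (extChartAt I' c').source :=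
    hcont ((isOpen_extChartAt_source c').mem_nhds hy')
  have heq : ((extChartAt I' c').symm ∘ (extChartAt I' c' ∘ f ∘ (extChartAt I c).symm))
      =ᶠ[𝓝[range I] y] (f ∘ (extChartAt I c).symm) := by
    filter_upwards [hev] with y' h
    exact (extChartAt I' c').left_inv h
  have ht : MDifferentiableWithinAt 𝓘(ℝ, E) 𝓘(ℝ, E')
      (extChartAt I' c' ∘ f ∘ (extChartAt I c).symm) (range I) y :=
    (mdifferentiableAt_extChartAt ((extChartAt_source I' c') ▸ hy')).comp_mdifferentiableWithinAt
      y (hfz.comp_mdifferentiableWithinAt y hs)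
  have hty : extChartAt I' c' (f z) ∈ (extChartAt I' c').target := (extChartAt I' c').map_source hy'
  have hc2 : mfderivWithin 𝓘(ℝ, E) I'
      ((extChartAt I' c').symm ∘ (extChartAt I' c' ∘ f ∘ (extChartAt I c).symm)) (range I) y
      = (mfderivWithin 𝓘(ℝ, E') I' (extChartAt I' c').symm (range I') (extChartAt I' c' (f z))).comp
        (mfderivWithin 𝓘(ℝ, E) 𝓘(ℝ, E') (extChartAt I' c' ∘ f ∘ (extChartAt I c).symm)
          (range I) y) :=
    mfderivWithin_comp y (mdifferentiableWithinAt_extChartAt_symm hty) ht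
      (fun _ _ => mem_range_self _) hU
  have hc3 := heq.mfderivWithin_eq_of_mem (I := 𝓘(ℝ, E)) (I' := I') hyr
  rw [← mfderivWithin_eq_fderivWithin]
  have e1 := congrArg (fun T : E →L[ℝ] E' => T v) hc1
  have e2 := congrArg (fun T : E →L[ℝ] E' => T v) hc2
  have e3 := congrArg (fun T : E →L[ℝ] E' => T v) hc3
  exact (e1.symm.trans e3.symm).trans e2

/-- Coordinate expressions of smooth maps on products are smooth. -/
theorem contDiffWithinAt_chart_prod [J.Boundaryless] {f : G × M → M'}
    (hf : ContMDiff (J.prod I) I' ∞ f)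
    {g : G} {x : M} {c' : M'} (hx' : f (g, x) ∈ (extChartAt I' c').source) :
    ContDiffWithinAt ℝ ∞ (fun p : EG × E =>
        extChartAt I' c' (f ((extChartAt J g).symm p.1, (extChartAt I x).symm p.2)))
      (univ ×ˢ range I) (extChartAt J g g, extChartAt I x x) := by
  have h := contDiffWithinAt_chart hf (mem_extChartAt_source (I := J.prod I) (g, x)) hx'
  have hr : range (J.prod I) = univ ×ˢ range I := by
    rw [modelWithCorners_prod_coe, range_prodMap, J.range_eq_univ]
  rw [hr] at h
  simp only [extChartAt_prod] at h
  exact h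

end Charts

/-! ### The adjoint representation -/

section Adjoint

variable {EG : Type*} [NormedAddCommGroup EG] [NormedSpace ℝ EG] [FiniteDimensional ℝ EG]
  {HG : Type*} [TopologicalSpace HG] (J : ModelWithCorners ℝ EG HG)
  {G : Type*} [TopologicalSpace G] [ChartedSpace HG G] [Group G] [LieGroup J ∞ G]

theorem contMDiff_conj (g : G) : ContMDiff J J ∞ (fun h : G => g * h * g⁻¹) :=
  (contMDiff_mul_right (I := J) (n := ∞) (a := g⁻¹)).comp contMDiff_mul_left

variable [J.Boundaryless]

theorem mfderivWithin_symm_one (v : EG) :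
    (mfderivWithin 𝓘(ℝ, EG) J (extChartAt J (1 : G)).symm (range J)
      (extChartAt J (1 : G) 1) v : EG) = v :=
  congrArg (fun T : EG →L[ℝ] EG => T v)
    (mfderivWithin_range_extChartAt_symm (I := J) (x := (1 : G)))

/-- `Ad g`, as a continuous linear map on the model space. -/
def AdL (g : G) : EG →L[ℝ] EG := mfderiv J J (fun h : G => g * h * g⁻¹) 1

theorem Ad_eq_fderivWithin (g : G) (η : GroupLieAlgebra J G) :
    (Ad J g η : EG) = fderivWithin ℝ (fun b => extChartAt J (1 : G)
      (g * (extChartAt J (1 : G)).symm b * g⁻¹)) univ (extChartAt J (1 : G) 1) η := by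
  have h1 : (Ad J g η : EG)
      = fderivWithin ℝ (writtenInExtChartAt J J (1 : G) (fun h : G => g * h * g⁻¹)) (range J)
          (extChartAt J (1 : G) 1) η :=
    congrArg (fun T : EG →L[ℝ] EG => T η)
      (((contMDiff_conj J g).mdifferentiableAt (by simp)).mfderiv (x := (1 : G)))
  have h2 : g * 1 * g⁻¹ = 1 := by group
  rw [h1, J.range_eq_univ, writtenInExtChartAt, h2]
  rfl

theorem Ad_one (η : GroupLieAlgebra J G) : Ad J (1 : G) η = η := by
  have h1 : (fun h : G => 1 * h * 1⁻¹) = id := by ext; simp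
  have h2 : Ad J (1 : G) = (mfderiv J J (fun h : G => 1 * h * 1⁻¹) 1 : EG →L[ℝ] EG).toLinearMap :=
    rfl
  have h3 : (mfderiv J J (fun h : G => 1 * h * 1⁻¹) 1 : EG →L[ℝ] EG)
      = ContinuousLinearMap.id ℝ EG := by
    rw [h1]; exact mfderiv_id
  have := congrArg (fun T : EG →L[ℝ] EG => T η) h3
  exact this

/-- Left-invariant vector fields in the chart at `1`. -/
theorem mpullbackWithin_mulInvariantVectorField (η : GroupLieAlgebra J G) :
    ∀ᶠ a in 𝓝 (extChartAt J (1 : G) 1),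
      (VectorField.mpullbackWithin 𝓘(ℝ, EG) J (extChartAt J (1 : G)).symm
        (mulInvariantVectorField η) (range J) a : EG)
      = fderivWithin ℝ (fun b => extChartAt J (1 : G)
          ((extChartAt J (1 : G)).symm a * (extChartAt J (1 : G)).symm b)) univ
          (extChartAt J (1 : G) 1) η := by
  filter_upwards [extChartAt_target_mem_nhds (I := J) (1 : G)] with a ha
  set φ := extChartAt J (1 : G)
  set g := φ.symm a with hg
  have hga : φ g = a := φ.right_inv ha
  have hgs : g ∈ φ.source := φ.map_target ha
  have h1 := mfderiv_mfderivWithin_extChartAt_symm (I := J) (I' := J)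
    (contMDiff_mul_left (I := J) (n := ∞) (a := g)) (c := (1 : G)) (c' := (1 : G))
    (y := φ 1) (mem_extChartAt_target _) (by
      rw [extChartAt_to_inv, mul_one]; exact hgs) η
  have h2 : (mulInvariantVectorField η g : EG)
      = mfderiv J J (fun h : G => g * h) (φ.symm (φ 1))
        (mfderivWithin 𝓘(ℝ, EG) J φ.symm (range J) (φ 1) η) := by
    have e1 : (mfderivWithin 𝓘(ℝ, EG) J φ.symm (range J) (φ 1) η : EG) = η :=
      mfderivWithin_symm_one J η
    have e2 : (mfderiv J J (fun h : G => g * h) (φ.symm (φ 1)) : EG →L[ℝ] EG)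
        = (mfderiv J J (fun h : G => g * h) 1 : EG →L[ℝ] EG) :=
      congrArg (fun p : G => (show EG →L[ℝ] EG from mfderiv J J (fun h : G => g * h) p))
        (extChartAt_to_inv (I := J) (1 : G))
    exact (congrArg₂ (fun (T : EG →L[ℝ] EG) (w : EG) => T w) e2 e1).symm
  have h3 : φ (g * φ.symm (φ 1)) = a := by
    rw [extChartAt_to_inv, mul_one, hga]
  have h4 := h2.trans (h1.trans (congrArg (fun z => (mfderivWithin 𝓘(ℝ, EG) J φ.symm (range J) z :
    EG →L[ℝ] EG) (fderivWithin ℝ (φ ∘ (fun h : G => g * h) ∘ φ.symm) (range J) (φ 1) η)) h3))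
  have hinv := isInvertible_mfderivWithin_extChartAt_symm (I := J) ha
  rw [J.range_eq_univ] at h4 hinv ⊢
  exact (congrArg (mfderivWithin 𝓘(ℝ, EG) J φ.symm univ a).inverse h4).trans
    (hinv.inverse_apply_eq.mpr rfl)

theorem hasFDerivAt_apply_const {F E E' : Type*} [NormedAddCommGroup F] [NormedSpace ℝ F]
    [NormedAddCommGroup E] [NormedSpace ℝ E] [NormedAddCommGroup E'] [NormedSpace ℝ E']
    {c : F → E →L[ℝ] E'} {B : F →L[ℝ] E →L[ℝ] E'} {x : F} (h : HasFDerivAt c B x) (v : E) :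
    HasFDerivAt (fun a => c a v) (B.flip v) x := by
  simpa using h.clm_apply (hasFDerivAt_const v x)

/-- The differential of the adjoint representation, in the chart at `1`. -/
theorem exists_hasFDerivAt_conj (η : EG) :
    ∃ L : EG →L[ℝ] EG,
      HasFDerivAt (fun a => fderivWithin ℝ (fun b => extChartAt J (1 : G)
        ((extChartAt J (1 : G)).symm a * (extChartAt J (1 : G)).symm b
          * ((extChartAt J (1 : G)).symm a)⁻¹)) univ (extChartAt J (1 : G) 1) η) L
        (extChartAt J (1 : G) 1) ∧
      ∀ ξ : EG, L ξ = VectorField.lieBracket ℝ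
        (fun a => fderivWithin ℝ (fun b => extChartAt J (1 : G)
          ((extChartAt J (1 : G)).symm a * (extChartAt J (1 : G)).symm b)) univ
          (extChartAt J (1 : G) 1) ξ)
        (fun a => fderivWithin ℝ (fun b => extChartAt J (1 : G)
          ((extChartAt J (1 : G)).symm a * (extChartAt J (1 : G)).symm b)) univ
          (extChartAt J (1 : G) 1) η) (extChartAt J (1 : G) 1) := by
  set φ := extChartAt J (1 : G) with hφ
  have hms : (1 : G) ∈ φ.source := mem_extChartAt_source _
  have hm : ContDiffWithinAt ℝ ∞ (fun p : EG × EG => φ (φ.symm p.1 * φ.symm p.2))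
      (univ ×ˢ univ) (φ 1, φ 1) := by
    have := contDiffWithinAt_chart_prod (J := J) (I := J) (I' := J)
      (contMDiff_mul J ∞ (G := G)) (g := 1) (x := 1) (c' := 1) (by simp)
    rwa [J.range_eq_univ] at this
  have hC : ContDiffWithinAt ℝ ∞ (fun p : EG × EG => φ (φ.symm p.1 * φ.symm p.2 * (φ.symm p.1)⁻¹))
      (univ ×ˢ univ) (φ 1, φ 1) := by
    have hc : ContMDiff (J.prod J) J ∞ (fun p : G × G => p.1 * p.2 * p.1⁻¹) :=
      (contMDiff_fst.mul contMDiff_snd).mul contMDiff_fst.inv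
    have := contDiffWithinAt_chart_prod (J := J) (I := J) (I' := J)
      hc (g := 1) (x := 1) (c' := 1) (by simp)
    rwa [J.range_eq_univ] at this
  have hcl : φ 1 ∈ closure (interior (univ : Set EG)) := by simp
  obtain ⟨B, hB1, hB2⟩ := exists_mixed_partial hm uniqueDiffOn_univ (mem_univ _) hcl
  obtain ⟨K, hK, -⟩ := exists_mixed_partial hC uniqueDiffOn_univ (mem_univ _) hcl
  rw [hasFDerivWithinAt_univ] at hB2
  refine ⟨K.flip η, hasFDerivAt_apply_const hK η, fun ξ => ?_⟩
  have key : ∀ᶠ a in 𝓝 (φ 1), fderivWithin ℝ (fun b => φ (φ.symm a * φ.symm b)) univ (φ 1) η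
      = fderiv ℝ (fun c => φ (φ.symm c * φ.symm a)) (φ 1)
        (fderivWithin ℝ (fun b => φ (φ.symm a * φ.symm b * (φ.symm a)⁻¹)) univ (φ 1) η) := by
    filter_upwards [extChartAt_target_mem_nhds (I := J) (1 : G)] with a ha
    set g := φ.symm a with hg
    have hga : φ g = a := φ.right_inv ha
    have hgs : g ∈ φ.source := φ.map_target ha
    have hr1 : φ.symm (φ 1) = 1 := extChartAt_to_inv 1
    have d1 : DifferentiableAt ℝ (fun c => φ (φ.symm c * g)) (φ 1) := by
      have := (contDiffWithinAt_chart (I := J) (I' := J) (contMDiff_mul_right (I := J) (n := ∞)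
        (a := g)) hms (c' := 1) (by rwa [one_mul])).differentiableWithinAt (by simp)
      rw [J.range_eq_univ, differentiableWithinAt_univ] at this
      exact this
    have d2 : DifferentiableAt ℝ (fun b => φ (g * φ.symm b * g⁻¹)) (φ 1) := by
      have := (contDiffWithinAt_chart (I := J) (I' := J) (contMDiff_conj J g) hms (c' := 1)
        (by simp)).differentiableWithinAt (by simp)
      rw [J.range_eq_univ, differentiableWithinAt_univ] at this
      exact this
    have hv : φ (g * φ.symm (φ 1) * g⁻¹) = φ 1 := by rw [hr1]; group
    have d1' : DifferentiableAt ℝ (fun c => φ (φ.symm c * g)) (φ (g * φ.symm (φ 1) * g⁻¹)) := by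
      rw [hv]; exact d1
    have hev : ∀ᶠ b in 𝓝 (φ 1), φ (g * φ.symm b)
        = φ (φ.symm (φ (g * φ.symm b * g⁻¹)) * g) := by
      have hcont : ContinuousAt (fun b => g * φ.symm b * g⁻¹) (φ 1) :=
        (contMDiff_conj J g).continuous.continuousAt.comp (continuousAt_extChartAt_symm (1 : G))
      have hmem : φ.source ∈ 𝓝 (g * φ.symm (φ 1) * g⁻¹) := by
        refine (isOpen_extChartAt_source (I := J) (1 : G)).mem_nhds ?_
        rw [hr1]; simp
      filter_upwards [hcont hmem] with b hb
      rw [φ.left_inv hb, inv_mul_cancel_right]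
    have h1 := d1'.hasFDerivAt.comp (φ 1) d2.hasFDerivAt
    rw [fderivWithin_univ, (h1.congr_of_eventuallyEq hev).fderiv, fderivWithin_univ, hv]
    rfl
  have hr1 : φ.symm (φ 1) = 1 := extChartAt_to_inv 1
  have hid : fderiv ℝ (fun b => φ (φ.symm b)) (φ 1) = ContinuousLinearMap.id ℝ EG := by
    have : (fun b => φ (φ.symm b)) =ᶠ[𝓝 (φ 1)] id := by
      filter_upwards [extChartAt_target_mem_nhds (I := J) (1 : G)] with a ha
      exact φ.right_inv ha
    rw [this.fderiv_eq, fderiv_id]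
  have hone : ∀ v : EG, fderivWithin ℝ (fun b => φ (φ.symm (φ 1) * φ.symm b)) univ (φ 1) v = v := by
    intro v
    rw [hr1, fderivWithin_univ]
    simp only [one_mul, hid, ContinuousLinearMap.id_apply]
  have hone' : ∀ v : EG, fderiv ℝ (fun c => φ (φ.symm c * φ.symm (φ 1))) (φ 1) v = v := by
    intro v
    rw [hr1]
    simp only [mul_one, hid, ContinuousLinearMap.id_apply]
  have hA1 : fderivWithin ℝ (fun b => φ (φ.symm (φ 1) * φ.symm b * (φ.symm (φ 1))⁻¹)) univ (φ 1) η
      = η := by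
    rw [hr1, fderivWithin_univ]
    simp only [inv_one, mul_one, one_mul, hid, ContinuousLinearMap.id_apply]
  have hkey : K ξ η + B η ξ = B ξ η := by
    have h1 := ((hB2.clm_apply (hasFDerivAt_apply_const hK η)).congr_of_eventuallyEq key).unique
      (hasFDerivAt_apply_const hB1 η)
    have h2 := congrArg (fun T : EG →L[ℝ] EG => T ξ) h1
    simp only [add_apply, ContinuousLinearMap.comp_apply, ContinuousLinearMap.flip_apply] at h2
    rw [hA1, hone'] at h2
    exact h2
  rw [VectorField.lieBracket, (hasFDerivAt_apply_const hB1 _).fderiv,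
    (hasFDerivAt_apply_const hB1 _).fderiv, hone, hone]
  exact eq_sub_of_add_eq hkey

/-- The differential of the adjoint representation is the Lie bracket. -/
theorem exists_hasFDerivAt_Ad (η : GroupLieAlgebra J G) :
    ∃ L : EG →L[ℝ] EG,
      HasFDerivAt (fun a => AdL J ((extChartAt J (1 : G)).symm a) η) L
        (extChartAt J (1 : G) 1) ∧
      ∀ ξ : GroupLieAlgebra J G, L ξ = ⁅ξ, η⁆ := by
  obtain ⟨L, h1, h2⟩ := exists_hasFDerivAt_conj J (G := G) η
  refine ⟨L, ?_, fun ξ => ?_⟩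
  · have h3 : (fun a => AdL J ((extChartAt J (1 : G)).symm a) η) = fun a => fderivWithin ℝ
        (fun b => extChartAt J (1 : G) ((extChartAt J (1 : G)).symm a *
          (extChartAt J (1 : G)).symm b * ((extChartAt J (1 : G)).symm a)⁻¹)) univ
          (extChartAt J (1 : G) 1) η :=
      funext fun a => Ad_eq_fderivWithin J _ η
    rw [h3]
    exact h1
  · refine (h2 ξ).trans ?_
    have h3 := Filter.EventuallyEq.lieBracket_vectorField_eq (𝕜 := ℝ)
      (mpullbackWithin_mulInvariantVectorField J ξ) (mpullbackWithin_mulInvariantVectorField J η)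
    refine h3.symm.trans ?_
    have h4 : (mfderiv J 𝓘(ℝ, EG) (extChartAt J (1 : G)) 1 : EG →L[ℝ] EG).inverse
        = ContinuousLinearMap.id ℝ EG := by
      have h5 : (mfderiv J 𝓘(ℝ, EG) (extChartAt J (1 : G)) 1 : EG →L[ℝ] EG)
          = ContinuousLinearMap.id ℝ EG := mfderiv_extChartAt_self
      exact (congrArg ContinuousLinearMap.inverse h5).trans ContinuousLinearMap.inverse_id
    rw [GroupLieAlgebra.bracket_def, VectorField.mlieBracket, VectorField.mlieBracketWithin,
      preimage_univ, univ_inter, J.range_eq_univ]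
    refine ((congrArg (fun T : EG →L[ℝ] EG => T _) h4).trans ?_).symm
    exact congrFun (VectorField.lieBracketWithin_univ (𝕜 := ℝ) (E := EG)) _

end Adjoint

/-! ### Automorphism properties of the adjoint representation -/

section AdjointHom

variable {EG : Type*} [NormedAddCommGroup EG] [NormedSpace ℝ EG] [FiniteDimensional ℝ EG]
  {HG : Type*} [TopologicalSpace HG] (J : ModelWithCorners ℝ EG HG) [J.Boundaryless]
  {G : Type*} [TopologicalSpace G] [ChartedSpace HG G] [Group G] [LieGroup J ∞ G]

theorem hasFDerivAt_conj_chart (g : G) :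
    HasFDerivAt (fun b => extChartAt J (1 : G) (g * (extChartAt J (1 : G)).symm b * g⁻¹)) (AdL J g)
      (extChartAt J (1 : G) 1) := by
  have d : DifferentiableAt ℝ
      (fun b => extChartAt J (1 : G) (g * (extChartAt J (1 : G)).symm b * g⁻¹))
      (extChartAt J (1 : G) 1) := by
    have := (contDiffWithinAt_chart (I := J) (I' := J) (contMDiff_conj J g)
      (mem_extChartAt_source (1 : G)) (c' := 1) (by simp)).differentiableWithinAt (by simp)
    rw [J.range_eq_univ, differentiableWithinAt_univ] at this
    exact this
  convert! d.hasFDerivAt using 1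
  ext v
  rw [← fderivWithin_univ]
  exact Ad_eq_fderivWithin J g v

theorem conj_chart_one (g : G) : extChartAt J (1 : G)
    (g * (extChartAt J (1 : G)).symm (extChartAt J (1 : G) 1) * g⁻¹) = extChartAt J (1 : G) 1 := by
  rw [extChartAt_to_inv]
  group

theorem eventually_conj_chart (g : G) : ∀ᶠ b in 𝓝 (extChartAt J (1 : G) 1),
    (extChartAt J (1 : G)).symm (extChartAt J (1 : G) (g * (extChartAt J (1 : G)).symm b * g⁻¹))
      = g * (extChartAt J (1 : G)).symm b * g⁻¹ := by
  have hcont : ContinuousAt (fun b => g * (extChartAt J (1 : G)).symm b * g⁻¹)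
      (extChartAt J (1 : G) 1) :=
    (contMDiff_conj J g).continuous.continuousAt.comp (continuousAt_extChartAt_symm (1 : G))
  have hmem : (extChartAt J (1 : G)).source
      ∈ 𝓝 (g * (extChartAt J (1 : G)).symm (extChartAt J (1 : G) 1) * g⁻¹) := by
    refine (isOpen_extChartAt_source (I := J) (1 : G)).mem_nhds ?_
    rw [extChartAt_to_inv]
    simp
  filter_upwards [hcont hmem] with b hb
  exact (extChartAt J (1 : G)).left_inv hb

theorem AdL_mul (g h : G) : AdL J (g * h) = AdL J g ∘L AdL J h := by
  have hA := hasFDerivAt_conj_chart J g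
  rw [← conj_chart_one J h] at hA
  have h1 := hA.comp (extChartAt J (1 : G) 1) (hasFDerivAt_conj_chart J h)
  refine ((h1.unique ((hasFDerivAt_conj_chart J (g * h)).congr_of_eventuallyEq ?_))).symm
  filter_upwards [eventually_conj_chart J h] with b hb
  simp only [Function.comp_apply]
  rw [hb]
  group

/-- The adjoint representation acts by automorphisms of the Lie algebra. -/
theorem Ad_lie (g : G) (ξ η : GroupLieAlgebra J G) :
    Ad J g ⁅ξ, η⁆ = ⁅Ad J g ξ, Ad J g η⁆ := by
  have hA := hasFDerivAt_conj_chart J g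
  obtain ⟨L, hL, hL'⟩ := exists_hasFDerivAt_Ad J (G := G) η
  obtain ⟨L', hL₁, hL₁'⟩ := exists_hasFDerivAt_Ad J (Ad J g η)
  rw [← conj_chart_one J g] at hL₁
  have h3 : L' ∘L AdL J g = AdL J g ∘L L := by
    refine (hL₁.comp (extChartAt J (1 : G) 1) hA).unique
      (((AdL J g).hasFDerivAt.comp (extChartAt J (1 : G) 1) hL).congr_of_eventuallyEq ?_)
    filter_upwards [eventually_conj_chart J g] with b hb
    show AdL J ((extChartAt J (1 : G)).symm (extChartAt J (1 : G) _)) (AdL J g η)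
      = AdL J g (AdL J _ η)
    have h4 : AdL J (g * (extChartAt J (1 : G)).symm b * g⁻¹) ∘L AdL J g
        = AdL J g ∘L AdL J ((extChartAt J (1 : G)).symm b) := by
      rw [← AdL_mul, ← AdL_mul, inv_mul_cancel_right]
    rw [hb]
    exact DFunLike.congr_fun h4 (η : EG)
  have h5 : L' (AdL J g ξ) = AdL J g (L ξ) := DFunLike.congr_fun h3 (ξ : EG)
  exact ((congrArg (AdL J g) (hL' ξ)).symm.trans h5.symm).trans (hL₁' _)

variable {κ : Type*} [Fintype κ] (b : Basis κ ℝ (GroupLieAlgebra J G))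

/-- Structure constants of the Lie algebra. -/
def structureConst (a c e : κ) : ℝ := b.coord a ⁅b c, b e⁆

theorem structureConst_swap (a c e : κ) :
    structureConst J b a c e = - structureConst J b a e c := by
  have : LieGroup J (minSmoothness ℝ 3) G := LieGroup.of_le (n := ∞) (by simp; norm_cast)
  rw [structureConst, structureConst, ← map_neg, lie_skew]

theorem sum_structureConst_mul (a c r q : κ) :
    ∑ e, structureConst J b a c e * structureConst J b e r q = b.coord a ⁅b c, ⁅b r, b q⁆⁆ := by
  have : LieGroup J (minSmoothness ℝ 3) G := LieGroup.of_le (n := ∞) (by simp; norm_cast)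
  conv_rhs => rw [← b.sum_repr ⁅b r, b q⁆]
  simp only [lie_sum, lie_smul, map_sum, map_smul, smul_eq_mul]
  exact Finset.sum_congr rfl fun e _ => mul_comm _ _

theorem structureConst_jacobi (a c r q : κ) :
    ∑ e, (structureConst J b a c e * structureConst J b e r q
      + structureConst J b a r e * structureConst J b e q c
      + structureConst J b a q e * structureConst J b e c r) = 0 := by
  have : LieGroup J (minSmoothness ℝ 3) G := LieGroup.of_le (n := ∞) (by simp; norm_cast)
  rw [Finset.sum_add_distrib, Finset.sum_add_distrib, sum_structureConst_mul,
    sum_structureConst_mul, sum_structureConst_mul, ← map_add, ← map_add, lie_jacobi, map_zero]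

/-- The coadjoint action of the Lie algebra, `l ↦ l ∘ ad ξ`. -/
def coad (ξ : GroupLieAlgebra J G) :
    Dual ℝ (GroupLieAlgebra J G) →ₗ[ℝ] Dual ℝ (GroupLieAlgebra J G) :=
  have : LieGroup J (minSmoothness ℝ 3) G := LieGroup.of_le (n := ∞) (by simp; norm_cast)
  (LieAlgebra.ad ℝ (GroupLieAlgebra J G) ξ).dualMap

@[simp] theorem coad_apply (ξ : GroupLieAlgebra J G) (l : Dual ℝ (GroupLieAlgebra J G))
    (η : GroupLieAlgebra J G) : coad J ξ l η = l ⁅ξ, η⁆ := rfl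

theorem exists_curve_Ad (ξ η : GroupLieAlgebra J G) :
    ∃ γ : ℝ → G, γ 0 = 1 ∧ ∀ l : Dual ℝ (GroupLieAlgebra J G),
      HasDerivAt (fun t => l (Ad J (γ t) η)) (l ⁅ξ, η⁆) 0 := by
  obtain ⟨L, hL, hL'⟩ := exists_hasFDerivAt_Ad J η
  let w : EG := ξ
  let e : EG := extChartAt J (1 : G) 1
  have hline : HasDerivAt (fun t : ℝ => e + t • w) w 0 := by
    have h1 := ((hasDerivAt_id (0 : ℝ)).smul_const w).const_add e
    rwa [one_smul] at h1
  refine ⟨fun t => (extChartAt J (1 : G)).symm (e + t • w), ?_, fun l => ?_⟩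
  · show (extChartAt J (1 : G)).symm (e + (0 : ℝ) • w) = 1
    rw [zero_smul, add_zero, extChartAt_to_inv]
  · have h1 : HasFDerivAt (fun a => AdL J ((extChartAt J (1 : G)).symm a) η) L
        (e + (0 : ℝ) • w) := by
      rw [zero_smul, add_zero]; exact hL
    let l' : EG →ₗ[ℝ] ℝ := l
    have h2 := (LinearMap.toContinuousLinearMap l').hasFDerivAt.comp_hasDerivAt
      (0 : ℝ) (h1.comp_hasDerivAt (0 : ℝ) hline)
    have h3 : l (L w) = l ⁅ξ, η⁆ := congrArg l (hL' ξ)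
    rw [← h3]
    exact h2

/-- Invariant polynomials are annihilated by the derivations which extend the coadjoint action of
the Lie algebra. -/
theorem derivation_eq_zero_of_mem_invPoly {κ : Type*} [Fintype κ]
    (b : Basis κ ℝ (GroupLieAlgebra J G)) {F : Poly J G} (hF : F ∈ invPoly J G)
    (ξ : GroupLieAlgebra J G) {δ : Poly J G →ₗ[ℝ] Poly J G}
    (hδ : ∀ F K, δ (F * K) = δ F * K + F * δ K)
    (hδι : ∀ l, δ (SymmetricAlgebra.ι ℝ _ l) = SymmetricAlgebra.ι ℝ _ (coad J ξ l)) :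
    δ F = 0 := by
  refine eq_zero_of_evalSym b fun η => ?_
  have hev : ∀ (g : G) (K : Poly J G) (η : GroupLieAlgebra J G),
      evalSym η (actPoly J g K) = evalSym (Ad J g⁻¹ η) K := by
    intro g K η
    have h : (evalSym η).comp (actPoly J g) = evalSym (Ad J g⁻¹ η) := by
      refine SymmetricAlgebra.algHom_ext (LinearMap.ext fun l => ?_)
      show evalSym η (actPoly J g (SymmetricAlgebra.ι ℝ _ l))
        = evalSym (Ad J g⁻¹ η) (SymmetricAlgebra.ι ℝ _ l)
      rw [actPoly, SymmetricAlgebra.lift_ι_apply, evalSym_ι]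
      exact evalSym_ι _ _
    exact DFunLike.congr_fun h K
  have hinv : ∀ g : G, evalSym (Ad J g η) F = evalSym η F := by
    intro g
    have := hev g⁻¹ F η
    rw [hF, inv_inv] at this
    exact this.symm
  obtain ⟨γ, hγ0, hc⟩ := exists_curve_Ad J ξ η
  have h0 : Ad J (γ 0) η = η := by rw [hγ0, Ad_one]
  have h1 := hasDerivAt_evalSym (W := GroupLieAlgebra J G) hc (N := coad J ξ)
    (fun l => by rw [h0]; rfl) hδ hδι F
  rw [h0] at h1
  have h2 : (fun t => evalSym (Ad J (γ t) η) F) = fun _ => evalSym η F := funext fun t => hinv _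
  rw [h2] at h1
  exact h1.unique (hasDerivAt_const _ _)

end AdjointHom

/-! ### Contractions of the exterior derivative of the degenerate connection -/

section CoordinateForms

variable {E : Type*} [NormedAddCommGroup E] [NormedSpace ℝ E] [FiniteDimensional ℝ E]

/-- The component of degree one of a form, as a continuous linear form. -/
def degreeOne : Form E →ₗ[ℝ] (E →L[ℝ] ℝ) :=
  (LinearMap.toContinuousLinearMap (𝕜 := ℝ) (E := E) (F' := ℝ)).toLinearMap ∘ₗ
    ExteriorAlgebra.ιInv

@[simp] theorem degreeOne_oneForm (l : Dual ℝ E) (v : E) : degreeOne (oneForm l) v = l v :=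
  congrArg (fun m : Dual ℝ E => m v) (ExteriorAlgebra.ι_leftInverse l)

/-- A continuous linear form, as a form of degree one. -/
def oneFormL : (E →L[ℝ] ℝ) →ₗ[ℝ] Form E :=
  oneForm ∘ₗ (LinearMap.toContinuousLinearMap (𝕜 := ℝ) (E := E) (F' := ℝ)).symm.toLinearMap

theorem oneFormL_apply (α : E →L[ℝ] ℝ) : oneFormL α = oneForm α.toLinearMap := rfl

theorem oneFormL_degreeOne (l : Dual ℝ E) : oneFormL (degreeOne (oneForm l)) = oneForm l := by
  rw [oneFormL_apply]
  congr 1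
  ext v
  exact degreeOne_oneForm l v

theorem contr_extd_oneForm {s : Set E} {w : E → Form E} {y : E}
    (hw : DifferentiableWithinAt ℝ w s y) (hs : UniqueDiffWithinAt ℝ s y)
    (hone : ∀ z, ∃ l, w z = oneForm l) (X : E) :
    contr X (extd s w y) = oneFormL (fderivWithin ℝ (fun z => degreeOne (w z)) s y X
      - (fderivWithin ℝ (fun z => degreeOne (w z)) s y).flip X) := by
  set A := fderivWithin ℝ (fun z => degreeOne (w z)) s y with hA
  have hA' : A.toLinearMap = degreeOne ∘ₗ (fderivWithin ℝ w s y).toLinearMap :=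
    fderivWithin_linear degreeOne hw hs
  have hd : DifferentiableWithinAt ℝ (fun z => degreeOne (w z)) s y :=
    (LinearMap.toContinuousLinearMap degreeOne).differentiableAt.comp_differentiableWithinAt y hw
  have hw' : (fun z => oneFormL (degreeOne (w z))) = w := by
    funext z
    obtain ⟨l, hl⟩ := hone z
    rw [hl, oneFormL_degreeOne]
  have hfw : (fderivWithin ℝ w s y).toLinearMap = oneFormL ∘ₗ A.toLinearMap := by
    rw [← fderivWithin_linear oneFormL hd hs, hw']
  set b := finBasis ℝ E
  have h1 : A X = ∑ i, b.coord i X • A (b i) := by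
    conv_lhs => rw [← b.sum_repr X, map_sum]
    simp
  have h2 : oneFormL (A.flip X) = ∑ i, A (b i) X • oneForm (b.coord i) := by
    simp only [oneFormL_apply, ← map_smul, ← map_sum]
    congr 1
    refine b.ext fun k => ?_
    simp [Finsupp.single_apply]
  rw [extd, hfw, alternate, map_sum, map_sub, h2, h1, map_sum, ← Finset.sum_sub_distrib]
  refine Finset.sum_congr rfl fun i _ => ?_
  rw [contr_oneForm_mul, LinearMap.comp_apply, oneFormL_apply, contr_oneForm, map_smul,
    ← Algebra.commutes, ← Algebra.smul_def]
  rfl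

theorem extd_algebraMap {s : Set E} {h : E → ℝ} {y : E} (hh : DifferentiableWithinAt ℝ h s y)
    (hs : UniqueDiffWithinAt ℝ s y) :
    extd s (fun z => algebraMap ℝ (Form E) (h z)) y = oneFormL (fderivWithin ℝ h s y) := by
  have h1 := fderivWithin_linear (Algebra.linearMap ℝ (Form E)) hh hs
  have h2 : extd s (fun z => algebraMap ℝ (Form E) (h z)) y
      = alternate (Algebra.linearMap ℝ (Form E) ∘ₗ (fderivWithin ℝ h s y).toLinearMap) := by
    rw [← h1]; rfl
  rw [h2, alternate]
  set b := finBasis ℝ E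
  have h3 : ∀ i, oneForm (b.coord i) * (Algebra.linearMap ℝ (Form E) ∘ₗ
      (fderivWithin ℝ h s y).toLinearMap) (b i)
      = fderivWithin ℝ h s y (b i) • oneForm (b.coord i) := fun i => by
    rw [LinearMap.comp_apply, Algebra.linearMap_apply, ← Algebra.commutes, ← Algebra.smul_def]
    rfl
  rw [Finset.sum_congr rfl fun i _ => h3 i, oneFormL_apply]
  simp only [← map_smul, ← map_sum]
  congr 1
  refine b.ext fun k => ?_
  simp [Finsupp.single_apply]

end CoordinateForms

section DegenerateConnection

variable {E : Type*} [NormedAddCommGroup E] [NormedSpace ℝ E] [FiniteDimensional ℝ E]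
  {H : Type*} [TopologicalSpace H]
  {EG : Type*} [NormedAddCommGroup EG] [NormedSpace ℝ EG] [FiniteDimensional ℝ EG]
  {HG : Type*} [TopologicalSpace HG]
  (J : ModelWithCorners ℝ EG HG) (I : ModelWithCorners ℝ E H)
  {G : Type*} [TopologicalSpace G] [ChartedSpace HG G] [Group G]
  {M : Type*} [TopologicalSpace M] [ChartedSpace H M] [MulAction G M]
  [IsManifold I ∞ M] {f : M → ℝ}
  {θ : (x : M) → TangentSpace I x →ₗ[ℝ] GroupLieAlgebra J G}

theorem eq_zero_of_mem_singularSet (hf : IsCutoff I G f) {x : M} (hx : x ∈ singularSet G M) :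
    f x = 0 := by
  obtain ⟨U, V, -, -, hsU, -, h0, -⟩ := hf.nhds
  exact h0 x (hsU hx)

theorem smul_reproduces (hf : IsCutoff I G f) (hθ : IsConnection J I θ) (ξ : GroupLieAlgebra J G)
    (l : Dual ℝ (GroupLieAlgebra J G)) (x : M) :
    f x * l (θ x (fundVF J I ξ x)) = f x * l ξ := by
  by_cases hx : x ∈ singularSet G M
  · rw [eq_zero_of_mem_singularSet I hf hx, zero_mul, zero_mul]
  · rw [hθ.reproduces ξ x hx]

variable [LieGroup J ∞ G] [ContMDiffSMul J I ∞ G M]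

theorem smul_contMDiff_left (x : M) : ContMDiff J I ∞ (fun g : G => g • x) :=
  (ContMDiffSMul.contMDiff_smul (I := J) (I' := I) (n := ∞) (G := G) (M := M)).comp
    (contMDiff_id.prodMk contMDiff_const)

theorem roughPullback_degConn (hf : IsCutoff I G f) (hθ : IsConnection J I θ) (g : G)
    (l : Dual ℝ (GroupLieAlgebra J G)) :
    roughPullback I (fun x : M => g • x) (degConn J I hf hθ l).1
      = (degConn J I hf hθ (l ∘ₗ Ad J g)).1 := by
  funext x
  show pull (mfderiv I I (fun x : M => g • x) x).toLinearMap (oneForm (f (g • x) • (l ∘ₗ θ (g • x))))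
    = oneForm (f x • ((l ∘ₗ Ad J g) ∘ₗ θ x))
  rw [pull_oneForm, hf.invariant]
  congr 1
  by_cases hx : x ∈ singularSet G M
  · rw [eq_zero_of_mem_singularSet I hf hx, zero_smul, zero_smul, LinearMap.zero_comp]
  · refine LinearMap.ext fun v => ?_
    exact congrArg (fun z => f x * l z) (hθ.equivariant g x hx v)

/-- The action of the group on the degenerate connection. -/
theorem actForm_degConn (hf : IsCutoff I G f) (hθ : IsConnection J I θ) (g : G)
    (l : Dual ℝ (GroupLieAlgebra J G)) :
    actForm J I g (degConn J I hf hθ l) = degConn J I hf hθ (l ∘ₗ Ad J g⁻¹) :=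
  Subtype.ext (roughPullback_degConn J I hf hθ g⁻¹ l)

variable [J.Boundaryless]

theorem chartInvD_fderiv_smul (ξ : GroupLieAlgebra J G) (x : M) {y : E}
    (hy : y ∈ (extChartAt I x).target) :
    chartInvD I x y (fderiv ℝ (fun a => extChartAt I x
      ((extChartAt J (1 : G)).symm a • (extChartAt I x).symm y)) (extChartAt J (1 : G) 1) ξ)
      = - fundVF J I ξ ((extChartAt I x).symm y) := by
  set z := (extChartAt I x).symm y with hz
  set φ := extChartAt J (1 : G)
  have hr1 : φ.symm (φ 1) = 1 := extChartAt_to_inv 1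
  have hzy : extChartAt I x (φ.symm (φ 1) • z) = y := by
    rw [hr1, one_smul]; exact (extChartAt I x).right_inv hy
  have h1 := mfderiv_mfderivWithin_extChartAt_symm (smul_contMDiff_left J I z) (c := (1 : G))
    (c' := x) (y := φ 1) (mem_extChartAt_target _) (by
      rw [extChartAt_to_inv, one_smul]; exact (extChartAt I x).map_target hy) ξ
  have e1 : (mfderivWithin 𝓘(ℝ, EG) J φ.symm (range J) (φ 1) ξ : EG) = ξ :=
    mfderivWithin_symm_one J ξ
  have e2 : (mfderiv J I (fun g : G => g • z) (φ.symm (φ 1)) : EG →L[ℝ] E)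
      = (mfderiv J I (fun g : G => g • z) 1 : EG →L[ℝ] E) :=
    congrArg (fun p : G => (show EG →L[ℝ] E from mfderiv J I (fun g : G => g • z) p)) hr1
  have e3 := congrArg₂ (fun (T : EG →L[ℝ] E) (w : EG) => T w) e2 e1
  have e4 := congrArg (fun p : E => (show E →L[ℝ] E from
    mfderivWithin 𝓘(ℝ, E) I (extChartAt I x).symm (range I) p)
      (fderivWithin ℝ (extChartAt I x ∘ (fun g : G => g • z) ∘ φ.symm) (range J) (φ 1) ξ)) hzy
  have e5 := e3.symm.trans (h1.trans e4)
  rw [J.range_eq_univ, fderivWithin_univ] at e5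
  refine e5.symm.trans ?_
  exact (neg_neg _).symm

theorem contDiffWithinAt_smul_chart (x : M) :
    ContDiffWithinAt ℝ ∞ (fun p : EG × E => extChartAt I x
        ((extChartAt J (1 : G)).symm p.1 • (extChartAt I x).symm p.2))
      (univ ×ˢ range I) (extChartAt J (1 : G) 1, extChartAt I x x) :=
  have : IsManifold J ∞ G := LieGroup.toContMDiffMul.toIsManifold
  contDiffWithinAt_chart_prod (J := J) (I := I) (I' := I)
    (ContMDiffSMul.contMDiff_smul (I := J) (I' := I) (n := ∞) (G := G) (M := M))
    (g := 1) (x := x) (c' := x) (by simp)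

end DegenerateConnection

section DegenerateConnection

variable {E : Type*} [NormedAddCommGroup E] [NormedSpace ℝ E] [FiniteDimensional ℝ E]
  {H : Type*} [TopologicalSpace H]
  {EG : Type*} [NormedAddCommGroup EG] [NormedSpace ℝ EG] [FiniteDimensional ℝ EG]
  {HG : Type*} [TopologicalSpace HG]
  (J : ModelWithCorners ℝ EG HG) (I : ModelWithCorners ℝ E H)
  {G : Type*} [TopologicalSpace G] [ChartedSpace HG G] [Group G]
  {M : Type*} [TopologicalSpace M] [ChartedSpace H M] [MulAction G M]
  [IsManifold I ∞ M] {f : M → ℝ}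
  {θ : (x : M) → TangentSpace I x →ₗ[ℝ] GroupLieAlgebra J G}
  [LieGroup J ∞ G] [ContMDiffSMul J I ∞ G M]

theorem chartRep_degConn (hf : IsCutoff I G f) (hθ : IsConnection J I θ)
    (l : Dual ℝ (GroupLieAlgebra J G)) (c : M) (y : E) :
    chartRep I (degConn J I hf hθ l).1 c y
      = oneForm ((f ((extChartAt I c).symm y) • (l ∘ₗ θ ((extChartAt I c).symm y)))
          ∘ₗ chartInvD I c y) :=
  pull_oneForm _ _

variable [J.Boundaryless]

theorem degreeOne_chartRep_degConn (hf : IsCutoff I G f) (hθ : IsConnection J I θ)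
    (l : Dual ℝ (GroupLieAlgebra J G)) (c : M) (y v : E) :
    degreeOne (chartRep I (degConn J I hf hθ l).1 c y) v
      = f ((extChartAt I c).symm y) * l (θ ((extChartAt I c).symm y) (chartInvD I c y v)) := by
  rw [chartRep_degConn, degreeOne_oneForm]
  rfl

/-- Cartan's formula for the degenerate connection, in a chart. -/
theorem fderivWithin_degConn (hf : IsCutoff I G f) (hθ : IsConnection J I θ)
    (ξ : GroupLieAlgebra J G) (l : Dual ℝ (GroupLieAlgebra J G)) (x : M) (Z v : E)
    (hZ : Z = fderiv ℝ (fun a => extChartAt I x ((extChartAt J (1 : G)).symm a •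
      (extChartAt I x).symm (extChartAt I x x))) (extChartAt J (1 : G) 1) ξ) :
    fderivWithin ℝ (fun y => degreeOne (chartRep I (degConn J I hf hθ l).1 x y)) (range I)
        (extChartAt I x x) Z v
      - fderivWithin ℝ (fun y => degreeOne (chartRep I (degConn J I hf hθ l).1 x y)) (range I)
        (extChartAt I x x) v Z
      = degreeOne (chartRep I (degConn J I hf hθ (coad J ξ l)).1 x (extChartAt I x x)) v
        + l ξ * fderivWithin ℝ (fun y => f ((extChartAt I x).symm y)) (range I)
          (extChartAt I x x) v := by
  set φ := extChartAt J (1 : G) with hφ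
  set ψ := extChartAt I x with hψ
  set y₀ := ψ x with hy₀
  have hr : y₀ ∈ range I := mem_range_self _
  have hr1 : φ.symm (φ 1) = 1 := extChartAt_to_inv 1
  have hx0 : ψ.symm y₀ = x := extChartAt_to_inv x
  set η : GroupLieAlgebra J G := θ (ψ.symm y₀) (chartInvD I x y₀ v) with hη
  obtain ⟨L, hL, hL'⟩ := exists_hasFDerivAt_Ad J η
  let l' : EG →ₗ[ℝ] ℝ := l
  have hρ : HasFDerivAt (fun a => f (ψ.symm y₀) * l (Ad J (φ.symm a) η))
      (f (ψ.symm y₀) • (LinearMap.toContinuousLinearMap l' ∘L L)) (φ 1) :=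
    ((LinearMap.toContinuousLinearMap l').hasFDerivAt.comp (φ 1) hL).const_mul (f (ψ.symm y₀))
  have hsf : DifferentiableWithinAt ℝ (fun y => f (ψ.symm y)) (range I) y₀ := by
    have := contDiffWithinAt_chart hf.smooth (mem_extChartAt_source (I := I) x) (c' := f x)
      (mem_extChartAt_source (I := 𝓘(ℝ, ℝ)) (f x))
    rw [extChartAt_model_space_eq_id] at this
    exact this.differentiableWithinAt (by simp)
  have hk : HasFDerivWithinAt (fun y => - (l ξ) * f (ψ.symm y))
      (- (l ξ) • fderivWithin ℝ (fun y => f (ψ.symm y)) (range I) y₀) (range I) y₀ :=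
    hsf.hasFDerivWithinAt.const_mul _
  have hΨ := contDiffWithinAt_smul_chart J I (G := G) x
  have hev : ∀ᶠ y in 𝓝[range I] y₀, y ∈ ψ.target :=
    extChartAt_target_mem_nhdsWithin (I := I) x
  have hact : ∀ᶠ a in 𝓝 (φ 1), φ.symm a • ψ.symm y₀ ∈ ψ.source := by
    have h1 : ContinuousAt (fun a => φ.symm a • ψ.symm y₀) (φ 1) :=
      (smul_contMDiff_left J I (ψ.symm y₀)).continuous.continuousAt.comp
        (continuousAt_extChartAt_symm (1 : G))
    refine h1 ((isOpen_extChartAt_source (I := I) x).mem_nhds ?_)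
    show φ.symm (φ 1) • ψ.symm y₀ ∈ ψ.source
    rw [hr1, one_smul, hx0]
    exact mem_extChartAt_source x
  have main := fderivWithin_oneForm_of_pullback hΨ I.uniqueDiffOn hr
    (I.range_subset_closure_interior hr) (hev.mono fun y hy => by
      show ψ (φ.symm (φ 1) • ψ.symm y) = y
      rw [hr1, one_smul, ψ.right_inv hy])
    (Eventually.of_forall fun a => mem_range_self _)
    (α := fun y => degreeOne (chartRep I (degConn J I hf hθ l).1 x y))
    ((LinearMap.toContinuousLinearMap (degreeOne (E := E))).differentiableAt.comp_differentiableWithinAt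
      y₀ (smoothFormAt_differentiable I ((degConn J I hf hθ l).2 x))) ξ v hρ
    (hact.mono fun a ha => by
      have h1 := chartRep_pullback_apply I (smul_contMDiff J I (φ.symm a)) (degConn J I hf hθ l).1 x x
        (mem_extChartAt_target x) ha
      rw [roughPullback_degConn] at h1
      have h2 := congrArg (fun u => degreeOne u v) h1
      simp only [degreeOne_chartRep_degConn] at h2
      rw [chartRep_degConn, pull_oneForm, degreeOne_oneForm] at h2
      show degreeOne (chartRep I (degConn J I hf hθ l).1 x (ψ (φ.symm a • ψ.symm y₀))) _ = _
      rw [chartRep_degConn, degreeOne_oneForm]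
      exact h2.symm)
    hk
    (hev.mono fun y hy => by
      show degreeOne (chartRep I (degConn J I hf hθ l).1 x y) _ = _
      rw [degreeOne_chartRep_degConn]
      have h1 := chartInvD_fderiv_smul J I ξ x hy
      have h2 := congrArg (fun u => f (ψ.symm y) * l (θ (ψ.symm y) u)) h1
      refine h2.trans ?_
      have h3 := smul_reproduces J I hf hθ ξ l (ψ.symm y)
      simp only [map_neg, mul_neg, neg_mul]
      rw [mul_comm (l ξ)]
      exact congrArg Neg.neg h3)
  rw [hZ, degreeOne_chartRep_degConn]
  refine main.trans ?_
  set T := fderivWithin ℝ (fun y => f (ψ.symm y)) (range I) y₀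
  show f (ψ.symm y₀) * l (L ξ) - (- (l ξ) * T v) = f (ψ.symm y₀) * l ⁅ξ, η⁆ + l ξ * T v
  have h3 : l (L ξ) = l ⁅ξ, η⁆ := congrArg l (hL' ξ)
  rw [h3]
  ring

/-- Cartan's formula for the degenerate connection:
`ι_ξ d⟨l, θ_f⟩ = - ⟨l ∘ ad ξ, θ_f⟩ - l(ξ) df`. -/
theorem contrForm_dForm_degConn (hf : IsCutoff I G f) (hθ : IsConnection J I θ)
    (ξ : GroupLieAlgebra J G) (l : Dual ℝ (GroupLieAlgebra J G)) :
    contrForm J I ξ (dForm I (degConn J I hf hθ l))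
      = - degConn J I hf hθ (coad J ξ l) - l ξ • dForm I (funForm I f hf.smooth) := by
  refine Subtype.ext <| funext fun x => ?_
  set y₀ := extChartAt I x x with hy₀
  set u := chartRep I (degConn J I hf hθ l).1 x with hu
  set X : E := chartD I x (fundVF J I ξ x) with hX
  set Z : E := fderiv ℝ (fun a => extChartAt I x ((extChartAt J (1 : G)).symm a •
      (extChartAt I x).symm y₀)) (extChartAt J (1 : G) 1) ξ with hZ
  have hXZ : X = -Z := by
    have h1 := chartInvD_fderiv_smul J I ξ x (mem_extChartAt_target (I := I) x)
    have h2 : chartInvD I x y₀ Z = Z := congrArg (fun T : E →L[ℝ] E => T Z)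
      (mfderivWithin_range_extChartAt_symm (I := I) (x := x))
    have h3 := congrArg (fun p : M => (show E from fundVF J I ξ p)) (extChartAt_to_inv (I := I) x)
    have h4 : (Z : E) = - (show E from fundVF J I ξ x) :=
      (h2.symm.trans h1).trans (congrArg (fun e : E => -e) h3)
    rw [h4, neg_neg]
    exact chartD_eq I x _
  have hw : chartRep I (funForm I f hf.smooth).1 x
      = fun y => algebraMap ℝ (Form E) (f ((extChartAt I x).symm y)) :=
    funext fun y => AlgHom.commutes _ _
  have hsf : DifferentiableWithinAt ℝ (fun y => f ((extChartAt I x).symm y)) (range I) y₀ := by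
    have := contDiffWithinAt_chart hf.smooth (mem_extChartAt_source (I := I) x) (c' := f x)
      (mem_extChartAt_source (I := 𝓘(ℝ, ℝ)) (f x))
    rw [extChartAt_model_space_eq_id] at this
    exact this.differentiableWithinAt (by simp)
  have hone : oneForm ((f ((extChartAt I x).symm y₀) • (coad J ξ l ∘ₗ
      θ ((extChartAt I x).symm y₀))) ∘ₗ chartInvD I x y₀)
      = chartRep I (degConn J I hf hθ (coad J ξ l)).1 x y₀ :=
    (chartRep_degConn J I hf hθ _ x y₀).symm
  have key : contr X (extd (range I) u y₀)
      = - chartRep I (degConn J I hf hθ (coad J ξ l)).1 x y₀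
        - l ξ • extd (range I) (chartRep I (funForm I f hf.smooth).1 x) y₀ := by
    rw [hw, extd_algebraMap hsf (uniqueDiff_chart I x), contr_extd_oneForm
      (smoothFormAt_differentiable I ((degConn J I hf hθ l).2 x)) (uniqueDiff_chart I x)
      (fun z => ⟨_, chartRep_degConn J I hf hθ l x z⟩), ← hone, ← oneFormL_degreeOne, hone,
      ← map_neg, ← map_smul, ← map_sub]
    congr 1
    ext v
    have h1 := fderivWithin_degConn J I hf hθ ξ l x Z v hZ
    rw [hXZ]
    simp only [map_neg, sub_apply, neg_apply, smul_apply, smul_eq_mul,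
      ContinuousLinearMap.flip_apply]
    rw [← hu, ← hy₀] at h1
    linarith
  show contr (fundVF J I ξ x) (pull (chartD I x) (extd (range I) u y₀))
    = - (degConn J I hf hθ (coad J ξ l)).1 x
      - l ξ • pull (chartD I x) (extd (range I) (chartRep I (funForm I f hf.smooth).1 x) y₀)
  rw [← pull_contr, ← hX, key, map_sub, map_neg, pull_chartRep_self, map_smul]

end DegenerateConnection

/-! ### The degenerate Chern–Weil homomorphism -/

section AbstractEquivariance

variable {Ω κ : Type*} [Ring Ω] [Algebra ℝ Ω] [Fintype κ]

/-- Linear changes of the connection which respect the structure constants act in the same way on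
the curvature. -/
theorem map_curvatureComponent {d : Ω →ₗ[ℝ] Ω} {φ : Ω →ₐ[ℝ] Ω} (hd : ∀ u, d (φ u) = φ (d u))
    {θ : κ → Ω} {m : κ → κ → ℝ} (hθ : ∀ a, φ (θ a) = ∑ p, m a p • θ p) {C : κ → κ → κ → ℝ}
    (hC : ∀ a p q, ∑ c, ∑ e, C a c e * (m c p * m e q) = ∑ r, m a r * C r p q) (a : κ) :
    φ (curvatureComponent d θ C a) = ∑ r, m a r • curvatureComponent d θ C r := by
  have h1 : ∑ c, ∑ e, C a c e • (φ (θ c) * φ (θ e))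
      = ∑ r, m a r • ∑ p, ∑ q, C r p q • (θ p * θ q) := by
    have h2 : ∀ c e, C a c e • (φ (θ c) * φ (θ e))
        = ∑ p, ∑ q, (C a c e * (m c p * m e q)) • (θ p * θ q) := fun c e => by
      rw [hθ, hθ, Finset.sum_mul_sum]
      simp only [Finset.smul_sum, smul_mul_smul_comm, smul_smul]
    have h3 : ∀ r, m a r • ∑ p, ∑ q, C r p q • (θ p * θ q)
        = ∑ p, ∑ q, (m a r * C r p q) • (θ p * θ q) := fun r => by
      simp only [Finset.smul_sum, smul_smul]
    simp only [h2, h3]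
    have h4 : ∀ c, ∑ e, ∑ p, ∑ q, (C a c e * (m c p * m e q)) • (θ p * θ q)
        = ∑ p, ∑ q, (∑ e, C a c e * (m c p * m e q)) • (θ p * θ q) := fun c => by
      rw [Finset.sum_comm]
      refine Finset.sum_congr rfl fun p _ => ?_
      rw [Finset.sum_comm]
      simp only [Finset.sum_smul]
    simp only [h4]
    rw [Finset.sum_comm, Finset.sum_comm (s := Finset.univ) (t := Finset.univ)
      (f := fun r p => ∑ q, (m a r * C r p q) • (θ p * θ q))]
    refine Finset.sum_congr rfl fun p _ => ?_
    rw [Finset.sum_comm, Finset.sum_comm (s := Finset.univ) (t := Finset.univ)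
      (f := fun r q => (m a r * C r p q) • (θ p * θ q))]
    refine Finset.sum_congr rfl fun q _ => ?_
    rw [← Finset.sum_smul, ← Finset.sum_smul, hC]
  simp only [curvatureComponent, map_add, map_smul, map_sum, map_mul, ← hd, hθ a] at h1 ⊢
  rw [h1]
  simp only [smul_add, Finset.sum_add_distrib, Finset.smul_sum, smul_comm (1 / 2 : ℝ)]

end AbstractEquivariance

section ChernWeilHom

variable {E : Type*} [NormedAddCommGroup E] [NormedSpace ℝ E] [FiniteDimensional ℝ E]
  {H : Type*} [TopologicalSpace H]
  {EG : Type*} [NormedAddCommGroup EG] [NormedSpace ℝ EG] [FiniteDimensional ℝ EG]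
  {HG : Type*} [TopologicalSpace HG]
  (J : ModelWithCorners ℝ EG HG) (I : ModelWithCorners ℝ E H)
  {G : Type*} [TopologicalSpace G] [ChartedSpace HG G] [Group G]
  {M : Type*} [TopologicalSpace M] [ChartedSpace H M] [MulAction G M]
  [IsManifold I ∞ M] {f : M → ℝ}
  {θ : (x : M) → TangentSpace I x →ₗ[ℝ] GroupLieAlgebra J G}

theorem degConn_sum_smul {κ : Type*} [Fintype κ] (hf : IsCutoff I G f) (hθ : IsConnection J I θ)
    (r : κ → ℝ) (l : κ → Dual ℝ (GroupLieAlgebra J G)) :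
    degConn J I hf hθ (∑ a, r a • l a) = ∑ a, r a • degConn J I hf hθ (l a) := by
  let D : Dual ℝ (GroupLieAlgebra J G) →ₗ[ℝ] DiffForm I M :=
    { toFun := degConn J I hf hθ
      map_add' := fun l l' => Subtype.ext <| funext fun x => by
        show oneForm (f x • ((l + l') ∘ₗ θ x)) = oneForm (f x • (l ∘ₗ θ x))
          + oneForm (f x • (l' ∘ₗ θ x))
        rw [LinearMap.add_comp, smul_add, map_add]
      map_smul' := fun c l => Subtype.ext <| funext fun x => by
        show oneForm (f x • ((c • l) ∘ₗ θ x)) = c • oneForm (f x • (l ∘ₗ θ x))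
        rw [LinearMap.smul_comp, smul_comm, map_smul] }
  show D _ = ∑ a, r a • D (l a)
  simp only [map_sum, map_smul]

theorem parityForm_degConn (hf : IsCutoff I G f) (hθ : IsConnection J I θ)
    (l : Dual ℝ (GroupLieAlgebra J G)) :
    parityForm I (degConn J I hf hθ l) = - degConn J I hf hθ l :=
  Subtype.ext <| funext fun _ => parity_oneForm _

theorem degConn_mul_swap (hf : IsCutoff I G f) (hθ : IsConnection J I θ)
    (l m : Dual ℝ (GroupLieAlgebra J G)) :
    degConn J I hf hθ l * degConn J I hf hθ m = - (degConn J I hf hθ m * degConn J I hf hθ l) :=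
  Subtype.ext <| funext fun _ => oneForm_mul_swap _ _

theorem commute_funForm (hf : ContMDiff I 𝓘(ℝ, ℝ) ∞ f) (u : DiffForm I M) :
    Commute (funForm I f hf) u :=
  Subtype.ext <| funext fun x => Algebra.commutes (A := Form (TangentSpace I x)) (f x) (u.1 x)

variable [LieGroup J ∞ G] [ContMDiffSMul J I ∞ G M]

theorem contrForm_funForm (hf : ContMDiff I 𝓘(ℝ, ℝ) ∞ f) (ξ : GroupLieAlgebra J G) :
    contrForm J I ξ (funForm I f hf) = 0 :=
  Subtype.ext <| funext fun _ => contr_algebraMap _ _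

theorem contrForm_degConn (hf : IsCutoff I G f) (hθ : IsConnection J I θ)
    (ξ : GroupLieAlgebra J G) (l : Dual ℝ (GroupLieAlgebra J G)) :
    contrForm J I ξ (degConn J I hf hθ l) = l ξ • funForm I f hf.smooth := by
  refine Subtype.ext <| funext fun x => ?_
  show contr (fundVF J I ξ x) (oneForm (f x • (l ∘ₗ θ x)))
    = l ξ • algebraMap ℝ (Form (TangentSpace I x)) (f x)
  rw [contr_oneForm, Algebra.smul_def, ← map_mul, mul_comm (l ξ)]
  exact congrArg _ (smul_reproduces J I hf hθ ξ l x)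

end ChernWeilHom

section ChernWeilHom

variable {E : Type*} [NormedAddCommGroup E] [NormedSpace ℝ E] [FiniteDimensional ℝ E]
  {H : Type*} [TopologicalSpace H]
  {EG : Type*} [NormedAddCommGroup EG] [NormedSpace ℝ EG] [FiniteDimensional ℝ EG]
  {HG : Type*} [TopologicalSpace HG]
  (J : ModelWithCorners ℝ EG HG) (I : ModelWithCorners ℝ E H)
  {G : Type*} [TopologicalSpace G] [ChartedSpace HG G] [Group G]
  {M : Type*} [TopologicalSpace M] [ChartedSpace H M] [MulAction G M]
  [IsManifold I ∞ M] {f : M → ℝ}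
  {θ : (x : M) → TangentSpace I x →ₗ[ℝ] GroupLieAlgebra J G}
  [LieGroup J ∞ G] [ContMDiffSMul J I ∞ G M] {κ : Type*} [Fintype κ]
  (b : Basis κ ℝ (GroupLieAlgebra J G))

theorem degCurvature_eq (hf : IsCutoff I G f) (hθ : IsConnection J I θ) (a : κ) :
    degCurvature J I b hf hθ a
      = 1 ⊗ₜ[ℝ] curvatureComponent (dForm I) (fun c => degConn J I hf hθ (b.coord c))
          (structureConst J b) a - Theta J b a ⊗ₜ[ℝ] (-1 + funForm I f hf.smooth) :=
  rfl

theorem dual_eq_sum_coord {V : Type*} [AddCommGroup V] [Module ℝ V] (b : Basis κ ℝ V)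
    (l : Dual ℝ V) : l = ∑ q, l (b q) • b.coord q := by
  classical
  refine b.ext fun k => ?_
  simp

theorem sum_apply_mul_coord {V : Type*} [AddCommGroup V] [Module ℝ V] (b : Basis κ ℝ V)
    (l : Dual ℝ V) (v : V) : ∑ a, l (b a) * b.coord a v = l v := by
  conv_rhs => rw [← b.sum_repr v]
  simp only [map_sum, map_smul, smul_eq_mul, Basis.coord_apply]
  exact Finset.sum_congr rfl fun _ _ => mul_comm _ _

theorem cartanParity_degCurvature (hf : IsCutoff I G f) (hθ : IsConnection J I θ) (a : κ) :
    cartanParity J I (degCurvature J I b hf hθ a) = degCurvature J I b hf hθ a := by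
  have h1 : parityForm I (funForm I f hf.smooth) = funForm I f hf.smooth :=
    Subtype.ext <| funext fun x => AlgHom.commutes _ _
  have h2 : parityForm I (dForm I (degConn J I hf hθ (b.coord a)))
      = dForm I (degConn J I hf hθ (b.coord a)) := by
    have := dForm_parityForm I (degConn J I hf hθ (b.coord a))
    rw [parityForm_degConn, map_neg, neg_inj] at this
    exact this.symm
  rw [degCurvature_eq, curvatureComponent, cartanParity, map_sub, Algebra.TensorProduct.map_tmul,
    Algebra.TensorProduct.map_tmul, map_add, map_add, map_smul, h2, map_neg, map_one, h1, map_one]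
  simp only [map_sum, map_smul, map_mul, parityForm_degConn, neg_mul_neg, AlgHom.id_apply]

theorem cartanParity_chernWeil_ι (hf : IsCutoff I G f) (hθ : IsConnection J I θ)
    (l : Dual ℝ (GroupLieAlgebra J G)) :
    cartanParity J I (chernWeil J I b hf hθ (SymmetricAlgebra.ι ℝ _ l))
      = chernWeil J I b hf hθ (SymmetricAlgebra.ι ℝ _ l) := by
  rw [chernWeil_ι, map_sum]
  simp only [map_smul, cartanParity_degCurvature]

theorem chernWeil_commute (hf : IsCutoff I G f) (hθ : IsConnection J I θ) (F : Poly J G)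
    (α : CartanAlg J I G M) : Commute (chernWeil J I b hf hθ F) α := by
  have h : chernWeil J I b hf hθ F ∈ Subalgebra.center ℝ (CartanAlg J I G M) :=
    Subtype.property _
  exact ((Subalgebra.mem_center_iff.mp h) α).symm

variable [J.Boundaryless]

/-- The Bianchi identity for the equivariant degenerate curvature. -/
theorem cartanD_degCurvature (hf : IsCutoff I G f) (hθ : IsConnection J I θ) (a : κ) :
    cartanD J I b (degCurvature J I b hf hθ a)
      = - ∑ r, ∑ e, structureConst J b a r e •
          ((1 ⊗ₜ[ℝ] degConn J I hf hθ (b.coord r)) * degCurvature J I b hf hθ e) := by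
  classical
  refine tensorD_equivariantCurvature (p := parityForm I)
    (θ := fun c => degConn J I hf hθ (b.coord c)) (f := funForm I f hf.smooth)
    (C := structureConst J b) (dForm_mul I) (fun a => contrForm_mul J I (b a))
    (fun a => dForm_dForm I _) (fun a => parityForm_degConn J I hf hθ _)
    (fun a e => degConn_mul_swap J I hf hθ _ _) (fun a u => dForm_oneForm_mem_center I _ _ u)
    (commute_funForm I hf.smooth) (structureConst_swap J b) (structureConst_jacobi J b)
    (fun a e => ?_) (fun a => contrForm_funForm J I hf.smooth (b a)) (fun e a => ?_) a
  · rw [contrForm_degConn, Basis.coord_apply, b.repr_self, Finsupp.single_apply, ite_smul,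
      one_smul, zero_smul]
  · rw [contrForm_dForm_degConn, dual_eq_sum_coord b (coad J (b e) (b.coord a)), degConn_sum_smul,
      Basis.coord_apply, b.repr_self, Finsupp.single_apply, ite_smul, one_smul, zero_smul]
    rfl

/-- Values of the Chern–Weil map on invariant polynomials are closed. -/
theorem cartanD_chernWeil (hf : IsCutoff I G f) (hθ : IsConnection J I θ) {F : Poly J G}
    (hF : F ∈ invPoly J G) : cartanD J I b (chernWeil J I b hf hθ F) = 0 := by
  classical
  choose δ hδ hδι using fun a : κ => exists_derivation_symmetricAlgebra b.dualBasis (coad J (b a))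
  rw [differential_algHom_symmetricAlgebra (cartanD_mul J I b) (chernWeil_commute J I b hf hθ)
    (cartanParity_chernWeil_ι J I b hf hθ)
    (T := fun a => 1 ⊗ₜ[ℝ] degConn J I hf hθ (b.coord a)) hδ (fun l => ?_) F]
  · simp [fun a => derivation_eq_zero_of_mem_invPoly J b hF (b a) (hδ a) (hδι a)]
  · simp only [hδι, chernWeil_ι, map_sum, map_smul, cartanD_degCurvature, coad_apply]
    simp only [smul_neg, Finset.sum_neg_distrib, Finset.smul_sum, smul_smul, Finset.mul_sum,
      mul_smul_comm]
    rw [neg_inj, Finset.sum_comm]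
    refine Finset.sum_congr rfl fun r _ => ?_
    rw [Finset.sum_comm]
    refine Finset.sum_congr rfl fun e _ => ?_
    rw [← Finset.sum_smul]
    congr 1
    exact sum_apply_mul_coord b l _

theorem actForm_funForm (hf : IsCutoff I G f) (g : G) :
    actForm J I g (funForm I f hf.smooth) = funForm I f hf.smooth := by
  refine Subtype.ext <| funext fun x => ?_
  show pull _ (algebraMap ℝ (Form (TangentSpace I (g⁻¹ • x))) (f (g⁻¹ • x)))
    = algebraMap ℝ (Form (TangentSpace I x)) (f x)
  rw [AlgHom.commutes, hf.invariant]

theorem actCartan_degCurvature (hf : IsCutoff I G f) (hθ : IsConnection J I θ) (g : G) (a : κ) :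
    actCartan J I g (degCurvature J I b hf hθ a)
      = ∑ e, b.coord a (Ad J g⁻¹ (b e)) • degCurvature J I b hf hθ e := by
  have h1 : actForm J I g (curvatureComponent (dForm I)
      (fun c => degConn J I hf hθ (b.coord c)) (structureConst J b) a)
      = ∑ e, b.coord a (Ad J g⁻¹ (b e)) • curvatureComponent (dForm I)
        (fun c => degConn J I hf hθ (b.coord c)) (structureConst J b) e := by
    refine map_curvatureComponent (m := fun a e => b.coord a (Ad J g⁻¹ (b e)))
      (fun u => dForm_pullbackForm I _ _ u) (fun c => ?_) (fun c p q => ?_) a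
    · show actForm J I g (degConn J I hf hθ (b.coord c)) = _
      rw [actForm_degConn, dual_eq_sum_coord b (b.coord c ∘ₗ Ad J g⁻¹), degConn_sum_smul]
      rfl
    · have : LieGroup J (minSmoothness ℝ 3) G := LieGroup.of_le (n := ∞) (by simp; norm_cast)
      have h2 := congrArg (b.coord c) (Ad_lie J g⁻¹ (b p) (b q))
      have h3 : b.coord c (Ad J g⁻¹ ⁅b p, b q⁆)
          = ∑ r, b.coord c (Ad J g⁻¹ (b r)) * structureConst J b r p q := by
        conv_lhs => rw [← b.sum_repr ⁅b p, b q⁆]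
        simp only [map_sum, map_smul, smul_eq_mul]
        exact Finset.sum_congr rfl fun r _ => mul_comm _ _
      rw [← h3, h2]
      conv_rhs => rw [← b.sum_repr (Ad J g⁻¹ (b p)), ← b.sum_repr (Ad J g⁻¹ (b q))]
      simp only [sum_lie, lie_sum, smul_lie, lie_smul, map_sum, map_smul, smul_eq_mul]
      rw [Finset.sum_comm]
      refine Finset.sum_congr rfl fun e _ => ?_
      rw [Finset.mul_sum]
      refine Finset.sum_congr rfl fun r _ => ?_
      simp only [structureConst, Basis.coord_apply]
      ring
  have h2 : actPoly J g (Theta J b a) = ∑ e, b.coord a (Ad J g⁻¹ (b e)) • Theta J b e := by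
    rw [Theta, actPoly, SymmetricAlgebra.lift_ι_apply]
    simp only [Theta, ← map_smul, ← map_sum]
    exact congrArg (SymmetricAlgebra.ι ℝ (Dual ℝ (GroupLieAlgebra J G)))
      (dual_eq_sum_coord b (b.coord a ∘ₗ Ad J g⁻¹))
  rw [degCurvature_eq, actCartan, map_sub, Algebra.TensorProduct.map_tmul,
    Algebra.TensorProduct.map_tmul, h1, h2, map_add, map_neg, map_one, map_one,
    actForm_funForm J I hf]
  simp only [degCurvature_eq, smul_sub, Finset.sum_sub_distrib, TensorProduct.tmul_sum,
    TensorProduct.tmul_smul, TensorProduct.sum_tmul, TensorProduct.smul_tmul']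

/-- The Chern–Weil map is equivariant. -/
theorem actCartan_chernWeil (hf : IsCutoff I G f) (hθ : IsConnection J I θ) (g : G)
    (F : Poly J G) :
    actCartan J I g (chernWeil J I b hf hθ F) = chernWeil J I b hf hθ (actPoly J g F) := by
  induction F using SymmetricAlgebra.induction with
  | algebraMap r => simp only [AlgHom.commutes]
  | ι l =>
    rw [actPoly, SymmetricAlgebra.lift_ι_apply]
    show actCartan J I g (chernWeil J I b hf hθ (SymmetricAlgebra.ι ℝ _ l))
      = chernWeil J I b hf hθ (SymmetricAlgebra.ι ℝ _ (l ∘ₗ Ad J g⁻¹))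
    rw [chernWeil_ι, chernWeil_ι, map_sum]
    simp only [map_smul, actCartan_degCurvature, Finset.smul_sum, smul_smul]
    rw [Finset.sum_comm]
    refine Finset.sum_congr rfl fun e _ => ?_
    rw [← Finset.sum_smul]
    congr 1
    exact sum_apply_mul_coord b l _
  | mul x y hx hy => simp only [map_mul, hx, hy]
  | add x y hx hy => simp only [map_add, hx, hy]

theorem chernWeil_mem_closedForms (hf : IsCutoff I G f) (hθ : IsConnection J I θ) {F : Poly J G}
    (hF : F ∈ invPoly J G) : chernWeil J I b hf hθ F ∈ closedForms J I b (M := M) :=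
  ⟨fun g => by rw [actCartan_chernWeil, hF g], cartanD_chernWeil J I b hf hθ hF⟩

/-- The Chern–Weil map, from invariant polynomials to cocycles. -/
def chernWeilCocycle (hf : IsCutoff I G f) (hθ : IsConnection J I θ) :
    invPoly J G →ₐ[ℝ] Cocycle J I M b :=
  ((chernWeil J I b hf hθ).comp (invPoly J G).val).codRestrict (closedForms J I b)
    fun F => chernWeil_mem_closedForms J I b hf hθ F.2

end ChernWeilHom

end

end DegCW

theorem theorem2p1
    -- a compact connected Lie group `G`, with a basis `b = (ξ_a)` of its Lie algebra
    {EG : Type*} [NormedAddCommGroup EG] [NormedSpace ℝ EG] [FiniteDimensional ℝ EG]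
    {HG : Type*} [TopologicalSpace HG] (J : ModelWithCorners ℝ EG HG) [J.Boundaryless]
    {G : Type*} [TopologicalSpace G] [ChartedSpace HG G] [Group G] [LieGroup J ∞ G]
    [T2Space G] [CompactSpace G] [ConnectedSpace G]
    {κ : Type*} [Fintype κ] (b : Module.Basis κ ℝ (GroupLieAlgebra J G))
    -- a compact smooth manifold `W`, possibly with boundary, with a smooth action of `G`
    {E : Type*} [NormedAddCommGroup E] [NormedSpace ℝ E] [FiniteDimensional ℝ E]
    {H : Type*} [TopologicalSpace H] (I : ModelWithCorners ℝ E H)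
    {W : Type*} [TopologicalSpace W] [ChartedSpace H W] [IsManifold I ∞ W]
    [T2Space W] [CompactSpace W]
    [MulAction G W] [ContMDiffSMul J I ∞ G W]
    -- which is a degenerate principal bundle, with a degenerate connection `f θ`
    (_hW : DegCW.IsDegeneratePrincipalBundle I (M := W) G)
    {f : W → ℝ} (hf : DegCW.IsCutoff I G f)
    {θ : (x : W) → TangentSpace I x →ₗ[ℝ] GroupLieAlgebra J G} (hθ : DegCW.IsConnection J I θ) :
    -- invariant polynomials are sent to `D`-closed equivariant forms
    (∀ F ∈ DegCW.invPoly J G, DegCW.chernWeil J I b hf hθ F ∈ DegCW.EquivForm J I G W ∧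
      DegCW.cartanD J I b (DegCW.chernWeil J I b hf hθ F) = 0) ∧
    -- polynomials of degree `q` are sent to elements of degree `2 q`
    (∀ (q : ℕ), ∀ F ∈ DegCW.polyDeg J G q,
      DegCW.chernWeil J I b hf hθ F ∈ DegCW.cartanDeg J I G W (2 * q)) ∧
    -- the induced homomorphism of algebras from invariant polynomials to equivariant cohomology
    ∃ cw : DegCW.invPoly J G →ₐ[ℝ] DegCW.EquivCohomology J I W b,
      ∀ F : DegCW.invPoly J G, ∃ h : DegCW.chernWeil J I b hf hθ F ∈ DegCW.closedForms J I b,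
        cw F = DegCW.cohomClass J I W b ⟨DegCW.chernWeil J I b hf hθ F, h⟩ := by
  refine ⟨fun F hF => DegCW.chernWeil_mem_closedForms J I b hf hθ hF,
    fun q F hF => DegCW.chernWeil_mem_cartanDeg J I b hf hθ q hF,
    (DegCW.cohomClass J I W b).comp (DegCW.chernWeilCocycle J I b hf hθ),
    fun F => ⟨DegCW.chernWeil_mem_closedForms J I b hf hθ F.2, rfl⟩⟩
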